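/- Let $3<p<5$, $s_p=\frac32-\frac2{p-1}$, and let $F=F(r,v,t)$ be a real-valued function of $r\ge 0$, $v\in\mathbb R$, $t\in\mathbb R$ with $|F(r,v,t)|\le |v|^p$. Let $u:\mathbb R^3\times\mathbb R\to\mathbb R$ be a radial (in $x$) solution, defined for all $t\in\mathbb R$, of $$\partial_t^2u-\Delta u=F(|x|,u,t).$$ This means: $u$ and $(x,t)\mapsto F(|x|,u(x,t),t)$ are measurable; $(u(\cdot,t),\partial_tu(\cdot,t))\in C(\mathbb R;\dot H^{s_p}\times\dot H^{s_p-1}(\mathbb R^3))$; the norm $$\|u\|_{Y(J)}=\left(\int_J\Big(\int_{\mathbb R^3}|u(x,t)|^{\frac{2p}{2-s_p}}dx\Big)^{\frac{2-s_p}{1+s_p}}dt\right)^{\frac{1+s_p}{2p}}$$ is finite for every bounded closed interval $J$; and for all $t,t_0\in\mathbb R$, in the sense of tempered distributions, $$u(\cdot,t)=\cos\big((t-t_0)\sqrt{-\Delta}\big)u(\cdot,t_0)+\frac{\sin((t-t_0)\sqrt{-\Delta})}{\sqrt{-\Delta}}\partial_tu(\cdot,t_0)+\int_{t_0}^t\frac{\sin((t-\tau)\sqrt{-\Delta})}{\sqrt{-\Delta}}F(|\cdot|,u(\cdot,\tau),\tau)\,d\tau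 .$$ Assume that the set $\{(u(\cdot,t),\partial_tu(\cdot,t)):t\in\mathbb R\}$ is pre-compact in $\dot H^{s_p}\times\dot H^{s_p-1}(\mathbb R^3)$. Then there are constants $A\in\mathbb R$ and $C,C_3,C_4>0$, independent of $t$, $x$ and $r$, such that for every $t\in\mathbb R$: 1. $\displaystyle |u(x,t)|\le\frac{C_3}{|x|}$ and $\displaystyle \left|u(x,t)-\frac A{|x|}\right|\le\frac{C}{|x|^{p-2}}$ for almost every $x\in\mathbb R^3$ (hence for every $x\ne0$ if the representative of $u(\cdot,t)$ that is continuous away from the origin is used); 2. on $\mathbb R^3\setminus\{0\}$ the distributions $\nabla u(\cdot,t)$ and $\partial_tu(\cdot,t)$ are locally integrable functions, and for every $r>0$ $$\int_{r<|x|<4r}\left(|\nabla u(x,t)|^2+|\partial_tu(x,t)|^2\right)dx\le C_4\,r^{-1}.$$ -/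

import Mathlib

open MeasureTheory
open scoped FourierTransform SchwartzMap ENNReal

noncomputable section

namespace RadialWave

/-- Three-dimensional Euclidean space. -/
abbrev E3 : Type := EuclideanSpace ℝ (Fin 3)

/-- The critical exponent `s_p = 3/2 - 2/(p-1)`. -/
def sCrit (p : ℝ) : ℝ := 3 / 2 - 2 / (p - 1)

/-- The symbol of `√(-Δ)`. Mathlib's Fourier transform uses the phase `exp(-2πi⟨x,ξ⟩)`,
so the symbol is `2π|ξ|`. -/
def freq (ξ : E3) : ℝ := 2 * Real.pi * ‖ξ‖

/-- The measure `(2π|ξ|)^{2s} dξ` on frequency space. -/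
def hdotMeasure (s : ℝ) : Measure E3 :=
  (volume : Measure E3).withDensity fun ξ => ENNReal.ofReal (freq ξ ^ (2 * s))

/-- The homogeneous Sobolev space `Ḣ^s(ℝ³)` for `-3/2 < s < 3/2`. Its elements are the tempered
distributions `f` whose Fourier transform is a function `g` with
`‖f‖² = ∫ (2π|ξ|)^{2s} |g(ξ)|² dξ < ∞`; an element is recorded by its Fourier transform `g`, and
the distribution itself is `Hdot.pair g`. -/
abbrev Hdot (s : ℝ) : Type := Lp ℂ 2 (hdotMeasure s)

/-- The action of the tempered distribution with Fourier transform `g` on a Schwartz function: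
`⟨f, φ⟩ = ⟨𝓕 f, 𝓕⁻¹ φ⟩`. The integral converges absolutely if `-3/2 < s < 3/2`. -/
def Hdot.pair {s : ℝ} (g : Hdot s) (φ : 𝓢(E3, ℂ)) : ℂ :=
  ∫ ξ, g ξ * (𝓕⁻ φ) ξ

/-- The function `f` is, as a tempered distribution, the element `g` of `Ḣ^s`. -/
def Hdot.IsFunction {s : ℝ} (g : Hdot s) (f : E3 → ℝ) : Prop :=
  ∀ φ : 𝓢(E3, ℂ), Integrable (fun x => (f x : ℂ) * φ x) ∧ ∫ x, (f x : ℂ) * φ x = g.pair φ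

/-- The element `g` of `Ḣ^s` is, as a distribution on the open set `Ω`, the locally integrable
function `f`. -/
def Hdot.IsFunctionOn {s : ℝ} (g : Hdot s) (Ω : Set E3) (f : E3 → ℝ) : Prop :=
  LocallyIntegrableOn f Ω ∧
    ∀ φ : 𝓢(E3, ℂ), HasCompactSupport φ → tsupport φ ⊆ Ω →
      ∫ x, (f x : ℂ) * φ x = g.pair φ

/-- `G` is the weak gradient of `f` on the open set `Ω`. -/
def IsWeakGradientOn (Ω : Set E3) (f : E3 → ℝ) (G : E3 → E3) : Prop :=
  LocallyIntegrableOn f Ω ∧ LocallyIntegrableOn G Ω ∧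
    ∀ φ : E3 → ℝ, ContDiff ℝ ((⊤ : ℕ∞) : WithTop ℕ∞) φ → HasCompactSupport φ → tsupport φ ⊆ Ω →
      ∀ e : E3, ∫ x, f x * fderiv ℝ φ x e = - ∫ x, inner ℝ (G x) e * φ x

/-- The symbol of `sin(t√(-Δ)) / √(-Δ)`. -/
def sinSymbol (t : ℝ) (ξ : E3) : ℝ := Real.sin (t * freq ξ) / freq ξ

/-- The free evolution `S_{L,0}(t)(u₀,u₁) = cos(t√(-Δ)) u₀ + (sin(t√(-Δ))/√(-Δ)) u₁`, as a
tempered distribution; `g₀`, `g₁` are the Fourier transforms of `u₀`, `u₁`. -/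
def freeWave {s : ℝ} (t : ℝ) (g₀ : Hdot s) (g₁ : Hdot (s - 1)) (φ : 𝓢(E3, ℂ)) : ℂ :=
  ∫ ξ, ((Real.cos (t * freq ξ) : ℂ) * g₀ ξ + (sinSymbol t ξ : ℂ) * g₁ ξ) * (𝓕⁻ φ) ξ

/-- The operator `sin(t√(-Δ)) / √(-Δ)` applied to a Schwartz function. -/
def sinPropagator (t : ℝ) (φ : 𝓢(E3, ℂ)) : E3 → ℂ :=
  𝓕⁻ (fun ξ : E3 => (sinSymbol t ξ : ℂ) * (𝓕 φ) ξ)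

/-- The Duhamel term `∫_{t₀}^t (sin((t-τ)√(-Δ))/√(-Δ)) G(τ) dτ`, as a tempered distribution. -/
def duhamel (G : ℝ → E3 → ℝ) (t₀ t : ℝ) (φ : 𝓢(E3, ℂ)) : ℂ :=
  ∫ τ in t₀..t, ∫ x, (G τ x : ℂ) * sinPropagator (t - τ) φ x

/-- The space-time norm `L^q L^r (I × ℝ³)`. -/
def mixedNorm (q r : ℝ) (I : Set ℝ) (f : ℝ → E3 → ℝ) : ℝ≥0∞ :=
  (∫⁻ t in I, (∫⁻ x, ‖f t x‖ₑ ^ r) ^ (q / r)) ^ (1 / q)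

/-- The norm `Y(I) = L^{2p/(1+s_p)} L^{2p/(2-s_p)} (I × ℝ³)`. -/
def normY (p : ℝ) (I : Set ℝ) (f : ℝ → E3 → ℝ) : ℝ≥0∞ :=
  mixedNorm (2 * p / (1 + sCrit p)) (2 * p / (2 - sCrit p)) I f

/-- `u : ℝ → ℝ³ → ℝ` is a solution of `∂_t² u - Δ u = F(|x|, u, t)` on the time interval `ℝ`.
Here `U t` and `V t` are the elements `u(·,t)` of `Ḣ^{s_p}` and `∂_t u(·,t)` of `Ḣ^{s_p-1}`. -/
structure IsGlobalSolution (p : ℝ) (F : ℝ → ℝ → ℝ → ℝ) (u : ℝ → E3 → ℝ)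
    (U : ℝ → Hdot (sCrit p)) (V : ℝ → Hdot (sCrit p - 1)) : Prop where
  isFunction : ∀ t, (U t).IsFunction (u t)
  hasDerivAt : ∀ (φ : 𝓢(E3, ℂ)) (t : ℝ), HasDerivAt (fun τ => (U τ).pair φ) ((V t).pair φ) t
  continuous_fst : Continuous U
  continuous_snd : Continuous V
  aestronglyMeasurable : AEStronglyMeasurable (fun z : ℝ × E3 => u z.1 z.2)
  aestronglyMeasurable_nonlinearity :
    AEStronglyMeasurable (fun z : ℝ × E3 => F ‖z.2‖ (u z.1 z.2) z.1)
  normY_lt_top : ∀ a b : ℝ, normY p (Set.Icc a b) u < ⊤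
  integral_equation : ∀ (t₀ t : ℝ) (φ : 𝓢(E3, ℂ)),
    (U t).pair φ = freeWave (t - t₀) (U t₀) (V t₀) φ
      + duhamel (fun τ x => F ‖x‖ (u τ x) τ) t₀ t φ

/-- The function `f` on `ℝ³` is radial. -/
def IsRadial (f : E3 → ℝ) : Prop := ∀ x y : E3, ‖x‖ = ‖y‖ → f x = f y

/-- The local energy `∫_{r<|x|<4r} (|∇u|² + |∂_t u|²) dx` of a pair of functions
`(G, v) = (∇u, ∂_t u)`. -/
def localEnergy (r : ℝ) (G : E3 → E3) (v : E3 → ℝ) : ℝ≥0∞ :=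
  ∫⁻ x in {x : E3 | r < ‖x‖ ∧ ‖x‖ < 4 * r}, ENNReal.ofReal (‖G x‖ ^ 2 + v x ^ 2)

end RadialWave

end

/-!
For a radial solution `u`, the profile `w = r u` solves the one-dimensional wave equation with
forcing term `r F`, and it is continuous in `r` because `s_p > 1/2`. By d'Alembert's formula
its increment along a null segment of length `h` starting at `(t, ρ)` is the increment of the free
wave with the data of time `t + N`, up to a term bounded by `h` times the integral of `r F` over an
outgoing null ray. Precompactness sends the free contribution to zero as `N → ∞`, and time reversal
gives the same bound backward in time. Thus a bound `|w| ≤ K r ^ (1 - b)` with `p b > 2` yields null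
increments of size `h r ^ (2 - p b)`, and since a space or a time increment is made of two null
increments, `w` is Lipschitz with the same size of constant.

The embedding of radial `Ḣ^{s_p}` gives `b = 2 / (p - 1)`, for which `r ^ (2 - p b)` integrates back
to `r ^ (1 - b)`. Precompactness makes the constant `K` small for large `r`; the superlinearity of
`K ↦ K ^ p` then turns the iteration over geometric scales into a gain of a power of `r`, whence
`b` can be taken close to `1`. As `p > 3`, the resulting Lipschitz constants are integrable at
infinity and `w` is bounded. With `b = 1` the null increments have size `h r ^ (2 - p)`, so that `w`
converges to a limit `A` independent of time, at the rate `r ^ (3 - p)`. Using this bound for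
`r ≥ 1` and the initial one, `h r ^ (-2 / (p - 1))`, for `r ≤ 1`, the profile has Lipschitz constant
`C / r` everywhere, so that the weak derivatives of `u` are at most `C / r ^ 2`.
-/

noncomputable section

namespace RadialWave

open Set Filter Topology

open scoped Real

/-! ### Polar coordinates -/

theorem exists_forall_lt_norm_eq_zero {E F : Type*} [NormedAddCommGroup E] [Zero F] {f : E → F}
    (hf : HasCompactSupport f) : ∃ L : ℝ, ∀ x, L < ‖x‖ → f x = 0 := by
  obtain ⟨L, hL⟩ := hf.isCompact.isBounded.subset_closedBall (0 : E)
  refine ⟨L, fun x hx => image_eq_zero_of_notMem_tsupport fun hmem => hx.not_ge ?_⟩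
  simpa using hL hmem

section PolarCoordinates

variable {E : Type*} [NormedAddCommGroup E] [NormedSpace ℝ E] [Nontrivial E]
  [FiniteDimensional ℝ E] [MeasurableSpace E] [BorelSpace E] (μ : Measure E) [μ.IsAddHaarMeasure]

theorem lintegral_fun_norm_addHaar {f : ℝ → ℝ≥0∞} (hf : Measurable f) :
    ∫⁻ x, f ‖x‖ ∂μ
      = Module.finrank ℝ E * μ (Metric.ball 0 1)
        * ∫⁻ r in Ioi (0 : ℝ), ENNReal.ofReal (r ^ (Module.finrank ℝ E - 1)) * f r := by
  calc ∫⁻ x, f ‖x‖ ∂μ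
      = ∫⁻ x : ({0}ᶜ : Set E), f ‖x.1‖ ∂(μ.comap Subtype.val) := by
        rw [lintegral_subtype_comap (measurableSet_singleton _).compl (fun x : E => f ‖x‖),
          restrict_compl_singleton]
    _ = ∫⁻ y, f y.2 ∂(μ.toSphere.prod (Measure.volumeIoiPow (Module.finrank ℝ E - 1))) := by
        rw [← μ.measurePreserving_homeomorphUnitSphereProd.lintegral_comp_emb
          (Homeomorph.measurableEmbedding _)]
        simp
    _ = μ.toSphere univ
          * ∫⁻ r : Ioi (0 : ℝ), f r ∂(Measure.volumeIoiPow (Module.finrank ℝ E - 1)) := by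
        rw [lintegral_prod _ (by fun_prop)]
        simp only [lintegral_const, mul_comm]
    _ = _ := by
        rw [Measure.toSphere_apply_univ, Measure.volumeIoiPow,
          lintegral_withDensity_eq_lintegral_mul _ (by fun_prop) (by fun_prop)]
        simp only [Pi.mul_apply]
        rw [lintegral_subtype_comap measurableSet_Ioi
          (fun r => ENNReal.ofReal (r ^ (Module.finrank ℝ E - 1)) * f r)]

theorem ae_norm_of_ae {P : ℝ → Prop} (h : ∀ᵐ r : ℝ, 0 < r → P r) : ∀ᵐ x ∂μ, P ‖x‖ := by
  obtain ⟨N, hN, hNm, hN0⟩ := exists_measurable_superset_of_null (ae_iff.1 h)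
  have hmeas : Measurable (N.indicator (1 : ℝ → ℝ≥0∞)) := measurable_one.indicator hNm
  have hzero : ∫⁻ x, N.indicator 1 ‖x‖ ∂μ = 0 := by
    rw [lintegral_fun_norm_addHaar μ hmeas, (lintegral_eq_zero_iff (by fun_prop)).2,
      mul_zero]
    refine ae_restrict_of_ae ?_
    filter_upwards [measure_eq_zero_iff_ae_notMem.1 hN0] with r hr
    simp [hr]
  filter_upwards [(lintegral_eq_zero_iff (hmeas.comp measurable_norm)).1 hzero,
    Measure.ae_ne μ (0 : E)] with x hx hx0
  by_contra hP
  have hxN : ‖x‖ ∈ N := hN (by simp [hx0, hP])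
  simp [hxN] at hx

end PolarCoordinates

theorem volume_ball_E3 : (volume : Measure E3) (Metric.ball 0 1) = ENNReal.ofReal (π * 4 / 3) := by
  simp [EuclideanSpace.volume_ball_fin_three]

theorem integral_norm_E3 {F : Type*} [NormedAddCommGroup F] [NormedSpace ℝ F] (f : ℝ → F) :
    ∫ x : E3, f ‖x‖ = ∫ r in Ioi (0 : ℝ), (4 * π * r ^ 2) • f r := by
  rw [integral_fun_norm_addHaar, measureReal_def, volume_ball_E3, finrank_euclideanSpace_fin,
    ENNReal.toReal_ofReal (by positivity), ← integral_smul, ← Nat.cast_smul_eq_nsmul ℝ,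
    ← integral_smul]
  congr with r
  simp only [smul_smul]
  congr 1
  push_cast
  ring

theorem integrable_norm_E3 {F : Type*} [NormedAddCommGroup F] [NormedSpace ℝ F] {f : ℝ → F} :
    Integrable (fun x : E3 => f ‖x‖) ↔ IntegrableOn (fun r : ℝ => r ^ 2 • f r) (Ioi 0) := by
  rw [integrable_fun_norm_addHaar, finrank_euclideanSpace_fin]

theorem lintegral_norm_E3 {f : ℝ → ℝ≥0∞} (hf : Measurable f) :
    ∫⁻ x : E3, f ‖x‖ = ∫⁻ r in Ioi (0 : ℝ), ENNReal.ofReal (4 * π * r ^ 2) * f r := by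
  rw [lintegral_fun_norm_addHaar _ hf, volume_ball_E3, finrank_euclideanSpace_fin,
    ← lintegral_const_mul _ (by fun_prop)]
  refine lintegral_congr fun r => ?_
  rw [← mul_assoc, ← ENNReal.ofReal_natCast, ← ENNReal.ofReal_mul (by positivity),
    ← ENNReal.ofReal_mul (by positivity)]
  congr 2
  push_cast
  ring

/-! ### The Fourier transform of radial functions -/

/-- The identification of `ℝ × ℂ` with `ℝ³`, used to slice `ℝ³` by planes orthogonal to the first
coordinate axis. -/
def slicePoint (q : ℝ × ℂ) : E3 := WithLp.toLp 2 ![q.1, q.2.re, q.2.im]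

theorem measurePreserving_slicePoint : MeasurePreserving slicePoint := by
  have hprod := (MeasurePreserving.id (volume : Measure ℝ)).prod Complex.volume_preserving_equiv_pi
  have hcons := (volume_preserving_piFinSuccAbove (fun _ : Fin 3 => ℝ) 0).symm
  have hcomp := (PiLp.volume_preserving_toLp (Fin 3)).comp (hcons.comp hprod)
  rw [← Measure.volume_eq_prod] at hcomp
  convert hcomp using 1
  ext q i
  fin_cases i <;> rfl

theorem measurableEmbedding_slicePoint : MeasurableEmbedding slicePoint := by
  have hcomp : slicePoint = (MeasurableEquiv.toLp 2 (Fin 3 → ℝ)) ∘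
      (MeasurableEquiv.piFinSuccAbove (fun _ : Fin 3 => ℝ) 0).symm ∘
      (MeasurableEquiv.prodCongr (MeasurableEquiv.refl ℝ) Complex.measurableEquivPi) := by
    ext q i
    fin_cases i <;> rfl
  rw [hcomp]
  exact (MeasurableEquiv.measurableEmbedding _).comp
    ((MeasurableEquiv.measurableEmbedding _).comp (MeasurableEquiv.measurableEmbedding _))

theorem slicePoint_apply_zero (q : ℝ × ℂ) : slicePoint q 0 = q.1 := rfl

theorem norm_slicePoint (q : ℝ × ℂ) : ‖slicePoint q‖ = √(q.1 ^ 2 + ‖q.2‖ ^ 2) := by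
  rw [EuclideanSpace.norm_eq, Fin.sum_univ_three, ← Complex.normSq_eq_norm_sq,
    Complex.normSq_apply]
  simp only [slicePoint, Fin.isValue, Matrix.cons_val_zero, Matrix.cons_val_one, Matrix.cons_val,
    Real.norm_eq_abs, sq_abs]
  ring_nf

theorem integral_slicePoint {F : Type*} [NormedAddCommGroup F] [NormedSpace ℝ F] {f : E3 → F}
    (hf : Integrable f) : ∫ x, f x = ∫ z : ℝ, ∫ y : ℂ, f (slicePoint (z, y)) := by
  rw [← measurePreserving_slicePoint.integral_comp measurableEmbedding_slicePoint]
  exact integral_prod _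
    ((measurePreserving_slicePoint.integrable_comp_emb measurableEmbedding_slicePoint).2 hf)

theorem integral_norm_complex {F : Type*} [NormedAddCommGroup F] [NormedSpace ℝ F] (f : ℝ → F) :
    ∫ y : ℂ, f ‖y‖ = ∫ r in Ioi (0 : ℝ), (2 * π * r) • f r := by
  rw [integral_fun_norm_addHaar, Complex.finrank_real_complex, measureReal_def,
    Complex.volume_ball, ← integral_smul, ← Nat.cast_smul_eq_nsmul ℝ, ← integral_smul]
  congr with r
  simp only [smul_smul]
  congr 1
  simp
  ring

theorem image_sqrt_sq_add_sq_Ioi (z : ℝ) : (fun ρ => √(z ^ 2 + ρ ^ 2)) '' Ioi 0 = Ioi |z| := by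
  ext r
  constructor
  · rintro ⟨ρ, hρ, rfl⟩
    refine (Real.lt_sqrt (abs_nonneg z)).2 ?_
    nlinarith [sq_abs z, mem_Ioi.1 hρ]
  · intro hr
    have hr0 : 0 < r := (abs_nonneg z).trans_lt hr
    have hzr : 0 < r ^ 2 - z ^ 2 := sub_pos.2 (sq_lt_sq.2 (by rwa [abs_of_pos hr0]))
    refine ⟨√(r ^ 2 - z ^ 2), Real.sqrt_pos.2 hzr, ?_⟩
    simp [Real.sq_sqrt hzr.le, Real.sqrt_sq hr0.le]

theorem integral_Ioi_smul_comp_sqrt {F : Type*} [NormedAddCommGroup F] [NormedSpace ℝ F]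
    (κ : ℝ → F) (z : ℝ) :
    ∫ ρ in Ioi (0 : ℝ), (ρ / √(z ^ 2 + ρ ^ 2)) • κ √(z ^ 2 + ρ ^ 2) = ∫ r in Ioi |z|, κ r := by
  have hderiv : ∀ ρ ∈ Ioi (0 : ℝ),
      HasDerivWithinAt (fun ρ => √(z ^ 2 + ρ ^ 2)) (ρ / √(z ^ 2 + ρ ^ 2)) (Ioi 0) ρ := by
    intro ρ hρ
    have hpos : z ^ 2 + ρ ^ 2 ≠ 0 := by have := mem_Ioi.1 hρ; positivity
    refine ((((hasDerivAt_pow 2 ρ).const_add (z ^ 2)).sqrt hpos).congr_deriv ?_).hasDerivWithinAt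
    norm_num
    ring
  have hinj : InjOn (fun ρ => √(z ^ 2 + ρ ^ 2)) (Ioi 0) := by
    intro ρ hρ ρ' hρ' h
    have hsq := add_left_cancel ((Real.sqrt_inj (by positivity) (by positivity)).1 h)
    exact (pow_left_inj₀ (mem_Ioi.1 hρ).le (mem_Ioi.1 hρ').le two_ne_zero).1 hsq
  rw [← image_sqrt_sq_add_sq_Ioi, integral_image_eq_integral_abs_deriv_smul measurableSet_Ioi
    hderiv hinj]
  refine setIntegral_congr_fun measurableSet_Ioi fun ρ hρ => ?_
  rw [abs_of_nonneg (div_nonneg (mem_Ioi.1 hρ).le (Real.sqrt_nonneg _))]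

/-- The radial function `κ(|x|) / (4π|x|)` on `ℝ³`. With this normalization, testing a radial
function `f` against it amounts to testing `r f(r)` against `κ` on the half-line. -/
def radialKernel (κ : ℝ → ℝ) (x : E3) : ℂ := ((κ ‖x‖ / (4 * π * ‖x‖) : ℝ) : ℂ)

theorem integrable_radialKernel {κ : ℝ → ℝ} (hκ : Continuous κ) (hc : HasCompactSupport κ) :
    Integrable (radialKernel κ) := by
  refine Integrable.ofReal (𝕜 := ℂ) (f := fun x : E3 => κ ‖x‖ / (4 * π * ‖x‖)) ?_
  refine (integrable_norm_E3 (f := fun r => κ r / (4 * π * r))).2 ?_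
  have hint : Integrable (fun r : ℝ => r * κ r / (4 * π)) :=
    ((continuous_id.mul hκ).div_const _).integrable_of_hasCompactSupport
      (hc.mono fun r hr hκr => hr (by simp [hκr]))
  refine hint.integrableOn.congr_fun (fun r hr => ?_) measurableSet_Ioi
  have : r ≠ 0 := ne_of_gt hr
  simp only [smul_eq_mul]
  field_simp

theorem integral_slice_radialKernel (κ : ℝ → ℝ) (z : ℝ) :
    ∫ y : ℂ, radialKernel κ (slicePoint (z, y)) = ((2⁻¹ * ∫ r in Ioi |z|, κ r : ℝ) : ℂ) := by
  simp only [radialKernel, norm_slicePoint]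
  rw [integral_complex_ofReal,
    integral_norm_complex (fun ρ => κ √(z ^ 2 + ρ ^ 2) / (4 * π * √(z ^ 2 + ρ ^ 2))),
    ← integral_Ioi_smul_comp_sqrt κ z, ← integral_const_mul]
  congr with ρ
  have := Real.pi_ne_zero
  simp only [smul_eq_mul]
  field_simp
  ring

theorem integral_exp_mul_symm {ω : ℝ} (hω : ω ≠ 0) (r : ℝ) :
    ∫ z in (-r)..r, Complex.exp ((ω * z : ℝ) * Complex.I)
      = ((2 * (Real.sin (r * ω) / ω) : ℝ) : ℂ) := by
  rw [intervalIntegral.integral_comp_mul_left (fun z : ℝ => Complex.exp (z * Complex.I)) hω,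
    mul_neg, integral_exp_mul_I_eq_sin, Complex.real_smul, mul_comm ω r]
  push_cast
  ring

theorem integrable_indicator_abs_lt_mul {f κ : ℝ → ℂ} (hf : Continuous f) (hκ : Continuous κ)
    (hc : HasCompactSupport κ) :
    Integrable ({q : ℝ × ℝ | |q.1| < q.2}.indicator fun q => f q.1 * κ q.2) := by
  have hS : MeasurableSet {q : ℝ × ℝ | |q.1| < q.2} := measurableSet_lt (by fun_prop) (by fun_prop)
  obtain ⟨L, hL⟩ := exists_forall_lt_norm_eq_zero hc
  refine (integrable_indicator_iff hS).2 (IntegrableOn.of_forall_sdiff_eq_zero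
    (s := Icc (-L) L ×ˢ Icc (-L) L) (ContinuousOn.integrableOn_compact
      (isCompact_Icc.prod isCompact_Icc) (by fun_prop)) hS ?_)
  rintro ⟨z, r⟩ ⟨hzr : |z| < r, hout⟩
  have hLr : L < |r| := by
    by_contra! h
    have hzL : |z| ≤ L := hzr.le.trans ((le_abs_self r).trans h)
    exact hout ⟨abs_le.1 hzL, abs_le.1 h⟩
  simp [hL r hLr]

theorem integral_mul_integral_Ioi_abs {f κ : ℝ → ℂ} (hf : Continuous f) (hκ : Continuous κ)
    (hc : HasCompactSupport κ) :
    ∫ z, f z * ∫ r in Ioi |z|, κ r = ∫ r in Ioi (0 : ℝ), κ r * ∫ z in (-r)..r, f z := by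
  set H : ℝ × ℝ → ℂ := {q : ℝ × ℝ | |q.1| < q.2}.indicator fun q => f q.1 * κ q.2
  have hfst (z : ℝ) : ∫ r, H (z, r) = f z * ∫ r in Ioi |z|, κ r := by
    rw [← integral_const_mul, ← integral_indicator measurableSet_Ioi]
    rfl
  have hsnd (r : ℝ) :
      ∫ z, H (z, r) = (Ioi (0 : ℝ)).indicator (fun r => κ r * ∫ z in (-r)..r, f z) r := by
    have hslice : (fun z => H (z, r)) = (Ioo (-r) r).indicator fun z => f z * κ r := by
      ext z
      simp only [H, indicator, mem_ofPred_eq, abs_lt, mem_Ioo]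
    rw [hslice, integral_indicator measurableSet_Ioo, integral_mul_const, mul_comm]
    by_cases hr : 0 < r
    · rw [indicator_of_mem (mem_Ioi.2 hr), ← integral_Ioc_eq_integral_Ioo,
        ← intervalIntegral.integral_of_le (by linarith)]
    · rw [Ioo_eq_empty (by linarith), indicator_of_notMem (by simpa using hr)]
      simp
  have hswap := integral_integral_swap (f := fun z r => H (z, r))
    (integrable_indicator_abs_lt_mul hf hκ hc)
  simp only [hfst, hsnd] at hswap
  rw [hswap, integral_indicator measurableSet_Ioi]

theorem exists_linearIsometryEquiv_inner_eq {ι : Type*} [Fintype ι] (i : ι)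
    (ξ : EuclideanSpace ℝ ι) :
    ∃ R : EuclideanSpace ℝ ι ≃ₗᵢ[ℝ] EuclideanSpace ℝ ι, ∀ v, inner ℝ (R v) ξ = ‖ξ‖ * v i := by
  classical
  set e : EuclideanSpace ℝ ι := EuclideanSpace.single i ‖ξ‖
  set R := Submodule.reflection (Submodule.span ℝ {e - ξ})ᗮ
  have hR : R e = ξ := Submodule.reflection_sub (by simp [e])
  refine ⟨R, fun v => ?_⟩
  conv_lhs => rw [← hR, R.inner_map_map]
  simp [e, EuclideanSpace.inner_single_right]

theorem freq_pos {ξ : E3} (hξ : ξ ≠ 0) : 0 < freq ξ :=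
  mul_pos Real.two_pi_pos (norm_pos_iff.2 hξ)

theorem fourier_radialKernel_eq_integral (κ : ℝ → ℝ) (ξ : E3) :
    𝓕 (radialKernel κ) ξ
      = ∫ x : E3, Complex.exp ((-freq ξ * x 0 : ℝ) * Complex.I) * radialKernel κ x := by
  obtain ⟨R, hR⟩ := exists_linearIsometryEquiv_inner_eq 0 ξ
  rw [Real.fourier_eq', ← R.measurePreserving.integral_comp R.toHomeomorph.measurableEmbedding]
  congr with x
  rw [hR, radialKernel, R.norm_map, smul_eq_mul]
  simp only [freq, radialKernel]
  congr 3
  push_cast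
  ring

/-- Slicing by planes: the integral of `κ(|x|) / (4π|x|)` over a plane at distance `|z|` from the
origin is half the integral of `κ` over `(|z|, ∞)`. -/
theorem fourier_radialKernel {κ : ℝ → ℝ} (hκ : Continuous κ) (hc : HasCompactSupport κ)
    {ξ : E3} (hξ : ξ ≠ 0) :
    𝓕 (radialKernel κ) ξ = ((∫ r in Ioi (0 : ℝ), κ r * sinSymbol r ξ : ℝ) : ℂ) := by
  have hint : Integrable fun x : E3 =>
      Complex.exp ((-freq ξ * x 0 : ℝ) * Complex.I) * radialKernel κ x :=
    (integrable_radialKernel hκ hc).bdd_mul (c := 1) (by fun_prop)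
      (Eventually.of_forall fun x => (Complex.norm_exp_ofReal_mul_I _).le)
  rw [fourier_radialKernel_eq_integral, integral_slicePoint hint]
  simp only [slicePoint_apply_zero, integral_const_mul, integral_slice_radialKernel]
  calc ∫ z : ℝ, Complex.exp ((-freq ξ * z : ℝ) * Complex.I) * ((2⁻¹ * ∫ r in Ioi |z|, κ r : ℝ) : ℂ)
      = ∫ z : ℝ, Complex.exp ((-freq ξ * z : ℝ) * Complex.I)
          * ∫ r in Ioi |z|, ((2⁻¹ * κ r : ℝ) : ℂ) := by
        simp only [integral_complex_ofReal, integral_const_mul]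
    _ = ∫ r in Ioi (0 : ℝ), ((2⁻¹ * κ r : ℝ) : ℂ)
          * ∫ z in (-r)..r, Complex.exp ((-freq ξ * z : ℝ) * Complex.I) :=
        integral_mul_integral_Ioi_abs (by fun_prop) (by fun_prop)
          (hc.mono fun r hr hκr => hr (by simp [hκr]))
    _ = ∫ r in Ioi (0 : ℝ), ((κ r * sinSymbol r ξ : ℝ) : ℂ) := by
        congr with r
        rw [integral_exp_mul_symm (neg_ne_zero.2 (freq_pos hξ).ne'), sinSymbol, mul_neg,
          Real.sin_neg, neg_div_neg_eq]
        push_cast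
        ring
    _ = _ := integral_complex_ofReal

/-! ### Test functions of the radius and the one-dimensional wave propagator -/

/-- `χ` is a test function on the half-line `(a, ∞)`. -/
structure IsTest (a : ℝ) (χ : ℝ → ℝ) : Prop where
  contDiff : ContDiff ℝ ((⊤ : ℕ∞) : WithTop ℕ∞) χ
  hasCompactSupport : HasCompactSupport χ
  tsupport_subset : tsupport χ ⊆ Ioi a

namespace IsTest

variable {a b : ℝ} {χ : ℝ → ℝ}

theorem continuous (h : IsTest a χ) : Continuous χ := h.contDiff.continuous

theorem integrable (h : IsTest a χ) : Integrable χ :=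
  h.continuous.integrable_of_hasCompactSupport h.hasCompactSupport

theorem eq_zero (h : IsTest a χ) {r : ℝ} (hr : r ≤ a) : χ r = 0 :=
  image_eq_zero_of_notMem_tsupport fun hmem => hr.not_gt (h.tsupport_subset hmem)

theorem mono (h : IsTest a χ) (hab : b ≤ a) : IsTest b χ :=
  ⟨h.contDiff, h.hasCompactSupport, h.tsupport_subset.trans (Ioi_subset_Ioi hab)⟩

theorem comp_add_right (h : IsTest a χ) (c : ℝ) : IsTest (a - c) fun r => χ (r + c) := by
  have htsupport : tsupport (fun r => χ (r + c)) = (Homeomorph.addRight c) ⁻¹' tsupport χ := by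
    rw [tsupport, tsupport, (Homeomorph.addRight c).preimage_closure]
    rfl
  refine ⟨h.contDiff.comp (contDiff_id.add contDiff_const),
    h.hasCompactSupport.comp_homeomorph (Homeomorph.addRight c), ?_⟩
  rw [htsupport]
  exact fun r hr => mem_Ioi.2 (sub_lt_iff_lt_add.2 (h.tsupport_subset hr))

theorem contDiff_radialKernel (h : IsTest 0 χ) :
    ContDiff ℝ ((⊤ : ℕ∞) : WithTop ℕ∞) (radialKernel χ) := by
  refine Complex.ofRealCLM.contDiff.comp (contDiff_iff_contDiffAt.2 fun x => ?_)
  rcases eq_or_ne x 0 with rfl | hx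
  · have hχ0 : ∀ᶠ r in 𝓝 (0 : ℝ), χ r = 0 :=
      notMem_tsupport_iff_eventuallyEq.1 fun hmem => lt_irrefl (0 : ℝ) (h.tsupport_subset hmem)
    refine (contDiffAt_const (c := (0 : ℝ))).congr_of_eventuallyEq ?_
    filter_upwards [(tendsto_norm_zero (E := E3)).eventually hχ0] with y hy
    rw [hy]
    exact zero_div _
  · have hnorm := contDiffAt_norm ℝ (n := ((⊤ : ℕ∞) : WithTop ℕ∞)) hx
    exact (h.contDiff.contDiffAt.comp x hnorm).div (contDiffAt_const.mul hnorm)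
      (mul_ne_zero (by positivity) (norm_ne_zero_iff.2 hx))

theorem hasCompactSupport_radialKernel (h : IsTest a χ) : HasCompactSupport (radialKernel χ) := by
  obtain ⟨L, hL⟩ := exists_forall_lt_norm_eq_zero h.hasCompactSupport
  refine HasCompactSupport.of_support_subset_isCompact (isCompact_closedBall (0 : E3) L) ?_
  intro x hx
  by_contra hout
  have hLx : L < ‖x‖ := by simpa using hout
  exact hx (by simp [radialKernel, hL ‖x‖ (by rwa [norm_norm])])

/-- The radial Schwartz function `χ(|x|) / (4π|x|)`. -/
def toSchwartz (h : IsTest 0 χ) : 𝓢(E3, ℂ) :=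
  h.hasCompactSupport_radialKernel.toSchwartzMap h.contDiff_radialKernel

theorem coe_toSchwartz (h : IsTest 0 χ) : ⇑h.toSchwartz = radialKernel χ := rfl

theorem fourier_toSchwartz (h : IsTest 0 χ) {ξ : E3} (hξ : ξ ≠ 0) :
    (𝓕 h.toSchwartz) ξ = ((∫ r, χ r * sinSymbol r ξ : ℝ) : ℂ) := by
  rw [SchwartzMap.fourier_coe, coe_toSchwartz,
    fourier_radialKernel h.continuous h.hasCompactSupport hξ,
    setIntegral_eq_integral_of_forall_compl_eq_zero]
  intro r hr
  rw [h.eq_zero (not_lt.1 hr), zero_mul]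

theorem fourierInv_toSchwartz (h : IsTest 0 χ) {ξ : E3} (hξ : ξ ≠ 0) :
    (𝓕⁻ h.toSchwartz) ξ = ((∫ r, χ r * sinSymbol r ξ : ℝ) : ℂ) := by
  rw [SchwartzMap.fourierInv_coe, Real.fourierInv_eq_fourier_neg, ← SchwartzMap.fourier_coe,
    h.fourier_toSchwartz (neg_ne_zero.2 hξ)]
  simp [sinSymbol, freq]

end IsTest

theorem integral_intervalIntegral_swap_of_continuous {f : ℝ → ℝ → ℝ} {a b L : ℝ}
    (hf : Continuous f.uncurry) (hL : ∀ z ∈ uIcc a b, ∀ y, L < |y| → f z y = 0) :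
    ∫ y, ∫ z in a..b, f z y = ∫ z in a..b, ∫ y, f z y := by
  refine (intervalIntegral_integral_swap ?_).symm
  have hint : IntegrableOn f.uncurry (uIoc a b ×ˢ univ) := by
    refine IntegrableOn.of_forall_sdiff_eq_zero (s := uIcc a b ×ˢ Icc (-L) L)
      (hf.continuousOn.integrableOn_compact (isCompact_uIcc.prod isCompact_Icc))
      (measurableSet_uIoc.prod MeasurableSet.univ) ?_
    rintro ⟨z, y⟩ ⟨⟨hz, -⟩, hout⟩
    refine hL z (uIoc_subset_uIcc hz) y (lt_of_not_ge fun hy => ?_)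
    exact hout ⟨uIoc_subset_uIcc hz, abs_le.1 hy⟩
  rwa [IntegrableOn, Measure.volume_eq_prod, ← Measure.prod_restrict, Measure.restrict_univ]
    at hint

theorem intervalIntegral_eq_zero_of_abs_lt {χ : ℝ → ℝ} {L s r : ℝ} (hL : ∀ y, L < |y| → χ y = 0)
    (hr : L + |s| < |r|) : ∫ y in (r - s)..(r + s), χ y = 0 := by
  rw [intervalIntegral.integral_congr (g := fun _ => (0 : ℝ)), intervalIntegral.integral_zero]
  intro y hy
  have hyr : |r - y| ≤ |s| := by
    rw [abs_le]
    rcases mem_uIcc.1 hy with hy | hy <;> rcases abs_cases s with hs | hs <;>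
      constructor <;> linarith
  exact hL y (by linarith [abs_sub_abs_le_abs_sub r y])

theorem integral_mul_intervalIntegral_add {χ g : ℝ → ℝ} (hχ : Continuous χ)
    (hc : HasCompactSupport χ) (hg : Continuous g) (s : ℝ) :
    ∫ y, χ y * ∫ z in (-s)..s, g (y + z) = ∫ r, (∫ y in (r - s)..(r + s), χ y) * g r := by
  obtain ⟨L, hL⟩ := exists_forall_lt_norm_eq_zero hc
  calc ∫ y, χ y * ∫ z in (-s)..s, g (y + z)
      = ∫ y, ∫ z in (-s)..s, χ y * g (y + z) := by
        simp only [intervalIntegral.integral_const_mul]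
    _ = ∫ z in (-s)..s, ∫ y, χ y * g (y + z) :=
        integral_intervalIntegral_swap_of_continuous (L := L) (by fun_prop) fun z _ y hy => by
          rw [hL y hy, zero_mul]
    _ = ∫ z in (-s)..s, ∫ r, χ (r - z) * g r := by
        refine intervalIntegral.integral_congr fun z _ => ?_
        simpa using integral_add_right_eq_self (fun r => χ (r - z) * g r) z
    _ = ∫ r, ∫ z in (-s)..s, χ (r - z) * g r := by
        refine (integral_intervalIntegral_swap_of_continuous (L := L + |s|) (by fun_prop)
          fun z hz r hr => ?_).symm
        have hzs : |z| ≤ |s| := by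
          rw [abs_le]
          rcases mem_uIcc.1 hz with hz | hz <;> rcases abs_cases s with hs | hs <;>
            constructor <;> linarith
        rw [hL (r - z) (by rw [Real.norm_eq_abs]; linarith [abs_sub_abs_le_abs_sub r z]), zero_mul]
    _ = ∫ r, (∫ y in (r - s)..(r + s), χ y) * g r := by
        simp only [intervalIntegral.integral_mul_const, intervalIntegral.integral_comp_sub_left,
          sub_neg_eq_add]

theorem integral_eq_integral_Ioi_add_neg {f : ℝ → ℝ} (hf : Integrable f) :
    ∫ r, f r = ∫ r in Ioi (0 : ℝ), (f r + f (-r)) := by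
  rw [integral_add hf.integrableOn hf.comp_neg.integrableOn, integral_comp_neg_Ioi, neg_zero,
    add_comm, intervalIntegral.integral_Iic_add_Ioi hf.integrableOn hf.integrableOn]

/-- The propagator `sin(s√(-∂²))/√(-∂²)` applied to the odd extension of `χ`. -/
def dAlembert (χ : ℝ → ℝ) (s r : ℝ) : ℝ := 2⁻¹ * ∫ y in (r - s)..(r + s), (χ y - χ (-y))

theorem dAlembert_neg (χ : ℝ → ℝ) (s r : ℝ) : dAlembert χ (-s) r = -dAlembert χ s r := by
  rw [dAlembert, dAlembert, sub_neg_eq_add, ← sub_eq_add_neg, intervalIntegral.integral_symm,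
    mul_neg]

theorem dAlembert_eq_zero {χ : ℝ → ℝ} {L s r : ℝ} (hL : ∀ y, L < |y| → χ y = 0)
    (hr : L + |s| < |r|) : dAlembert χ s r = 0 := by
  rw [dAlembert, intervalIntegral_eq_zero_of_abs_lt (L := L) _ hr, mul_zero]
  intro y hy
  rw [hL y hy, hL (-y) (by rwa [abs_neg]), sub_zero]

section Continuous

variable {χ : ℝ → ℝ}

theorem continuous_intervalIntegral_sub_add (hχ : Continuous χ) :
    Continuous fun q : ℝ × ℝ => ∫ y in (q.2 - q.1)..(q.2 + q.1), χ y := by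
  have hint (a b : ℝ) : IntervalIntegrable χ volume a b := hχ.intervalIntegrable a b
  have hprim : Continuous fun b => ∫ y in (0 : ℝ)..b, χ y :=
    intervalIntegral.continuous_primitive hint 0
  have hsub (q : ℝ × ℝ) : ∫ y in (q.2 - q.1)..(q.2 + q.1), χ y
      = (∫ y in (0 : ℝ)..(q.2 + q.1), χ y) - ∫ y in (0 : ℝ)..(q.2 - q.1), χ y :=
    (intervalIntegral.integral_interval_sub_left (hint 0 _) (hint 0 _)).symm
  simp only [hsub]
  exact (hprim.comp (by fun_prop)).sub (hprim.comp (by fun_prop))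

theorem continuous_dAlembert (hχ : Continuous χ) :
    Continuous fun q : ℝ × ℝ => dAlembert χ q.1 q.2 :=
  (continuous_intervalIntegral_sub_add (by fun_prop)).const_mul 2⁻¹

theorem dAlembert_eq_integral_sub_neg (hχ : Continuous χ) (s r : ℝ) :
    dAlembert χ s r
      = 2⁻¹ * ((∫ y in (r - s)..(r + s), χ y) - ∫ y in (-r - s)..(-r + s), χ y) := by
  rw [dAlembert, intervalIntegral.integral_sub (hχ.intervalIntegrable _ _)
    (Continuous.intervalIntegrable (by fun_prop) _ _), intervalIntegral.integral_comp_neg,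
    neg_sub', neg_add', sub_neg_eq_add]

theorem dAlembert_eq_integral_reflected (hχ : Continuous χ) (s r : ℝ) :
    dAlembert χ s r = 2⁻¹ * ∫ y in (s - r)..(s + r), (χ y - χ (-y)) := by
  have hint (a b : ℝ) : IntervalIntegrable (fun y => χ y - χ (-y)) volume a b :=
    Continuous.intervalIntegrable (by fun_prop) a b
  have hodd : ∫ y in (s - r)..(r - s), (χ y - χ (-y)) = 0 := by
    have hneg := intervalIntegral.integral_comp_neg (a := s - r) (b := r - s) fun y => χ y - χ (-y)
    rw [neg_sub, neg_sub, intervalIntegral.integral_congr (g := fun y => -(χ y - χ (-y)))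
      fun y _ => by ring_nf, intervalIntegral.integral_neg] at hneg
    linarith
  rw [dAlembert, ← intervalIntegral.integral_add_adjacent_intervals (hint (s - r) (r - s))
    (hint (r - s) (s + r)), hodd, zero_add, add_comm s r]

theorem abs_dAlembert_le (hχ : Continuous χ) {B : ℝ} (hB : ∀ y, |χ y| ≤ B) (s : ℝ) {r : ℝ}
    (hr : 0 ≤ r) : |dAlembert χ s r| ≤ 2 * B * r := by
  have hbound := intervalIntegral.norm_integral_le_of_norm_le_const (a := s - r) (b := s + r)
    (f := fun y => χ y - χ (-y)) (C := 2 * B) fun y _ =>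
      (abs_sub _ _).trans (by linarith [hB y, hB (-y)])
  rw [show s + r - (s - r) = 2 * r by ring, abs_of_nonneg (by positivity : 0 ≤ 2 * r),
    Real.norm_eq_abs] at hbound
  rw [dAlembert_eq_integral_reflected hχ, abs_mul, abs_of_pos (by norm_num : (0 : ℝ) < 2⁻¹)]
  linarith

theorem integral_dAlembert_mul_odd (hχ : Continuous χ) (hc : HasCompactSupport χ) {g : ℝ → ℝ}
    (hg : Continuous g) (hodd : ∀ y, g (-y) = -g y) (s : ℝ) :
    ∫ r in Ioi (0 : ℝ), dAlembert χ s r * g r = 2⁻¹ * ∫ y, χ y * ∫ z in (-s)..s, g (y + z) := by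
  obtain ⟨L, hL⟩ := exists_forall_lt_norm_eq_zero hc
  set m : ℝ → ℝ := fun r => ∫ y in (r - s)..(r + s), χ y
  have hmc : Continuous m :=
    (continuous_intervalIntegral_sub_add hχ).comp (by fun_prop : Continuous fun r : ℝ => (s, r))
  have hms : HasCompactSupport m := by
    refine HasCompactSupport.intro (isCompact_Icc (a := -(L + |s|)) (b := L + |s|)) fun r hr => ?_
    exact intervalIntegral_eq_zero_of_abs_lt hL (lt_of_not_ge fun h => hr (abs_le.1 h))
  have hmg : Integrable fun r => m r * g r :=
    (hmc.mul hg).integrable_of_hasCompactSupport hms.mul_right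
  rw [integral_mul_intervalIntegral_add hχ hc hg, integral_eq_integral_Ioi_add_neg hmg,
    ← integral_const_mul]
  congr with r
  rw [dAlembert_eq_integral_sub_neg hχ, hodd]
  ring

theorem integral_sin_add_div {ω : ℝ} (hω : ω ≠ 0) (y s : ℝ) :
    ∫ z in (-s)..s, Real.sin ((y + z) * ω) / ω
      = 2 * (Real.sin (s * ω) / ω * (Real.sin (y * ω) / ω)) := by
  rw [intervalIntegral.integral_div,
    intervalIntegral.integral_comp_add_left (fun z => Real.sin (z * ω)),
    intervalIntegral.integral_comp_mul_right Real.sin hω, integral_sin, add_mul, add_mul, neg_mul,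
    Real.cos_add, Real.cos_add, Real.cos_neg, Real.sin_neg, smul_eq_mul]
  field_simp
  ring

theorem integral_dAlembert_mul_sinSymbol (hχ : Continuous χ) (hc : HasCompactSupport χ) (s : ℝ)
    {ξ : E3} (hξ : ξ ≠ 0) :
    ∫ r in Ioi (0 : ℝ), dAlembert χ s r * sinSymbol r ξ
      = sinSymbol s ξ * ∫ r, χ r * sinSymbol r ξ := by
  simp only [sinSymbol]
  rw [integral_dAlembert_mul_odd hχ hc (by fun_prop)
      (fun y => by rw [neg_mul, Real.sin_neg, neg_div]),
    ← integral_const_mul, ← integral_const_mul]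
  congr with y
  rw [integral_sin_add_div (freq_pos hξ).ne']
  ring

end Continuous

theorem continuous_sinSymbol (ξ : E3) : Continuous fun t => sinSymbol t ξ := by
  unfold sinSymbol
  fun_prop

theorem measurable_sinSymbol (t : ℝ) : Measurable (sinSymbol t) := by
  unfold sinSymbol freq
  fun_prop

theorem freq_nonneg (ξ : E3) : 0 ≤ freq ξ := mul_nonneg Real.two_pi_pos.le (norm_nonneg ξ)

theorem abs_sinSymbol_le_min (t : ℝ) (ξ : E3) : |sinSymbol t ξ| ≤ min |t| (freq ξ)⁻¹ := by
  rw [sinSymbol, abs_div, abs_of_nonneg (freq_nonneg ξ)]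
  refine le_min (div_le_of_le_mul₀ (freq_nonneg ξ) (abs_nonneg t) ?_)
    ((div_le_div_of_nonneg_right (Real.abs_sin_le_one _) (freq_nonneg ξ)).trans_eq (one_div _))
  exact Real.abs_sin_le_abs.trans_eq (by rw [abs_mul, abs_of_nonneg (freq_nonneg ξ)])

theorem continuousAt_radialKernel {κ : ℝ → ℝ} (hκ : Continuous κ) {x : E3} (hx : x ≠ 0) :
    ContinuousAt (radialKernel κ) x := by
  refine Complex.continuous_ofReal.continuousAt.comp (ContinuousAt.div (by fun_prop) (by fun_prop)
    (mul_ne_zero (by positivity) (norm_ne_zero_iff.2 hx)))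

theorem radialKernel_comp_abs (κ : ℝ → ℝ) : radialKernel (fun r => κ |r|) = radialKernel κ := by
  ext x
  simp only [radialKernel, abs_norm]

/-- Fourier inversion, the kernel `κ(r) = dAlembert χ s |r|` being continuous with compact
support. -/
theorem sinPropagator_toSchwartz {χ : ℝ → ℝ} (h : IsTest 0 χ) (s : ℝ) {x : E3} (hx : x ≠ 0) :
    sinPropagator s h.toSchwartz x = radialKernel (dAlembert χ s) x := by
  obtain ⟨L, hL⟩ := exists_forall_lt_norm_eq_zero h.hasCompactSupport
  set κ : ℝ → ℝ := fun r => dAlembert χ s |r| with hκ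
  have hκc : Continuous κ := (continuous_dAlembert h.continuous).comp
    (by fun_prop : Continuous fun r : ℝ => (s, |r|))
  have hκs : HasCompactSupport κ := by
    refine HasCompactSupport.intro (isCompact_Icc (a := -(L + |s|)) (b := L + |s|)) fun r hr => ?_
    refine dAlembert_eq_zero hL (lt_of_not_ge fun hle => hr (abs_le.1 ?_))
    rwa [abs_abs] at hle
  have hfourier : (fun ξ => (sinSymbol s ξ : ℂ) * (𝓕 h.toSchwartz) ξ)
      =ᵐ[volume] 𝓕 (radialKernel κ) := by
    filter_upwards [Measure.ae_ne volume (0 : E3)] with ξ hξ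
    rw [fourier_radialKernel hκc hκs hξ, h.fourier_toSchwartz hξ, ← Complex.ofReal_mul,
      ← integral_dAlembert_mul_sinSymbol h.continuous h.hasCompactSupport s hξ]
    congr 1
    refine setIntegral_congr_fun measurableSet_Ioi fun r hr => ?_
    simp only [hκ, abs_of_pos (mem_Ioi.1 hr)]
  have hint : Integrable fun ξ : E3 => (sinSymbol s ξ : ℂ) * (𝓕 h.toSchwartz) ξ :=
    (SchwartzMap.integrable (𝓕 h.toSchwartz)).bdd_mul (c := |s|)
      (Complex.measurable_ofReal.comp (measurable_sinSymbol s)).aestronglyMeasurable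
      (Eventually.of_forall fun ξ => by
        rw [Complex.norm_real]
        exact (abs_sinSymbol_le_min s ξ).trans (min_le_left _ _))
  calc sinPropagator s h.toSchwartz x
      = 𝓕⁻ (𝓕 (radialKernel κ)) x := by
        rw [sinPropagator, Real.fourierInv_eq, Real.fourierInv_eq]
        refine integral_congr_ae ?_
        filter_upwards [hfourier] with ξ hξ
        rw [hξ]
    _ = radialKernel κ x := (integrable_radialKernel hκc hκs).fourierInv_fourier_eq
        ((integrable_congr hfourier).1 hint) (continuousAt_radialKernel hκc hx)
    _ = radialKernel (dAlembert χ s) x := by rw [hκ, radialKernel_comp_abs]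

/-! ### Multipliers acting on homogeneous Sobolev spaces -/

theorem continuous_freq : Continuous freq := by
  unfold freq
  fun_prop

theorem measurable_freq : Measurable freq := continuous_freq.measurable

theorem measurable_freq_rpow (a : ℝ) : Measurable fun ξ => freq ξ ^ a :=
  measurable_freq.pow_const a

theorem freq_smul {r : ℝ} (hr : 0 ≤ r) (ξ : E3) : freq (r • ξ) = r * freq ξ := by
  rw [freq, freq, norm_smul, Real.norm_of_nonneg hr]
  ring

theorem hdotMeasure_absolutelyContinuous (s : ℝ) : hdotMeasure s ≪ volume :=
  withDensity_absolutelyContinuous _ _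

theorem absolutelyContinuous_hdotMeasure (s : ℝ) : (volume : Measure E3) ≪ hdotMeasure s := by
  refine withDensity_absolutelyContinuous' (measurable_freq_rpow _).ennreal_ofReal.aemeasurable ?_
  filter_upwards [Measure.ae_ne volume (0 : E3)] with ξ hξ
  exact (ENNReal.ofReal_pos.2 (Real.rpow_pos_of_pos (freq_pos hξ) _)).ne'

theorem eLpNorm_hdotMeasure {F : Type*} [NormedAddCommGroup F] [MeasurableSpace F]
    [OpensMeasurableSpace F] {f : E3 → F} (hf : Measurable f) (σ : ℝ) :
    eLpNorm f 2 (hdotMeasure σ)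
      = (∫⁻ ξ, (‖f ξ‖ₑ * ENNReal.ofReal (freq ξ ^ σ)) ^ (2 : ℝ)) ^ (1 / 2 : ℝ) := by
  have hweight := measurable_freq_rpow (2 * σ)
  rw [eLpNorm_eq_lintegral_rpow_enorm_toReal (by norm_num) (by norm_num), hdotMeasure,
    lintegral_withDensity_eq_lintegral_mul _ (by fun_prop) (by fun_prop), ENNReal.toReal_ofNat]
  congr 1
  refine lintegral_congr fun ξ => ?_
  rw [Pi.mul_apply, ENNReal.mul_rpow_of_nonneg _ _ zero_le_two,
    ENNReal.ofReal_rpow_of_nonneg (Real.rpow_nonneg (freq_nonneg ξ) _) zero_le_two,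
    ← Real.rpow_mul (freq_nonneg ξ), mul_comm σ 2, mul_comm]

theorem lintegral_enorm_mul_le {G : E3 → ℂ} (hG : Measurable G) {k : E3 → ℝ} (hk : Measurable k)
    (σ : ℝ) :
    ∫⁻ ξ, ‖G ξ * (k ξ : ℂ)‖ₑ ≤ eLpNorm G 2 (hdotMeasure σ) * eLpNorm k 2 (hdotMeasure (-σ)) := by
  have hweight := measurable_freq_rpow
  rw [eLpNorm_hdotMeasure hG, eLpNorm_hdotMeasure hk]
  refine le_of_eq_of_le (lintegral_congr_ae ?_)
    (ENNReal.lintegral_mul_le_Lp_mul_Lq volume Real.HolderConjugate.two_two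
      (f := fun ξ : E3 => ‖G ξ‖ₑ * ENNReal.ofReal (freq ξ ^ σ))
      (g := fun ξ => ‖k ξ‖ₑ * ENNReal.ofReal (freq ξ ^ (-σ))) (by fun_prop) (by fun_prop))
  filter_upwards [Measure.ae_ne volume (0 : E3)] with ξ hξ
  have hcancel : ENNReal.ofReal (freq ξ ^ σ) * ENNReal.ofReal (freq ξ ^ (-σ)) = 1 := by
    rw [← ENNReal.ofReal_mul (Real.rpow_nonneg (freq_nonneg ξ) _), ← Real.rpow_add (freq_pos hξ),
      add_neg_cancel, Real.rpow_zero, ENNReal.ofReal_one]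
  rw [Pi.mul_apply, mul_mul_mul_comm, hcancel, mul_one, enorm_mul, ← ofReal_norm (k ξ : ℂ),
    Complex.norm_real, ofReal_norm]

theorem integrableOn_Ioi_sq_mul_min_inv_mul_rpow_sq {s : ℝ} (hs : 1 / 2 < s) (hs' : s < 3 / 2) :
    IntegrableOn (fun t : ℝ => t ^ 2 * (min 1 t⁻¹ * t ^ (-s)) ^ 2) (Ioi 0) := by
  have hpow (t : ℝ) (ht : 0 < t) : t ^ (-(2 * s)) = (t ^ (-s)) ^ 2 := by
    rw [← Real.rpow_mul_natCast ht.le]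
    congr 1
    push_cast
    ring
  rw [← Ioc_union_Ioi_eq_Ioi (zero_le_one' ℝ)]
  refine IntegrableOn.union ?_ ?_
  · have hlow : IntegrableOn (fun t : ℝ => t ^ (2 - 2 * s)) (Ioc 0 1) :=
      (intervalIntegrable_iff_integrableOn_Ioc_of_le zero_le_one).1
        (intervalIntegral.intervalIntegrable_rpow' (by linarith))
    refine hlow.congr_fun (fun t ht => ?_) measurableSet_Ioc
    simp only [min_eq_left ((one_le_inv₀ ht.1).2 ht.2), one_mul]
    rw [sub_eq_add_neg, Real.rpow_add ht.1, hpow t ht.1, Real.rpow_two]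
  · have hhigh : IntegrableOn (fun t : ℝ => t ^ (-(2 * s))) (Ioi 1) :=
      integrableOn_Ioi_rpow_of_lt (by linarith) one_pos
    refine hhigh.congr_fun (fun t ht => ?_) measurableSet_Ioi
    have htpos : 0 < t := one_pos.trans ht
    simp only [min_eq_right (inv_le_one_of_one_le₀ (mem_Ioi.1 ht).le)]
    rw [hpow t htpos]
    field_simp

theorem memLp_min_one_inv_freq {s : ℝ} (hs : 1 / 2 < s) (hs' : s < 3 / 2) :
    MemLp (fun ξ => min 1 (freq ξ)⁻¹) 2 (hdotMeasure (-s)) := by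
  have hmeas : Measurable fun ξ : E3 => min 1 (freq ξ)⁻¹ :=
    measurable_const.min measurable_freq.inv
  refine ⟨hmeas.aestronglyMeasurable, ?_⟩
  have hint : Integrable fun ξ : E3 => (min 1 (freq ξ)⁻¹ * freq ξ ^ (-s)) ^ 2 := by
    refine (integrable_norm_E3 (f := fun t => (min 1 (2 * π * t)⁻¹ * (2 * π * t) ^ (-s)) ^ 2)).2 ?_
    have hscaled : IntegrableOn (fun t : ℝ => (2 * π * t) ^ 2
        * (min 1 (2 * π * t)⁻¹ * (2 * π * t) ^ (-s)) ^ 2) (Ioi 0) :=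
      (integrableOn_Ioi_comp_mul_left_iff (fun t => t ^ 2 * (min 1 t⁻¹ * t ^ (-s)) ^ 2) 0
        Real.two_pi_pos).2 (by
          simpa only [mul_zero] using integrableOn_Ioi_sq_mul_min_inv_mul_rpow_sq hs hs')
    refine IntegrableOn.congr_fun (Integrable.const_mul hscaled ((2 * π) ^ 2)⁻¹) (fun t _ => ?_)
      measurableSet_Ioi
    simp only [smul_eq_mul]
    field_simp
  rw [eLpNorm_hdotMeasure hmeas]
  refine ENNReal.rpow_lt_top_of_nonneg (by norm_num) (ne_of_lt ?_)
  refine lt_of_eq_of_lt (lintegral_congr fun ξ => ?_) hint.lintegral_lt_top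
  have hmin : 0 ≤ min 1 (freq ξ)⁻¹ := le_min zero_le_one (inv_nonneg.2 (freq_nonneg ξ))
  rw [Real.enorm_of_nonneg hmin, ← ENNReal.ofReal_mul hmin,
    ENNReal.ofReal_rpow_of_nonneg (mul_nonneg hmin (Real.rpow_nonneg (freq_nonneg ξ) _))
      zero_le_two, Real.rpow_two]

/-- The norm of the multiplier `min(1, 1/(2π|ξ|))` in `Ḣ^{-s}`, finite for `1/2 < s < 3/2`. -/
def sobolevConst (s : ℝ) : ℝ := (eLpNorm (fun ξ => min 1 (freq ξ)⁻¹) 2 (hdotMeasure (-s))).toReal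

theorem sobolevConst_nonneg (s : ℝ) : 0 ≤ sobolevConst s := ENNReal.toReal_nonneg

theorem lintegral_comp_smul_E3 {f : E3 → ℝ≥0∞} (hf : Measurable f) {r : ℝ} (hr : 0 < r) :
    ∫⁻ ξ, f (r • ξ) = ENNReal.ofReal (r ^ 3)⁻¹ * ∫⁻ ξ, f ξ := by
  rw [← lintegral_map hf (measurable_const_smul r), Measure.map_addHaar_smul volume hr.ne',
    lintegral_smul_measure, finrank_euclideanSpace_fin, abs_of_pos (by positivity), smul_eq_mul]

theorem eLpNorm_min_inv_freq {s : ℝ} (hs : 1 / 2 < s) (hs' : s < 3 / 2) {r : ℝ} (hr : 0 ≤ r) :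
    eLpNorm (fun ξ => min r (freq ξ)⁻¹) 2 (hdotMeasure (-s))
      = ENNReal.ofReal (sobolevConst s * r ^ (s - 1 / 2)) := by
  rcases hr.eq_or_lt with rfl | hr
  · have hzero (ξ : E3) : min 0 (freq ξ)⁻¹ = 0 := min_eq_left (inv_nonneg.2 (freq_nonneg ξ))
    rw [Real.zero_rpow (by linarith)]
    simp [hzero]
  have hmeas (a : ℝ) : Measurable fun ξ : E3 => min a (freq ξ)⁻¹ :=
    measurable_const.min measurable_freq.inv
  have hweight := measurable_freq_rpow (-s)
  have hscale (ξ : E3) :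
      (‖min r (freq ξ)⁻¹‖ₑ * ENNReal.ofReal (freq ξ ^ (-s))) ^ (2 : ℝ)
        = ENNReal.ofReal (r ^ (2 + 2 * s))
          * (‖min 1 (freq (r • ξ))⁻¹‖ₑ * ENNReal.ofReal (freq (r • ξ) ^ (-s))) ^ (2 : ℝ) := by
    have hω := freq_nonneg ξ
    have hmin : min r (freq ξ)⁻¹ = r * min 1 (freq (r • ξ))⁻¹ := by
      rw [mul_min_of_nonneg _ _ hr.le, mul_one, freq_smul hr.le, mul_inv,
        mul_inv_cancel_left₀ hr.ne']
    have hrpow : freq ξ ^ (-s) = r ^ s * freq (r • ξ) ^ (-s) := by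
      rw [freq_smul hr.le, Real.mul_rpow hr.le hω, Real.rpow_neg hr.le, mul_inv_cancel_left₀]
      positivity
    rw [hmin, hrpow, enorm_mul, ENNReal.ofReal_mul (by positivity), Real.enorm_of_nonneg hr.le,
      mul_mul_mul_comm, ENNReal.mul_rpow_of_nonneg _ _ zero_le_two, ← ENNReal.ofReal_mul hr.le,
      ENNReal.ofReal_rpow_of_nonneg (by positivity) zero_le_two, ← Real.rpow_one_add' hr.le
      (by linarith), ← Real.rpow_mul hr.le]
    ring_nf
  have hint := lintegral_comp_smul_E3 (f := fun ξ =>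
    (‖min 1 (freq ξ)⁻¹‖ₑ * ENNReal.ofReal (freq ξ ^ (-s))) ^ (2 : ℝ)) (by fun_prop) hr
  have hcube : r ^ (2 + 2 * s) * (r ^ 3)⁻¹ = r ^ (2 * s - 1) := by
    rw [← Real.rpow_natCast, ← Real.rpow_neg hr.le, ← Real.rpow_add hr]
    congr 1
    push_cast
    ring
  rw [eLpNorm_hdotMeasure (hmeas r), lintegral_congr hscale, lintegral_const_mul' _ _
    ENNReal.ofReal_ne_top, hint, ← mul_assoc, ← ENNReal.ofReal_mul (by positivity), hcube,
    ENNReal.mul_rpow_of_nonneg _ _ (by norm_num), ← eLpNorm_hdotMeasure (hmeas 1), sobolevConst,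
    ENNReal.ofReal_mul ENNReal.toReal_nonneg,
    ENNReal.ofReal_toReal (memLp_min_one_inv_freq hs hs').eLpNorm_ne_top, mul_comm,
    ENNReal.ofReal_rpow_of_nonneg (by positivity) (by norm_num), ← Real.rpow_mul hr.le]
  ring_nf

/-- Real multipliers `k` with `(2π|ξ|)^{s-σ} |k(ξ)| ≤ min(r, 1/(2π|ξ|))`. For `1/2 < s < 3/2` the
pairing with such a `k` is a bounded functional on `Ḣ^σ`, of norm at most a constant times
`r^{s-1/2}`. -/
structure IsAdmissible (s σ r : ℝ) (k : E3 → ℝ) : Prop where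
  measurable : Measurable k
  abs_mul_rpow_le : ∀ ξ ≠ 0, |k ξ| * freq ξ ^ (s - σ) ≤ min r (freq ξ)⁻¹

namespace IsAdmissible

variable {s σ r : ℝ} {k : E3 → ℝ}

theorem abs_le (hk : IsAdmissible s σ r k) {ξ : E3} (hξ : ξ ≠ 0) :
    |k ξ| ≤ min r (freq ξ)⁻¹ * freq ξ ^ (σ - s) := by
  have hmul := mul_le_mul_of_nonneg_right (hk.abs_mul_rpow_le ξ hξ)
    (Real.rpow_nonneg (freq_nonneg ξ) (σ - s))
  rwa [mul_assoc, ← Real.rpow_add (freq_pos hξ), sub_add_sub_cancel, sub_self, Real.rpow_zero,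
    mul_one] at hmul

theorem nonneg (hk : IsAdmissible s σ r k) : 0 ≤ r := by
  obtain ⟨ξ, hξ⟩ := exists_ne (0 : E3)
  exact (mul_nonneg (abs_nonneg _) (Real.rpow_nonneg (freq_nonneg ξ) _)).trans
    ((hk.abs_mul_rpow_le ξ hξ).trans (min_le_left _ _))

theorem eLpNorm_le (hk : IsAdmissible s σ r k) (hs : 1 / 2 < s) (hs' : s < 3 / 2) :
    eLpNorm k 2 (hdotMeasure (-σ)) ≤ ENNReal.ofReal (sobolevConst s * r ^ (s - 1 / 2)) := by
  rw [← eLpNorm_min_inv_freq hs hs' hk.nonneg, eLpNorm_hdotMeasure hk.measurable,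
    eLpNorm_hdotMeasure (f := fun ξ => min r (freq ξ)⁻¹) (measurable_const.min measurable_freq.inv)]
  refine ENNReal.rpow_le_rpow (lintegral_mono_ae ?_) (by norm_num)
  filter_upwards [Measure.ae_ne volume (0 : E3)] with ξ hξ
  have hmin : 0 ≤ min r (freq ξ)⁻¹ := le_min hk.nonneg (inv_nonneg.2 (freq_nonneg ξ))
  have hsplit : freq ξ ^ (-σ) = freq ξ ^ (s - σ) * freq ξ ^ (-s) := by
    rw [← Real.rpow_add (freq_pos hξ)]
    ring_nf
  refine ENNReal.rpow_le_rpow ?_ zero_le_two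
  rw [Real.enorm_eq_ofReal_abs, Real.enorm_of_nonneg hmin, ← ENNReal.ofReal_mul (abs_nonneg _),
    ← ENNReal.ofReal_mul hmin, hsplit, ← mul_assoc]
  exact ENNReal.ofReal_le_ofReal (mul_le_mul_of_nonneg_right (hk.abs_mul_rpow_le ξ hξ)
    (Real.rpow_nonneg (freq_nonneg ξ) _))

end IsAdmissible

theorem isAdmissible_min_mul_rpow (s σ : ℝ) {r : ℝ} (hr : 0 ≤ r) :
    IsAdmissible s σ r fun ξ => min r (freq ξ)⁻¹ * freq ξ ^ (σ - s) := by
  refine ⟨(measurable_const.min measurable_freq.inv).mul (measurable_freq_rpow _), fun ξ hξ => ?_⟩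
  rw [abs_of_nonneg (mul_nonneg (le_min hr (inv_nonneg.2 (freq_nonneg ξ)))
    (Real.rpow_nonneg (freq_nonneg ξ) _)), mul_assoc, ← Real.rpow_add (freq_pos hξ)]
  simp

theorem isAdmissible_sinSymbol (s r : ℝ) : IsAdmissible s s |r| (sinSymbol r) :=
  ⟨measurable_sinSymbol r, fun ξ _ => by simpa using abs_sinSymbol_le_min r ξ⟩

/-- The pairing of an element of `Ḣ^σ` with a real multiplier. -/
def Hdot.act {σ : ℝ} (g : Hdot σ) (k : E3 → ℝ) : ℂ := ∫ ξ, g ξ * (k ξ : ℂ)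

section act

variable {s σ r : ℝ} {k : E3 → ℝ}

theorem Hdot.measurable (g : Hdot σ) : Measurable g := (Lp.stronglyMeasurable g).measurable

theorem Hdot.lintegral_act_le (g : Hdot σ) (hk : IsAdmissible s σ r k) (hs : 1 / 2 < s)
    (hs' : s < 3 / 2) :
    ∫⁻ ξ, ‖g ξ * (k ξ : ℂ)‖ₑ ≤ ENNReal.ofReal (sobolevConst s * r ^ (s - 1 / 2) * ‖g‖) := by
  refine (lintegral_enorm_mul_le g.measurable hk.measurable σ).trans ?_
  rw [← Lp.enorm_def, ← ofReal_norm, mul_comm, ENNReal.ofReal_mul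
    (mul_nonneg (sobolevConst_nonneg s) (Real.rpow_nonneg hk.nonneg _))]
  gcongr
  exact hk.eLpNorm_le hs hs'

theorem Hdot.integrable_act (g : Hdot σ) (hk : IsAdmissible s σ r k) (hs : 1 / 2 < s)
    (hs' : s < 3 / 2) : Integrable fun ξ => g ξ * (k ξ : ℂ) :=
  ⟨(g.measurable.mul (Complex.measurable_ofReal.comp hk.measurable)).aestronglyMeasurable,
    (g.lintegral_act_le hk hs hs').trans_lt ENNReal.ofReal_lt_top⟩

theorem Hdot.norm_act_le (g : Hdot σ) (hk : IsAdmissible s σ r k) (hs : 1 / 2 < s)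
    (hs' : s < 3 / 2) : ‖g.act k‖ ≤ sobolevConst s * r ^ (s - 1 / 2) * ‖g‖ := by
  have hle := (enorm_integral_le_lintegral_enorm fun ξ => g ξ * (k ξ : ℂ)).trans
    (g.lintegral_act_le hk hs hs')
  rw [← ofReal_norm] at hle
  exact (ENNReal.ofReal_le_ofReal_iff (mul_nonneg (mul_nonneg (sobolevConst_nonneg s)
    (Real.rpow_nonneg hk.nonneg _)) (norm_nonneg g))).1 hle

theorem Hdot.act_sub (g g' : Hdot σ) (hk : IsAdmissible s σ r k) (hs : 1 / 2 < s)
    (hs' : s < 3 / 2) : (g - g').act k = g.act k - g'.act k := by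
  rw [Hdot.act, Hdot.act, Hdot.act, ← integral_sub (g.integrable_act hk hs hs')
    (g'.integrable_act hk hs hs')]
  refine integral_congr_ae ?_
  filter_upwards [(absolutelyContinuous_hdotMeasure σ).ae_le (Lp.coeFn_sub g g')] with ξ hξ
  rw [hξ, Pi.sub_apply, sub_mul]

theorem Hdot.continuous_act (g : Hdot σ) {k : ℝ → E3 → ℝ}
    (hk : ∀ ρ, IsAdmissible s σ |ρ| (k ρ)) (hcont : ∀ ξ, Continuous fun ρ => k ρ ξ)
    (hs : 1 / 2 < s) (hs' : s < 3 / 2) : Continuous fun ρ => g.act (k ρ) := by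
  refine continuous_iff_continuousAt.2 fun ρ₀ => ?_
  have hR : 0 ≤ |ρ₀| + 1 := by positivity
  refine continuousAt_of_dominated (bound := fun ξ => ‖g ξ *
      ((min (|ρ₀| + 1) (freq ξ)⁻¹ * freq ξ ^ (σ - s) : ℝ) : ℂ)‖)
    (Eventually.of_forall fun ρ => (g.integrable_act (hk ρ) hs hs').aestronglyMeasurable) ?_
    (g.integrable_act (isAdmissible_min_mul_rpow s σ hR) hs hs').norm
    (Eventually.of_forall fun ξ =>
      (continuous_const.mul (Complex.continuous_ofReal.comp (hcont ξ))).continuousAt)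
  filter_upwards [Metric.ball_mem_nhds ρ₀ one_pos] with ρ hρ
  filter_upwards [Measure.ae_ne volume (0 : E3)] with ξ hξ
  have hρR : |ρ| ≤ |ρ₀| + 1 := by
    rw [Metric.mem_ball, Real.dist_eq] at hρ
    linarith [abs_sub_abs_le_abs_sub ρ ρ₀]
  rw [norm_mul, norm_mul, Complex.norm_real, Complex.norm_real]
  gcongr
  exact ((hk ρ).abs_le hξ).trans ((mul_le_mul_of_nonneg_right (min_le_min_right _ hρR)
    (Real.rpow_nonneg (freq_nonneg ξ) _)).trans (le_abs_self _))

end act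

/-! ### The radial profile of an element of a homogeneous Sobolev space -/

/-- For a radial element `f` of `Ḣ^s` this is the function `r f(r)`. -/
def Hdot.profile {s : ℝ} (g : Hdot s) (r : ℝ) : ℂ := g.act (sinSymbol r)

theorem tendsto_eLpNorm_indicator_ball {E F : Type*} [MetricSpace E] [MeasurableSpace E]
    [OpensMeasurableSpace E] [NormedAddCommGroup F] {μ : Measure E} {p : ℝ≥0∞} (hp0 : p ≠ 0)
    (hp : p ≠ ⊤) {f : E → F} (hf : MemLp f p μ) {x : E} (hx : μ {x} = 0) :
    Tendsto (fun δ => eLpNorm ((Metric.ball x δ).indicator f) p μ) (𝓝[>] 0) (𝓝 0) := by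
  set ν := μ.withDensity fun y => ‖f y‖ₑ ^ p.toReal
  have hball (δ : ℝ) : ν (Metric.ball x δ) = ∫⁻ y in Metric.ball x δ, ‖f y‖ₑ ^ p.toReal ∂μ :=
    withDensity_apply _ measurableSet_ball
  have hfin : ν (Metric.ball x 1) ≠ ⊤ := by
    rw [hball]
    exact ((setLIntegral_le_lintegral _ _).trans_lt
      (lintegral_rpow_enorm_lt_top_of_eLpNorm_lt_top hp0 hp hf.eLpNorm_lt_top)).ne
  have hν : Tendsto (fun δ => ν (Metric.ball x δ)) (𝓝[>] 0) (𝓝 0) := by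
    have hlim := tendsto_measure_biInter_gt (μ := ν) (s := Metric.ball x) (a := 0)
      (fun _ _ => measurableSet_ball.nullMeasurableSet)
      (fun _ _ _ hij => Metric.ball_subset_ball hij) ⟨1, one_pos, hfin⟩
    rwa [Metric.biInter_gt_ball, Metric.closedBall_zero,
      withDensity_absolutelyContinuous μ _ hx] at hlim
  have hpow := (ENNReal.continuous_rpow_const (y := 1 / p.toReal)).continuousAt.tendsto.comp hν
  rw [ENNReal.zero_rpow_of_pos (one_div_pos.2 (ENNReal.toReal_pos hp0 hp))] at hpow
  refine hpow.congr fun δ => ?_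
  rw [Function.comp_apply, hball, eLpNorm_indicator_eq_eLpNorm_restrict measurableSet_ball,
    eLpNorm_eq_lintegral_rpow_enorm_toReal hp0 hp]

section profile

variable {s : ℝ}

theorem Hdot.continuous_profile (g : Hdot s) (hs : 1 / 2 < s) (hs' : s < 3 / 2) :
    Continuous g.profile :=
  g.continuous_act (isAdmissible_sinSymbol s) continuous_sinSymbol hs hs'

theorem Hdot.norm_profile_le (g : Hdot s) (hs : 1 / 2 < s) (hs' : s < 3 / 2) (r : ℝ) :
    ‖g.profile r‖ ≤ sobolevConst s * |r| ^ (s - 1 / 2) * ‖g‖ :=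
  g.norm_act_le (isAdmissible_sinSymbol s r) hs hs'

theorem Hdot.profile_sub (g g' : Hdot s) (hs : 1 / 2 < s) (hs' : s < 3 / 2) (r : ℝ) :
    (g - g').profile r = g.profile r - g'.profile r :=
  g.act_sub g' (isAdmissible_sinSymbol s r) hs hs'

theorem isAdmissible_indicator_compl_ball_sinSymbol (s r : ℝ) {δ : ℝ} (hδ : 0 < δ) :
    IsAdmissible s s (2 * π * δ)⁻¹ ((Metric.ball (0 : E3) δ)ᶜ.indicator (sinSymbol r)) := by
  refine ⟨(measurable_sinSymbol r).indicator measurableSet_ball.compl, fun ξ _ => ?_⟩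
  rw [sub_self, Real.rpow_zero, mul_one]
  by_cases hξ : ξ ∈ Metric.ball (0 : E3) δ
  · rw [indicator_of_notMem (not_not.2 hξ), abs_zero]
    exact le_min (by positivity) (inv_nonneg.2 (freq_nonneg ξ))
  · rw [indicator_of_mem (mem_compl hξ)]
    have hle := (abs_sinSymbol_le_min r ξ).trans (min_le_right _ _)
    refine le_min (hle.trans (inv_anti₀ (by positivity) ?_)) hle
    exact mul_le_mul_of_nonneg_left (by simpa using hξ) Real.two_pi_pos.le

theorem Hdot.enorm_profile_le_add (g : Hdot s) (hs : 1 / 2 < s) (hs' : s < 3 / 2) (r : ℝ) {δ : ℝ}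
    (hδ : 0 < δ) :
    ‖g.profile r‖ₑ
      ≤ eLpNorm ((Metric.ball (0 : E3) δ).indicator g) 2 (hdotMeasure s)
          * ENNReal.ofReal (sobolevConst s * |r| ^ (s - 1 / 2))
        + ENNReal.ofReal (sobolevConst s * (2 * π * δ)⁻¹ ^ (s - 1 / 2) * ‖g‖) := by
  set B := Metric.ball (0 : E3) δ
  have hB : MeasurableSet B := measurableSet_ball
  calc ‖g.profile r‖ₑ ≤ ∫⁻ ξ, ‖g ξ * (sinSymbol r ξ : ℂ)‖ₑ := enorm_integral_le_lintegral_enorm _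
    _ = ∫⁻ ξ, (‖B.indicator g ξ * (sinSymbol r ξ : ℂ)‖ₑ
          + ‖g ξ * ((Bᶜ.indicator (sinSymbol r) ξ : ℝ) : ℂ)‖ₑ) := by
        refine lintegral_congr fun ξ => ?_
        by_cases hξ : ξ ∈ B <;> simp [hξ]
    _ = (∫⁻ ξ, ‖B.indicator g ξ * (sinSymbol r ξ : ℂ)‖ₑ)
          + ∫⁻ ξ, ‖g ξ * ((Bᶜ.indicator (sinSymbol r) ξ : ℝ) : ℂ)‖ₑ :=
        lintegral_add_left (((g.measurable.indicator hB).mul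
          (Complex.measurable_ofReal.comp (measurable_sinSymbol r))).enorm) _
    _ ≤ _ := by
        refine add_le_add ((lintegral_enorm_mul_le (g.measurable.indicator hB)
          (measurable_sinSymbol r) s).trans ?_) (g.lintegral_act_le
            (isAdmissible_indicator_compl_ball_sinSymbol s r hδ) hs hs')
        gcongr
        exact (isAdmissible_sinSymbol s r).eLpNorm_le hs hs'

/-- The frequencies below `δ` contribute at most `r^{s-1/2}` times the small norm of `g` there, and
the others a constant depending on `δ` only. -/
theorem Hdot.tendsto_profile (g : Hdot s) (hs : 1 / 2 < s) (hs' : s < 3 / 2) :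
    Tendsto (fun r => (r ^ (1 / 2 - s) : ℝ) • g.profile r) atTop (𝓝 0) := by
  set K := sobolevConst s
  have hK : 0 ≤ K := sobolevConst_nonneg s
  rw [Metric.tendsto_nhds]
  intro ε hε
  have hη : 0 < ε / (2 * (K + 1)) := by positivity
  obtain ⟨δ, hδsmall, hδ : 0 < δ⟩ :=
    (((tendsto_eLpNorm_indicator_ball two_ne_zero ENNReal.ofNat_ne_top (Lp.memLp g)
      (hdotMeasure_absolutelyContinuous s (measure_singleton 0))).eventually_lt_const
        (ENNReal.ofReal_pos.2 hη)).and self_mem_nhdsWithin).exists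
  set M := K * (2 * π * δ)⁻¹ ^ (s - 1 / 2) * ‖g‖
  have hM : 0 ≤ M := by positivity
  have hlim : Tendsto (fun r : ℝ => M * r ^ (-(s - 1 / 2))) atTop (𝓝 0) := by
    simpa using (tendsto_rpow_neg_atTop (by linarith : 0 < s - 1 / 2)).const_mul M
  filter_upwards [hlim.eventually_lt_const (half_pos hε), eventually_gt_atTop 0] with r hr hr0
  have hbound : ‖g.profile r‖ ≤ ε / (2 * (K + 1)) * (K * r ^ (s - 1 / 2)) + M := by
    have hle := (g.enorm_profile_le_add hs hs' r hδ).trans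
      (add_le_add_left (mul_le_mul_left hδsmall.le _) _)
    rwa [abs_of_pos hr0, ← ofReal_norm, ← ENNReal.ofReal_mul hη.le,
      ← ENNReal.ofReal_add (by positivity) hM, ENNReal.ofReal_le_ofReal_iff (by positivity)] at hle
  have hcancel : r ^ (1 / 2 - s) * r ^ (s - 1 / 2) = 1 := by
    rw [← Real.rpow_add hr0]
    simp
  rw [dist_zero_right, norm_smul, Real.norm_of_nonneg (by positivity)]
  calc r ^ (1 / 2 - s) * ‖g.profile r‖
      ≤ r ^ (1 / 2 - s) * (ε / (2 * (K + 1)) * (K * r ^ (s - 1 / 2)) + M) := by gcongr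
    _ = ε / 2 * (K / (K + 1)) * (r ^ (1 / 2 - s) * r ^ (s - 1 / 2))
          + M * r ^ (-(s - 1 / 2)) := by
        rw [neg_sub]
        field_simp
    _ < ε := by
        have hfrac : K / (K + 1) ≤ 1 := (div_le_one (by positivity)).2 (by linarith)
        rw [hcancel]
        nlinarith

end profile

/-! ### A radial Riemann–Lebesgue lemma and compactness -/

section riemannLebesgue

variable {X : Type*} [MeasurableSpace X] {μ : Measure X} {Φ : X → ℝ}

theorem tendsto_integral_fourierChar_comp_smul_of_nonneg (hΦ : Measurable Φ)
    (hac : μ.map Φ ≪ volume) {f : X → ℝ} (hf : Integrable f μ) (hf0 : 0 ≤ f) :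
    Tendsto (fun w : ℝ => ∫ x, Real.fourierChar (-(Φ x * w)) • (f x : ℂ) ∂μ) (cocompact ℝ)
      (𝓝 0) := by
  set ν := (μ.withDensity fun x => ENNReal.ofReal (f x)).map Φ
  have hfin : IsFiniteMeasure (μ.withDensity fun x => ENNReal.ofReal (f x)) :=
    isFiniteMeasure_withDensity_ofReal hf.2
  have hν : ν ≪ volume := ((withDensity_absolutelyContinuous _ _).map hΦ).trans hac
  refine (Real.tendsto_integral_exp_smul_cocompact fun v =>
    ((ν.rnDeriv volume v).toReal : ℂ)).congr fun w => ?_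
  have hcont : Continuous fun v : ℝ => ((Real.fourierChar (-(v * w)) : Circle) : ℂ) :=
    continuous_subtype_val.comp (Real.continuous_fourierChar.comp (by fun_prop))
  calc ∫ v, Real.fourierChar (-(v * w)) • ((ν.rnDeriv volume v).toReal : ℂ)
      = ∫ v, (ν.rnDeriv volume v).toReal • ((Real.fourierChar (-(v * w)) : Circle) : ℂ) := by
        simp only [Circle.smul_def, smul_eq_mul, Complex.real_smul, mul_comm]
    _ = ∫ v, ((Real.fourierChar (-(v * w)) : Circle) : ℂ) ∂ν := integral_rnDeriv_smul hν
    _ = ∫ x, ((Real.fourierChar (-(Φ x * w)) : Circle) : ℂ)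
          ∂(μ.withDensity fun x => ENNReal.ofReal (f x)) :=
        integral_map hΦ.aemeasurable hcont.aestronglyMeasurable
    _ = ∫ x, Real.fourierChar (-(Φ x * w)) • (f x : ℂ) ∂μ := by
        rw [integral_withDensity_eq_integral_toReal_smul₀ hf.1.aemeasurable.ennreal_ofReal
          (Eventually.of_forall fun _ => ENNReal.ofReal_lt_top)]
        simp only [Circle.smul_def, smul_eq_mul, Complex.real_smul, mul_comm,
          ENNReal.toReal_ofReal (hf0 _)]

theorem integrable_fourierChar_comp_smul (hΦ : Measurable Φ) {f : X → ℂ} (hf : Integrable f μ)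
    (w : ℝ) : Integrable (fun x => Real.fourierChar (-(Φ x * w)) • f x) μ := by
  have hchar : StronglyMeasurable fun x => Real.fourierChar (-(Φ x * w)) :=
    Real.continuous_fourierChar.comp_stronglyMeasurable (hΦ.mul_const w).neg.stronglyMeasurable
  exact hf.congr' (hchar.aestronglyMeasurable.smul hf.1)
    (Eventually.of_forall fun x => (Circle.norm_smul _ _).symm)

theorem tendsto_integral_fourierChar_comp_smul_ofReal (hΦ : Measurable Φ)
    (hac : μ.map Φ ≪ volume) {f : X → ℝ} (hf : Integrable f μ) :
    Tendsto (fun w : ℝ => ∫ x, Real.fourierChar (-(Φ x * w)) • (f x : ℂ) ∂μ) (cocompact ℝ)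
      (𝓝 0) := by
  have hint {g : X → ℝ} (hg : Integrable g μ) (w : ℝ) :
      Integrable (fun x => Real.fourierChar (-(Φ x * w)) • (g x : ℂ)) μ :=
    integrable_fourierChar_comp_smul hΦ hg.ofReal w
  have hlim := (tendsto_integral_fourierChar_comp_smul_of_nonneg hΦ hac hf.pos_part
    fun _ => le_max_right _ _).sub (tendsto_integral_fourierChar_comp_smul_of_nonneg hΦ hac
      hf.neg_part fun _ => le_max_right _ _)
  rw [sub_zero] at hlim
  refine hlim.congr fun w => ?_
  rw [← integral_sub (hint hf.pos_part w) (hint hf.neg_part w)]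
  refine integral_congr_ae (Eventually.of_forall fun x => ?_)
  simp only [← smul_sub, ← Complex.ofReal_sub, max_zero_sub_max_neg_zero_eq_self]

theorem tendsto_integral_fourierChar_comp_smul (hΦ : Measurable Φ) (hac : μ.map Φ ≪ volume)
    {f : X → ℂ} (hf : Integrable f μ) :
    Tendsto (fun w : ℝ => ∫ x, Real.fourierChar (-(Φ x * w)) • f x ∂μ) (cocompact ℝ) (𝓝 0) := by
  have hre : Integrable (fun x => (f x).re) μ := hf.re
  have him : Integrable (fun x => (f x).im) μ := hf.im
  have hlim := (tendsto_integral_fourierChar_comp_smul_ofReal hΦ hac hre).add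
    ((tendsto_integral_fourierChar_comp_smul_ofReal hΦ hac him).mul_const Complex.I)
  rw [zero_mul, add_zero] at hlim
  refine hlim.congr fun w => ?_
  have hre' : Integrable (fun x => Real.fourierChar (-(Φ x * w)) • ((f x).re : ℂ)) μ :=
    integrable_fourierChar_comp_smul hΦ hre.ofReal w
  have him' : Integrable (fun x => Real.fourierChar (-(Φ x * w)) • ((f x).im : ℂ)) μ :=
    integrable_fourierChar_comp_smul hΦ him.ofReal w
  rw [← integral_mul_const, ← integral_add hre' (him'.mul_const _)]
  refine integral_congr_ae (Eventually.of_forall fun x => ?_)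
  simp only [smul_mul_assoc, ← smul_add, Complex.re_add_im]

end riemannLebesgue

theorem map_norm_absolutelyContinuous : (volume : Measure E3).map norm ≪ volume := by
  refine Measure.AbsolutelyContinuous.mk fun N hN hN0 => ?_
  rw [Measure.map_apply measurable_norm hN]
  have hae : ∀ᵐ x : E3, ‖x‖ ∉ N := ae_norm_of_ae volume (P := (· ∉ N))
    ((measure_eq_zero_iff_ae_notMem.1 hN0).mono fun _ h _ => h)
  exact measure_eq_zero_iff_ae_notMem.2 hae

theorem cos_mul_freq_eq (w : ℝ) (ξ : E3) : (Real.cos (w * freq ξ) : ℂ)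
    = ((Real.fourierChar (-(‖ξ‖ * w)) : Circle) + (Real.fourierChar (-(‖ξ‖ * -w)) : Circle))
      / 2 := by
  have hphase : w * freq ξ = 2 * π * (‖ξ‖ * w) := by
    rw [freq]
    ring
  rw [hphase, Complex.ofReal_cos, Complex.cos, Real.fourierChar_apply, Real.fourierChar_apply]
  push_cast
  ring_nf

theorem sin_mul_freq_eq (w : ℝ) (ξ : E3) : (Real.sin (w * freq ξ) : ℂ)
    = ((Real.fourierChar (-(‖ξ‖ * w)) : Circle) - (Real.fourierChar (-(‖ξ‖ * -w)) : Circle))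
      * Complex.I / 2 := by
  have hphase : w * freq ξ = 2 * π * (‖ξ‖ * w) := by
    rw [freq]
    ring
  rw [hphase, Complex.ofReal_sin, Complex.sin, Real.fourierChar_apply, Real.fourierChar_apply]
  push_cast
  ring_nf

section

variable {f : E3 → ℂ}

theorem tendsto_integral_fourierChar_norm_smul_atTop (hf : Integrable f) :
    Tendsto (fun y : ℝ => ∫ ξ, Real.fourierChar (-(‖ξ‖ * y)) • f ξ) atTop (𝓝 0) :=
  (tendsto_integral_fourierChar_comp_smul measurable_norm map_norm_absolutelyContinuous
    hf).mono_left atTop_le_cocompact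

theorem tendsto_integral_fourierChar_norm_smul_neg (hf : Integrable f) :
    Tendsto (fun y : ℝ => ∫ ξ, Real.fourierChar (-(‖ξ‖ * -y)) • f ξ) atTop (𝓝 0) :=
  ((tendsto_integral_fourierChar_comp_smul measurable_norm map_norm_absolutelyContinuous
    hf).mono_left atBot_le_cocompact).comp tendsto_neg_atTop_atBot

theorem tendsto_integral_mul_cos_freq (hf : Integrable f) :
    Tendsto (fun y : ℝ => ∫ ξ, f ξ * (Real.cos (y * freq ξ) : ℂ)) atTop (𝓝 0) := by
  have hlim := ((tendsto_integral_fourierChar_norm_smul_atTop hf).add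
    (tendsto_integral_fourierChar_norm_smul_neg hf)).div_const 2
  rw [add_zero, zero_div] at hlim
  refine hlim.congr fun y => ?_
  rw [← integral_add (integrable_fourierChar_comp_smul measurable_norm hf y)
    (integrable_fourierChar_comp_smul measurable_norm hf (-y)), ← integral_div]
  refine integral_congr_ae (Eventually.of_forall fun ξ => ?_)
  simp only [cos_mul_freq_eq, Circle.smul_def, smul_eq_mul]
  ring

theorem tendsto_integral_mul_sin_freq (hf : Integrable f) :
    Tendsto (fun y : ℝ => ∫ ξ, f ξ * (Real.sin (y * freq ξ) : ℂ)) atTop (𝓝 0) := by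
  have hlim := ((tendsto_integral_fourierChar_norm_smul_atTop hf).sub
    (tendsto_integral_fourierChar_norm_smul_neg hf)).mul_const (Complex.I / 2)
  rw [sub_zero, zero_mul] at hlim
  refine hlim.congr fun y => ?_
  rw [← integral_sub (integrable_fourierChar_comp_smul measurable_norm hf y)
    (integrable_fourierChar_comp_smul measurable_norm hf (-y)), ← integral_mul_const]
  refine integral_congr_ae (Eventually.of_forall fun ξ => ?_)
  simp only [sin_mul_freq_eq, Circle.smul_def, smul_eq_mul]
  ring

end

theorem exists_forall_norm_le_of_isCompact {X E : Type*} [PseudoMetricSpace X]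
    [SeminormedAddCommGroup E] {S : Set X} (hS : IsCompact (closure S)) {Φ : ℝ → X → E} {C : ℝ}
    (hΦ : ∀ r, 0 < r → ∀ x y, ‖Φ r x - Φ r y‖ ≤ C * dist x y)
    (hlim : ∀ x, Tendsto (fun r => Φ r x) atTop (𝓝 0)) {ε : ℝ} (hε : 0 < ε) :
    ∃ R > 0, ∀ r ≥ R, ∀ x ∈ S, ‖Φ r x‖ ≤ ε := by
  obtain ⟨t, -, ht, hcov⟩ := hS.finite_cover_balls (e := ε / (2 * (|C| + 1))) (by positivity)
  have hcenters : ∀ᶠ r in atTop, ∀ x ∈ t, ‖Φ r x‖ < ε / 2 :=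
    (eventually_all_finite ht).2 fun x _ =>
      (tendsto_zero_iff_norm_tendsto_zero.1 (hlim x)).eventually_lt_const (by positivity)
  obtain ⟨R, hR⟩ := eventually_atTop.1 hcenters
  refine ⟨max R 1, by positivity, fun r hr x hx => ?_⟩
  obtain ⟨y, hy, hxy⟩ := mem_iUnion₂.1 (hcov (subset_closure hx))
  have hr0 : 0 < r := one_pos.trans_le ((le_max_right _ _).trans hr)
  have hnear : C * dist x y ≤ ε / 2 :=
    calc C * dist x y ≤ (|C| + 1) * (ε / (2 * (|C| + 1))) :=
          mul_le_mul (by linarith [le_abs_self C]) (Metric.mem_ball.1 hxy).le dist_nonneg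
            (by positivity)
      _ = ε / 2 := by field_simp
  calc ‖Φ r x‖ = ‖(Φ r x - Φ r y) + Φ r y‖ := by rw [sub_add_cancel]
    _ ≤ ‖Φ r x - Φ r y‖ + ‖Φ r y‖ := norm_add_le _ _
    _ ≤ C * dist x y + ε / 2 :=
        add_le_add (hΦ r hr0 x y) (hR r ((le_max_left _ _).trans hr) y hy).le
    _ ≤ ε := by linarith

/-! ### The free evolution of radial profiles -/

theorem IsAdmissible.mul_left {s σ σ' r : ℝ} {k m : E3 → ℝ} (hk : IsAdmissible s σ r k)
    (hm : Measurable m) (hle : ∀ ξ ≠ 0, |m ξ| * freq ξ ^ (σ - σ') ≤ 1) :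
    IsAdmissible s σ' r fun ξ => m ξ * k ξ := by
  refine ⟨hm.mul hk.measurable, fun ξ hξ => le_trans ?_ (hk.abs_mul_rpow_le ξ hξ)⟩
  rw [← sub_add_sub_cancel s σ σ', Real.rpow_add (freq_pos hξ), abs_mul, mul_comm (_ ^ _),
    mul_mul_mul_comm]
  exact mul_le_of_le_one_left
    (mul_nonneg (abs_nonneg _) (Real.rpow_nonneg (freq_nonneg ξ) _)) (hle ξ hξ)

section free

variable {s : ℝ}

theorem isAdmissible_cos_mul_sinSymbol (s t ρ : ℝ) :
    IsAdmissible s s |ρ| fun ξ => Real.cos (t * freq ξ) * sinSymbol ρ ξ :=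
  have hfreq := measurable_freq
  (isAdmissible_sinSymbol s ρ).mul_left (by fun_prop) fun ξ _ => by
    simpa using Real.abs_cos_le_one (t * freq ξ)

theorem abs_sinSymbol_mul_freq_le (t : ℝ) {ξ : E3} (hξ : ξ ≠ 0) :
    |sinSymbol t ξ| * freq ξ ≤ 1 := by
  rw [sinSymbol, abs_div, abs_of_pos (freq_pos hξ), div_mul_cancel₀ _ (freq_pos hξ).ne']
  exact Real.abs_sin_le_one _

theorem isAdmissible_sinSymbol_mul_sinSymbol (s t ρ : ℝ) :
    IsAdmissible s (s - 1) |ρ| fun ξ => sinSymbol t ξ * sinSymbol ρ ξ :=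
  (isAdmissible_sinSymbol s ρ).mul_left (measurable_sinSymbol t) fun ξ hξ => by
    simpa using abs_sinSymbol_mul_freq_le t hξ

theorem isAdmissible_inv_freq_mul_sinSymbol (s ρ : ℝ) :
    IsAdmissible s (s - 1) |ρ| fun ξ => (freq ξ)⁻¹ * sinSymbol ρ ξ :=
  (isAdmissible_sinSymbol s ρ).mul_left measurable_freq.inv fun ξ hξ => by
    rw [sub_sub_cancel, Real.rpow_one, abs_of_pos (inv_pos.2 (freq_pos hξ)),
      inv_mul_cancel₀ (freq_pos hξ).ne']

/-- The profile at radius `ρ` of the free wave at time `t` with initial data `(g₀, g₁)`. -/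
def freeField (t : ℝ) (g₀ : Hdot s) (g₁ : Hdot (s - 1)) (ρ : ℝ) : ℂ :=
  g₀.act (fun ξ => Real.cos (t * freq ξ) * sinSymbol ρ ξ) +
    g₁.act (fun ξ => sinSymbol t ξ * sinSymbol ρ ξ)

/-- The increment of the profile of a free wave along an incoming null segment of length `h` that
ends at radius `y` when traced back to time `0`; see `freeField_sub_freeField`. -/
def nullDiff (h y : ℝ) (q : Hdot s × Hdot (s - 1)) : ℂ :=
  q.2.act (fun ξ => sinSymbol y ξ * sinSymbol h ξ) -
    q.1.act (fun ξ => Real.cos (y * freq ξ) * sinSymbol h ξ)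

theorem continuous_freeField (hs : 1 / 2 < s) (hs' : s < 3 / 2) (t : ℝ) (g₀ : Hdot s)
    (g₁ : Hdot (s - 1)) : Continuous (freeField t g₀ g₁) :=
  (g₀.continuous_act (isAdmissible_cos_mul_sinSymbol s t)
    (fun ξ => continuous_const.mul (continuous_sinSymbol ξ)) hs hs').add
  (g₁.continuous_act (isAdmissible_sinSymbol_mul_sinSymbol s t)
    (fun ξ => continuous_const.mul (continuous_sinSymbol ξ)) hs hs')

theorem cos_mul_sinSymbol_sub (N h ρ : ℝ) (ξ : E3) :
    Real.cos ((h - N) * freq ξ) * sinSymbol (ρ - h) ξ - Real.cos (-N * freq ξ) * sinSymbol ρ ξ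
      = -(Real.cos ((ρ + N - h) * freq ξ) * sinSymbol h ξ) := by
  simp only [sinSymbol]
  rw [mul_div_assoc', mul_div_assoc', mul_div_assoc', ← sub_div, ← neg_div]
  congr 1
  simp only [sub_mul, add_mul, neg_mul, Real.cos_neg, Real.cos_sub, Real.sin_sub, Real.cos_add,
    Real.sin_add]
  linear_combination (Real.cos (N * freq ξ) * Real.sin (ρ * freq ξ)) *
    Real.sin_sq_add_cos_sq (h * freq ξ)

theorem sinSymbol_mul_sinSymbol_sub (N h ρ : ℝ) (ξ : E3) :
    sinSymbol (h - N) ξ * sinSymbol (ρ - h) ξ - sinSymbol (-N) ξ * sinSymbol ρ ξ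
      = sinSymbol (ρ + N - h) ξ * sinSymbol h ξ := by
  simp only [sinSymbol, div_mul_div_comm]
  rw [← sub_div]
  congr 1
  simp only [sub_mul, add_mul, neg_mul, Real.sin_neg, Real.sin_sub, Real.cos_add, Real.sin_add]
  linear_combination (-(Real.sin (N * freq ξ) * Real.sin (ρ * freq ξ))) *
    Real.sin_sq_add_cos_sq (h * freq ξ)

theorem Hdot.act_neg {σ : ℝ} (g : Hdot σ) (k : E3 → ℝ) : g.act (fun ξ => -k ξ) = -g.act k := by
  simp only [Hdot.act, Complex.ofReal_neg, mul_neg, integral_neg]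

theorem Hdot.act_sub_act {σ r r' : ℝ} (g : Hdot σ) {k k' : E3 → ℝ} (hk : IsAdmissible s σ r k)
    (hk' : IsAdmissible s σ r' k') (hs : 1 / 2 < s) (hs' : s < 3 / 2) :
    g.act k - g.act k' = g.act fun ξ => k ξ - k' ξ := by
  simp only [Hdot.act, Complex.ofReal_sub, mul_sub]
  exact (integral_sub (g.integrable_act hk hs hs') (g.integrable_act hk' hs hs')).symm

theorem freeField_sub_freeField (hs : 1 / 2 < s) (hs' : s < 3 / 2) (N h ρ : ℝ) (g₀ : Hdot s)
    (g₁ : Hdot (s - 1)) :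
    freeField (h - N) g₀ g₁ (ρ - h) - freeField (-N) g₀ g₁ ρ
      = nullDiff h (ρ + N - h) (g₀, g₁) := by
  simp only [freeField, nullDiff]
  rw [add_sub_add_comm,
    g₀.act_sub_act (isAdmissible_cos_mul_sinSymbol s _ _) (isAdmissible_cos_mul_sinSymbol s _ _)
      hs hs',
    g₁.act_sub_act (isAdmissible_sinSymbol_mul_sinSymbol s _ _)
      (isAdmissible_sinSymbol_mul_sinSymbol s _ _) hs hs']
  simp only [cos_mul_sinSymbol_sub, sinSymbol_mul_sinSymbol_sub, Hdot.act_neg]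
  ring

theorem norm_nullDiff_sub_le (hs : 1 / 2 < s) (hs' : s < 3 / 2) (h y : ℝ)
    (q q' : Hdot s × Hdot (s - 1)) :
    ‖nullDiff h y q - nullDiff h y q'‖
      ≤ 2 * (sobolevConst s * |h| ^ (s - 1 / 2)) * dist q q' := by
  have hcos := isAdmissible_cos_mul_sinSymbol s y h
  have hsin := isAdmissible_sinSymbol_mul_sinSymbol s y h
  set K := sobolevConst s * |h| ^ (s - 1 / 2)
  have hK : 0 ≤ K := mul_nonneg (sobolevConst_nonneg s) (by positivity)
  rw [nullDiff, nullDiff, sub_sub_sub_comm, ← Hdot.act_sub _ _ hsin hs hs',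
    ← Hdot.act_sub _ _ hcos hs hs']
  calc _ ≤ K * ‖q.2 - q'.2‖ + K * ‖q.1 - q'.1‖ := (norm_sub_le _ _).trans
        (add_le_add (Hdot.norm_act_le _ hsin hs hs') (Hdot.norm_act_le _ hcos hs hs'))
    _ ≤ K * dist q q' + K * dist q q' := by
        rw [← dist_eq_norm, ← dist_eq_norm]
        gcongr
        exacts [le_max_right _ _, le_max_left _ _]
    _ = 2 * K * dist q q' := by ring

theorem tendsto_nullDiff (hs : 1 / 2 < s) (hs' : s < 3 / 2) (h : ℝ) (q : Hdot s × Hdot (s - 1)) :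
    Tendsto (fun y => nullDiff h y q) atTop (𝓝 0) := by
  have hlim := (tendsto_integral_mul_sin_freq
    (q.2.integrable_act (isAdmissible_inv_freq_mul_sinSymbol s h) hs hs')).sub
      (tendsto_integral_mul_cos_freq
        (q.1.integrable_act (isAdmissible_sinSymbol s h) hs hs'))
  rw [sub_zero] at hlim
  refine hlim.congr fun y => ?_
  simp only [nullDiff, Hdot.act, sinSymbol]
  congr 1 <;> refine integral_congr_ae (Eventually.of_forall fun ξ => ?_) <;> push_cast <;> ring

theorem exists_forall_norm_nullDiff_le (hs : 1 / 2 < s) (hs' : s < 3 / 2)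
    {S : Set (Hdot s × Hdot (s - 1))} (hS : IsCompact (closure S)) (h : ℝ) {ε : ℝ} (hε : 0 < ε) :
    ∃ Y > 0, ∀ y ≥ Y, ∀ q ∈ S, ‖nullDiff h y q‖ ≤ ε :=
  exists_forall_norm_le_of_isCompact hS (fun y _ => norm_nullDiff_sub_le hs hs' h y)
    (tendsto_nullDiff hs hs' h) hε

end free

/-! ### Testing against radial functions -/

section testing

variable {s σ : ℝ} {χ : ℝ → ℝ}

theorem IsTest.integrable_mul {a : ℝ} (hχ : IsTest a χ) {f : ℝ → ℂ} (hf : Continuous f) :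
    Integrable fun y => (χ y : ℂ) * f y :=
  ((Complex.continuous_ofReal.comp hχ.continuous).mul hf).integrable_of_hasCompactSupport
    (hχ.hasCompactSupport.comp_left (g := Complex.ofReal) Complex.ofReal_zero).mul_right

theorem integrable_prod_test_mul_act (hs : 1 / 2 < s) (hs' : s < 3 / 2) (hχ : Continuous χ)
    (hχc : HasCompactSupport χ) (g : Hdot σ) {m : E3 → ℝ} (hm : Measurable m)
    (hle : ∀ ξ ≠ 0, |m ξ| * freq ξ ^ (s - σ) ≤ 1) :
    Integrable (fun q : ℝ × E3 => (χ q.1 : ℂ) * (g q.2 * ((m q.2 * sinSymbol q.1 q.2 : ℝ) : ℂ)))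
      (volume.prod volume) := by
  obtain ⟨L, hL⟩ := exists_forall_lt_norm_eq_zero hχc
  have hadm : IsAdmissible s σ |L| fun ξ => m ξ * min |L| (freq ξ)⁻¹ := by
    simpa only [sub_self, Real.rpow_zero, mul_one] using
      (isAdmissible_min_mul_rpow s s (abs_nonneg L)).mul_left hm hle
  refine ((hχ.integrable_of_hasCompactSupport hχc).ofReal.mul_prod
    (g.integrable_act hadm hs hs')).mono ?_ ?_
  · have hsin : Measurable fun q : ℝ × E3 => sinSymbol q.1 q.2 := by
      have := measurable_freq
      unfold sinSymbol
      fun_prop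
    have hgm := Hdot.measurable g
    have hχm := hχ.measurable
    exact Measurable.aestronglyMeasurable (by fun_prop)
  · refine Eventually.of_forall fun q => ?_
    simp only [norm_mul, RCLike.norm_ofReal, Complex.norm_real, Real.norm_eq_abs]
    by_cases hq : L < |q.1|
    · simp [hL _ hq]
    · have hsin : |sinSymbol q.1 q.2| ≤ |min |L| (freq q.2)⁻¹| :=
        (abs_sinSymbol_le_min q.1 q.2).trans
          ((min_le_min_right _ ((not_lt.1 hq).trans (le_abs_self L))).trans (le_abs_self _))
      gcongr

theorem integral_test_mul_act_inner (χ : ℝ → ℝ) (g : Hdot σ) (m : E3 → ℝ) (ξ : E3) :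
    ∫ ρ, (χ ρ : ℂ) * (g ξ * ((m ξ * sinSymbol ρ ξ : ℝ) : ℂ))
      = g ξ * (m ξ : ℂ) * ((∫ ρ, χ ρ * sinSymbol ρ ξ : ℝ) : ℂ) := by
  rw [← integral_complex_ofReal, ← integral_const_mul]
  refine integral_congr_ae (Eventually.of_forall fun ρ => ?_)
  push_cast
  ring

theorem integrable_mul_integral_test (hs : 1 / 2 < s) (hs' : s < 3 / 2) (hχ : Continuous χ)
    (hχc : HasCompactSupport χ) (g : Hdot σ) {m : E3 → ℝ} (hm : Measurable m)
    (hle : ∀ ξ ≠ 0, |m ξ| * freq ξ ^ (s - σ) ≤ 1) :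
    Integrable fun ξ => g ξ * (m ξ : ℂ) * ((∫ ρ, χ ρ * sinSymbol ρ ξ : ℝ) : ℂ) := by
  simpa only [integral_test_mul_act_inner] using
    (integrable_prod_test_mul_act hs hs' hχ hχc g hm hle).integral_prod_right

theorem integral_test_mul_act (hs : 1 / 2 < s) (hs' : s < 3 / 2) (hχ : Continuous χ)
    (hχc : HasCompactSupport χ) (g : Hdot σ) {m : E3 → ℝ} (hm : Measurable m)
    (hle : ∀ ξ ≠ 0, |m ξ| * freq ξ ^ (s - σ) ≤ 1) :
    ∫ ρ, (χ ρ : ℂ) * g.act (fun ξ => m ξ * sinSymbol ρ ξ)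
      = ∫ ξ, g ξ * (m ξ : ℂ) * ((∫ ρ, χ ρ * sinSymbol ρ ξ : ℝ) : ℂ) := by
  simp only [Hdot.act, ← integral_const_mul, ← integral_test_mul_act_inner]
  exact integral_integral_swap (integrable_prod_test_mul_act hs hs' hχ hχc g hm hle)

theorem pair_toSchwartz (hs : 1 / 2 < s) (hs' : s < 3 / 2) (hχ : IsTest 0 χ) (g : Hdot s) :
    g.pair hχ.toSchwartz = ∫ ρ, (χ ρ : ℂ) * g.profile ρ := by
  have htest := integral_test_mul_act hs hs' hχ.continuous hχ.hasCompactSupport g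
    (m := fun _ => 1) measurable_const fun ξ _ => by simp
  simp only [one_mul, Complex.ofReal_one, mul_one] at htest
  refine Eq.trans ?_ htest.symm
  rw [Hdot.pair]
  refine integral_congr_ae ?_
  filter_upwards [Measure.ae_ne volume (0 : E3)] with ξ hξ
  rw [hχ.fourierInv_toSchwartz hξ]

theorem freeWave_toSchwartz (hs : 1 / 2 < s) (hs' : s < 3 / 2) (hχ : IsTest 0 χ) (t : ℝ)
    (g₀ : Hdot s) (g₁ : Hdot (s - 1)) :
    freeWave t g₀ g₁ hχ.toSchwartz = ∫ ρ, (χ ρ : ℂ) * freeField t g₀ g₁ ρ := by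
  have hχc := hχ.hasCompactSupport
  have hcosm : Measurable fun ξ => Real.cos (t * freq ξ) := by
    have := measurable_freq
    fun_prop
  have hcos_le : ∀ ξ : E3, ξ ≠ 0 → |Real.cos (t * freq ξ)| * freq ξ ^ (s - s) ≤ 1 := fun ξ _ => by
    simpa using Real.abs_cos_le_one _
  have hsin_le : ∀ ξ : E3, ξ ≠ 0 → |sinSymbol t ξ| * freq ξ ^ (s - (s - 1)) ≤ 1 := fun ξ hξ => by
    simpa using abs_sinSymbol_mul_freq_le t hξ
  have hcont₀ := g₀.continuous_act (isAdmissible_cos_mul_sinSymbol s t)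
    (fun ξ => continuous_const.mul (continuous_sinSymbol ξ)) hs hs'
  have hcont₁ := g₁.continuous_act (isAdmissible_sinSymbol_mul_sinSymbol s t)
    (fun ξ => continuous_const.mul (continuous_sinSymbol ξ)) hs hs'
  simp only [freeField, mul_add]
  rw [integral_add (hχ.integrable_mul hcont₀) (hχ.integrable_mul hcont₁),
    integral_test_mul_act hs hs' hχ.continuous hχc g₀ hcosm hcos_le,
    integral_test_mul_act hs hs' hχ.continuous hχc g₁ (measurable_sinSymbol t) hsin_le,
    ← integral_add (integrable_mul_integral_test hs hs' hχ.continuous hχc g₀ hcosm hcos_le)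
      (integrable_mul_integral_test hs hs' hχ.continuous hχc g₁ (measurable_sinSymbol t) hsin_le),
    freeWave]
  refine integral_congr_ae ?_
  filter_upwards [Measure.ae_ne volume (0 : E3)] with ξ hξ
  rw [hχ.fourierInv_toSchwartz hξ]
  ring

end testing

section localization

variable {a ρ b ε : ℝ} {χ : ℝ → ℝ}

theorem exists_isTest_integral_eq_one (hρ : a < ρ) {P : ℝ → Prop} (hP : ∀ᶠ y in 𝓝 ρ, P y) :
    ∃ χ, IsTest a χ ∧ (∀ y, 0 ≤ χ y) ∧ ∫ y, χ y = 1 ∧ ∀ y, χ y ≠ 0 → P y := by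
  obtain ⟨δ, hδ, hball⟩ := Metric.eventually_nhds_iff_ball.1 (hP.and (Ioi_mem_nhds hρ))
  let φ : ContDiffBump ρ := ⟨δ / 4, δ / 2, by positivity, by linarith⟩
  have hδφ : φ.rOut < δ := by
    change δ / 2 < δ
    linarith
  refine ⟨φ.normed volume, ⟨φ.contDiff_normed, φ.hasCompactSupport_normed, ?_⟩,
    φ.nonneg_normed, φ.integral_normed, fun y hy => ?_⟩
  · rw [φ.tsupport_normed_eq]
    exact fun y hy => (hball y (Metric.closedBall_subset_ball hδφ hy)).2
  · have hmem : y ∈ Function.support (φ.normed volume) := hy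
    rw [φ.support_normed_eq] at hmem
    exact (hball y (Metric.ball_subset_ball hδφ.le hmem)).1

theorem norm_integral_test_mul_sub_le (hχ : IsTest a χ) (hχ0 : ∀ y, 0 ≤ χ y)
    (hχ1 : ∫ y, χ y = 1) {f : ℝ → ℂ} (hf : Continuous f) {c : ℂ}
    (hfc : ∀ y, χ y ≠ 0 → ‖f y - c‖ ≤ ε) : ‖(∫ y, (χ y : ℂ) * f y) - c‖ ≤ ε := by
  have hc : c = ∫ y, (χ y : ℂ) * c := by
    rw [integral_mul_const, integral_complex_ofReal, hχ1, Complex.ofReal_one, one_mul]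
  calc ‖(∫ y, (χ y : ℂ) * f y) - c‖ = ‖∫ y, ((χ y : ℂ) * f y - (χ y : ℂ) * c)‖ := by
        rw [integral_sub (hχ.integrable_mul hf) (hχ.integrable_mul continuous_const), ← hc]
    _ ≤ ∫ y, χ y * ε := by
        refine norm_integral_le_of_norm_le (hχ.integrable.mul_const _)
          (Eventually.of_forall fun y => ?_)
        rw [← mul_sub, norm_mul, Complex.norm_real, Real.norm_of_nonneg (hχ0 y)]
        by_cases hy : χ y = 0
        · simp [hy]
        · exact mul_le_mul_of_nonneg_left (hfc y hy) (hχ0 y)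
    _ = ε := by rw [integral_mul_const, hχ1, one_mul]

theorem lintegral_enorm_mul_ofReal_le (hχ : Integrable χ) (hχ0 : ∀ y, 0 ≤ χ y)
    (hχ1 : ∫ y, χ y = 1) {B : ℝ → ℝ} (hB : ∀ y, χ y ≠ 0 → B y ≤ b) :
    ∫⁻ y, ‖χ y‖ₑ * ENNReal.ofReal (B y) ≤ ENNReal.ofReal b := by
  calc ∫⁻ y, ‖χ y‖ₑ * ENNReal.ofReal (B y) ≤ ∫⁻ y, ‖χ y‖ₑ * ENNReal.ofReal b := by
        refine lintegral_mono fun y => ?_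
        by_cases hy : χ y = 0
        · simp [hy]
        · exact mul_le_mul_right (ENNReal.ofReal_le_ofReal (hB y hy)) _
    _ = ENNReal.ofReal b := by
        rw [lintegral_mul_const' _ _ ENNReal.ofReal_ne_top,
          ← ofReal_integral_norm_eq_lintegral_enorm hχ]
        simp only [Real.norm_of_nonneg (hχ0 _), hχ1, ENNReal.ofReal_one, one_mul]

theorem norm_le_of_forall_test {f : ℝ → ℂ} {B : ℝ → ℝ} (hf : Continuous f)
    (hB : ContinuousAt B ρ) (hB0 : 0 ≤ B ρ)
    (htest : ∀ χ, IsTest a χ →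
      ‖∫ y, (χ y : ℂ) * f y‖ₑ ≤ ∫⁻ y, ‖χ y‖ₑ * ENNReal.ofReal (B y))
    (hρ : a < ρ) : ‖f ρ‖ ≤ B ρ := by
  refine le_of_forall_pos_le_add fun ε hε => ?_
  have hf_near : ∀ᶠ y in 𝓝 ρ, ‖f y - f ρ‖ < ε / 2 := by
    simpa only [dist_eq_norm] using Metric.tendsto_nhds.1 hf.continuousAt _ (half_pos hε)
  have hB_near : ∀ᶠ y in 𝓝 ρ, B y < B ρ + ε / 2 := hB.eventually_lt_const (by linarith)
  obtain ⟨χ, hχ, hχ0, hχ1, hsupp⟩ := exists_isTest_integral_eq_one hρ (hf_near.and hB_near)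
  have hclose : ‖(∫ y, (χ y : ℂ) * f y) - f ρ‖ ≤ ε / 2 :=
    norm_integral_test_mul_sub_le hχ hχ0 hχ1 hf fun y hy => (hsupp y hy).1.le
  have havg : ‖∫ y, (χ y : ℂ) * f y‖ ≤ B ρ + ε / 2 := by
    have hle := (htest χ hχ).trans (lintegral_enorm_mul_ofReal_le hχ.integrable hχ0 hχ1
      fun y hy => (hsupp y hy).2.le)
    rwa [← ofReal_norm, ENNReal.ofReal_le_ofReal_iff (by linarith)] at hle
  have htri := norm_sub_norm_le (f ρ) (∫ y, (χ y : ℂ) * f y)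
  rw [norm_sub_rev] at htri
  linarith

end localization

/-! ### Estimates along null segments -/

section nullSegment

variable {χ : ℝ → ℝ}

theorem lintegral_mul_radialKernel_le {R M γ : ℝ} {g : E3 → ℝ}
    (hg : ∀ᵐ x, R < ‖x‖ → |g x| ≤ M * ‖x‖ ^ (-γ - 1)) {κ : ℝ → ℝ} (hκ : Measurable κ)
    (hκ0 : ∀ r, 0 < r → r ≤ R → κ r = 0) :
    ∫⁻ x, ‖(g x : ℂ) * radialKernel κ x‖ₑ
      ≤ ∫⁻ r in Ioi (0 : ℝ), ENNReal.ofReal (M * r ^ (-γ)) * ‖κ r‖ₑ := by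
  set w : ℝ → ℝ≥0∞ := fun r => ENNReal.ofReal (M * r ^ (-γ - 1) / (4 * π * r)) * ‖κ r‖ₑ
  calc ∫⁻ x, ‖(g x : ℂ) * radialKernel κ x‖ₑ ≤ ∫⁻ x : E3, w ‖x‖ := by
        refine lintegral_mono_ae ?_
        filter_upwards [hg, Measure.ae_ne volume (0 : E3)] with x hx hx0
        have hpos := norm_pos_iff.2 hx0
        rcases le_or_gt ‖x‖ R with hxR | hxR
        · simp [radialKernel, hκ0 _ hpos hxR]
        · have hnorm : ‖(g x : ℂ) * radialKernel κ x‖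
              = |g x| / (4 * π * ‖x‖) * ‖κ ‖x‖‖ := by
            rw [radialKernel, norm_mul, Complex.norm_real, Complex.norm_real, norm_div,
              Real.norm_of_nonneg (by positivity : 0 ≤ 4 * π * ‖x‖), Real.norm_eq_abs]
            ring
          rw [← ofReal_norm, hnorm, ENNReal.ofReal_mul (by positivity), ofReal_norm]
          dsimp only [w]
          gcongr
          exact hx hxR
    _ = ∫⁻ r in Ioi (0 : ℝ), ENNReal.ofReal (M * r ^ (-γ)) * ‖κ r‖ₑ := by
        rw [lintegral_norm_E3 (by fun_prop)]
        refine setLIntegral_congr_fun measurableSet_Ioi fun r hr => ?_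
        have hr0 : 0 < r := hr
        dsimp only [w]
        rw [← mul_assoc, ← ENNReal.ofReal_mul (by positivity), Real.rpow_sub hr0, Real.rpow_one]
        congr 2
        field_simp

theorem lintegral_Ioi_rpow_mul_enorm_comp_add_le {b w γ : ℝ} (hχ : ∀ y ≤ b, χ y = 0)
    (hw : w ≤ b) (hγ : 0 ≤ γ) :
    ∫⁻ r in Ioi (0 : ℝ), ENNReal.ofReal (r ^ (-γ)) * ‖χ (r + w)‖ₑ
      ≤ ∫⁻ y, ‖χ y‖ₑ * ENNReal.ofReal ((y - b) ^ (-γ)) := by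
  rw [← lintegral_add_right_eq_self (fun y => ‖χ y‖ₑ * ENNReal.ofReal ((y - b) ^ (-γ))) w]
  refine (lintegral_mono fun r => ?_).trans (setLIntegral_le_lintegral (Ioi 0) _)
  rw [mul_comm]
  rcases le_or_gt (r + w) b with hr | hr
  · simp [hχ _ hr]
  · exact mul_le_mul_right (ENNReal.ofReal_le_ofReal
      (Real.rpow_le_rpow_of_nonpos (by linarith) (by linarith) (by linarith))) _

theorem lintegral_mul_radialKernel_le_of_enorm_le {R M γ h σ : ℝ} (hR : 0 ≤ R) (hM : 0 ≤ M)
    (hγ : 0 ≤ γ) (hσ : 0 ≤ σ) {g : E3 → ℝ} (hg : ∀ᵐ x, R < ‖x‖ → |g x| ≤ M * ‖x‖ ^ (-γ - 1))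
    (hχ : IsTest (R + 2 * h) χ) {κ : ℝ → ℝ} (hκm : Measurable κ)
    (hκ : ∀ r, 0 < r → ‖κ r‖ₑ ≤ ENNReal.ofReal 2⁻¹ * ∫⁻ v in Ioc 0 (2 * h), ‖χ (r - σ + v)‖ₑ) :
    ∫⁻ x, ‖(g x : ℂ) * radialKernel κ x‖ₑ
      ≤ ENNReal.ofReal (h * M) * ∫⁻ y, ‖χ y‖ₑ * ENNReal.ofReal ((y - 2 * h + σ) ^ (-γ)) := by
  have hχm := hχ.continuous.measurable
  have hκ0 : ∀ r, 0 < r → r ≤ R → κ r = 0 := fun r hr hrR => by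
    have hz : ∫⁻ v in Ioc 0 (2 * h), ‖χ (r - σ + v)‖ₑ = 0 :=
      (setLIntegral_congr_fun (g := 0) measurableSet_Ioc fun v hv => by
        simp [hχ.eq_zero (r := r - σ + v) (by linarith [hv.2])]).trans (by simp)
    simpa [hz] using hκ r hr
  calc ∫⁻ x, ‖(g x : ℂ) * radialKernel κ x‖ₑ
      ≤ ∫⁻ r in Ioi (0 : ℝ), ENNReal.ofReal (M * r ^ (-γ)) * ‖κ r‖ₑ :=
        lintegral_mul_radialKernel_le hg hκm hκ0
    _ ≤ ∫⁻ r in Ioi (0 : ℝ), ∫⁻ v in Ioc 0 (2 * h),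
          ENNReal.ofReal (M / 2) * (ENNReal.ofReal (r ^ (-γ)) * ‖χ (r + (v - σ))‖ₑ) := by
        refine setLIntegral_mono' measurableSet_Ioi fun r hr => ?_
        refine (mul_le_mul_right (hκ r hr) _).trans_eq ?_
        rw [lintegral_const_mul _ (by fun_prop), lintegral_const_mul _ (by fun_prop), ← mul_assoc,
          ← mul_assoc, ENNReal.ofReal_mul hM, div_eq_mul_inv, ENNReal.ofReal_mul hM]
        simp only [sub_add_eq_add_sub, add_sub_assoc]
        ring
    _ = ∫⁻ v in Ioc 0 (2 * h), ∫⁻ r in Ioi (0 : ℝ),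
          ENNReal.ofReal (M / 2) * (ENNReal.ofReal (r ^ (-γ)) * ‖χ (r + (v - σ))‖ₑ) :=
        lintegral_lintegral_swap (by fun_prop)
    _ ≤ ∫⁻ _v in Ioc 0 (2 * h), ENNReal.ofReal (M / 2) *
          ∫⁻ y, ‖χ y‖ₑ * ENNReal.ofReal ((y - 2 * h + σ) ^ (-γ)) := by
        refine setLIntegral_mono' measurableSet_Ioc fun v hv => ?_
        rw [lintegral_const_mul _ (by fun_prop)]
        simpa only [sub_sub_eq_add_sub, sub_add_eq_add_sub] using mul_le_mul_right
          (lintegral_Ioi_rpow_mul_enorm_comp_add_le (b := 2 * h - σ) (w := v - σ)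
            (fun y hy => hχ.eq_zero (by linarith)) (by linarith [hv.2]) hγ) _
    _ = _ := by
        rw [lintegral_const, Measure.restrict_apply_univ, Real.volume_Ioc, mul_right_comm,
          ← ENNReal.ofReal_mul (by positivity)]
        congr 2
        ring

theorem lintegral_Ioi_add_rpow {a γ : ℝ} (ha : 0 < a) (hγ : 1 < γ) :
    ∫⁻ σ in Ioi (0 : ℝ), ENNReal.ofReal ((a + σ) ^ (-γ))
      = ENNReal.ofReal (a ^ (1 - γ) / (γ - 1)) := by
  have hshift : ∫⁻ σ in Ioi (0 : ℝ), ENNReal.ofReal ((a + σ) ^ (-γ))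
      = ∫⁻ y in Ioi a, ENNReal.ofReal (y ^ (-γ)) := by
    rw [← lintegral_indicator measurableSet_Ioi, ← lintegral_indicator measurableSet_Ioi,
      ← lintegral_add_left_eq_self ((Ioi a).indicator fun y => ENNReal.ofReal (y ^ (-γ))) a]
    refine lintegral_congr fun σ => ?_
    by_cases hσ : 0 < σ <;> simp [indicator, hσ]
  rw [hshift, ← ofReal_integral_eq_lintegral_ofReal
    (integrableOn_Ioi_rpow_of_lt (by linarith) ha), integral_Ioi_rpow_of_lt (by linarith) ha,
    neg_add_eq_sub, ← neg_sub γ 1, neg_div_neg_eq, neg_sub]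
  filter_upwards [ae_restrict_mem measurableSet_Ioi] with y hy
  exact Real.rpow_nonneg (ha.le.trans (le_of_lt hy)) _

theorem lintegral_Ioi_lintegral_enorm_mul_rpow {b γ : ℝ} (hχm : Measurable χ)
    (hχ : ∀ y ≤ b, χ y = 0) (hγ : 1 < γ) :
    ∫⁻ σ in Ioi (0 : ℝ), ∫⁻ y, ‖χ y‖ₑ * ENNReal.ofReal ((y - b + σ) ^ (-γ))
      = ∫⁻ y, ‖χ y‖ₑ * ENNReal.ofReal ((y - b) ^ (1 - γ) / (γ - 1)) := by
  rw [lintegral_lintegral_swap (by fun_prop)]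
  refine lintegral_congr fun y => ?_
  rw [lintegral_const_mul _ (by fun_prop)]
  rcases le_or_gt y b with hy | hy
  · simp [hχ y hy]
  · rw [lintegral_Ioi_add_rpow (sub_pos.2 hy) hγ]

theorem enorm_half_intervalIntegral_le (χ : ℝ → ℝ) (c : ℝ) {b h : ℝ} (hb : 0 ≤ b)
    (hbh : b ≤ 2 * h) :
    ‖2⁻¹ * ∫ y in c..(c + b), χ y‖ₑ
      ≤ ENNReal.ofReal 2⁻¹ * ∫⁻ v in Ioc 0 (2 * h), ‖χ (c + v)‖ₑ := by
  have hshift : ∫ y in c..(c + b), χ y = ∫ v in (0 : ℝ)..b, χ (c + v) := by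
    rw [intervalIntegral.integral_comp_add_left, add_zero]
  rw [hshift, enorm_mul, ← ofReal_norm (2⁻¹ : ℝ), Real.norm_of_nonneg (by norm_num),
    intervalIntegral.integral_of_le hb]
  exact mul_le_mul_right ((enorm_integral_le_lintegral_enorm _).trans
    (lintegral_mono_set (Ioc_subset_Ioc_right hbh))) _

theorem enorm_dAlembert_le {h σ r : ℝ} (hχ : ∀ y ≤ 2 * h, χ y = 0) (hσ : 0 ≤ σ)
    (hσh : σ ≤ h) (hr : 0 ≤ r) :
    ‖dAlembert χ σ r‖ₑ ≤ ENNReal.ofReal 2⁻¹ * ∫⁻ v in Ioc 0 (2 * h), ‖χ (r - σ + v)‖ₑ := by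
  have heq : dAlembert χ σ r = 2⁻¹ * ∫ y in (r - σ)..(r - σ + 2 * σ), χ y := by
    rw [dAlembert, show r - σ + 2 * σ = r + σ by ring]
    congr 1
    refine intervalIntegral.integral_congr fun y hy => ?_
    rw [uIcc_of_le (by linarith)] at hy
    rw [hχ (-y) (by linarith [hy.1]), sub_zero]
  rw [heq]
  exact enorm_half_intervalIntegral_le χ _ (by linarith) (by linarith)

theorem dAlembert_sub_dAlembert_comp_add (hχc : Continuous χ) {h σ r : ℝ}
    (hχ : ∀ y ≤ 2 * h, χ y = 0) (hh : 0 ≤ h) (hσh : h ≤ σ) (hr : 0 ≤ r) :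
    dAlembert χ σ r - dAlembert (fun y => χ (y + h)) (σ - h) r
      = 2⁻¹ * ∫ y in (r - σ)..(r - σ + 2 * h), χ y := by
  have hint : ∀ a b, IntervalIntegrable χ volume a b := fun a b => hχc.intervalIntegrable a b
  have hzero : ∫ y in (-r - σ)..(-r - σ + 2 * h), χ y = 0 := by
    rw [intervalIntegral.integral_congr (g := fun _ => (0 : ℝ)), intervalIntegral.integral_zero]
    intro y hy
    rw [uIcc_of_le (by linarith)] at hy
    exact hχ y (by linarith [hy.2])
  rw [dAlembert_eq_integral_sub_neg hχc, dAlembert_eq_integral_sub_neg (by fun_prop),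
    intervalIntegral.integral_comp_add_right, intervalIntegral.integral_comp_add_right,
    show r - (σ - h) + h = r - σ + 2 * h by ring, show r + (σ - h) + h = r + σ by ring,
    show -r - (σ - h) + h = -r - σ + 2 * h by ring, show -r + (σ - h) + h = -r + σ by ring]
  linarith [intervalIntegral.integral_add_adjacent_intervals (hint (r - σ) (r - σ + 2 * h))
    (hint _ (r + σ)), intervalIntegral.integral_add_adjacent_intervals
    (hint (-r - σ) (-r - σ + 2 * h)) (hint _ (-r + σ))]

theorem radialKernel_sub (κ κ' : ℝ → ℝ) (x : E3) :
    radialKernel (fun r => κ r - κ' r) x = radialKernel κ x - radialKernel κ' x := by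
  simp only [radialKernel, ← Complex.ofReal_sub]
  rw [sub_div]

end nullSegment

section duhamelIntegrand

variable {χ : ℝ → ℝ}

theorem integrable_indicator_rpow_norm {β : ℝ} (hβ : β < 1) (C Λ : ℝ) :
    Integrable fun x : E3 => (Iic Λ).indicator (fun r : ℝ => C * r ^ (-2 - β)) ‖x‖ := by
  refine integrable_norm_E3.2 ?_
  have hrpow : IntegrableOn (fun r : ℝ => r ^ (-β)) (Ioc 0 Λ) :=
    (intervalIntegral.intervalIntegrable_rpow' (by linarith)).1
  have hind : IntegrableOn ((Iic Λ).indicator fun r : ℝ => C * r ^ (-β)) (Ioi 0) := by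
    rw [IntegrableOn, integrable_indicator_iff measurableSet_Iic, IntegrableOn,
      Measure.restrict_restrict measurableSet_Iic, inter_comm, Ioi_inter_Iic]
    exact hrpow.const_mul _
  refine hind.congr_fun (fun r hr => ?_) measurableSet_Ioi
  have hr0 : (0 : ℝ) < r := hr
  by_cases hrΛ : r ∈ Iic Λ
  · simp only [hrΛ, indicator_of_mem, smul_eq_mul]
    rw [show -2 - β = -β - 2 by ring, Real.rpow_sub hr0, Real.rpow_two]
    field_simp
  · simp [hrΛ]

theorem norm_radialKernel_dAlembert_le (hχ : Continuous χ) {B : ℝ} (hB : ∀ y, |χ y| ≤ B) (σ : ℝ)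
    (x : E3) : ‖radialKernel (dAlembert χ σ) x‖ ≤ B / (2 * π) := by
  have hB0 : 0 ≤ B := (abs_nonneg _).trans (hB 0)
  rcases eq_or_ne x 0 with rfl | hx
  · simpa [radialKernel] using div_nonneg hB0 Real.two_pi_pos.le
  · have hpos := norm_pos_iff.2 hx
    rw [radialKernel, Complex.norm_real, norm_div,
      Real.norm_of_nonneg (by positivity : 0 ≤ 4 * π * ‖x‖), Real.norm_eq_abs,
      div_le_div_iff₀ (by positivity) (by positivity)]
    nlinarith [mul_le_mul_of_nonneg_right (abs_dAlembert_le hχ hB σ hpos.le) Real.two_pi_pos.le]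

theorem radialKernel_dAlembert_eq_zero {L : ℝ} (hL : ∀ y, L < |y| → χ y = 0) {σ : ℝ} {x : E3}
    (hx : L + |σ| < ‖x‖) : radialKernel (dAlembert χ σ) x = 0 := by
  rw [radialKernel, dAlembert_eq_zero hL (by rwa [abs_norm]), zero_div, Complex.ofReal_zero]

theorem aestronglyMeasurable_duhamel_integrand {G : ℝ → E3 → ℝ}
    (hG : AEStronglyMeasurable (fun z : ℝ × E3 => G z.1 z.2)) (hχ : Continuous χ) (t N c : ℝ) :
    AEStronglyMeasurable (fun z : ℝ × E3 => (G (t + z.1) z.2 : ℂ) *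
      radialKernel (dAlembert χ (z.1 - c)) z.2) ((volume.restrict (Ioc 0 N)).prod volume) := by
  have hshift : MeasurePreserving (fun z : ℝ × E3 => (t + z.1, z.2))
      (volume.prod volume) (volume.prod volume) :=
    (measurePreserving_add_left volume t).prod (MeasurePreserving.id volume)
  have hGt : AEStronglyMeasurable (fun z : ℝ × E3 => G (t + z.1) z.2)
      ((volume.restrict (Ioc 0 N)).prod volume) :=
    (hG.comp_measurePreserving hshift).mono_ac
      (Measure.absolutelyContinuous_restrict.prod Measure.AbsolutelyContinuous.rfl)
  have hdA : Continuous fun z : ℝ × E3 => dAlembert χ (z.1 - c) ‖z.2‖ :=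
    (continuous_dAlembert hχ).comp ((continuous_fst.sub continuous_const).prodMk (by fun_prop))
  exact (Complex.continuous_ofReal.comp_aestronglyMeasurable hGt).mul
    (Complex.measurable_ofReal.comp (hdA.measurable.div (by fun_prop))).aestronglyMeasurable

theorem integrable_duhamel_integrand {G : ℝ → E3 → ℝ}
    (hG : AEStronglyMeasurable (fun z : ℝ × E3 => G z.1 z.2)) {C β : ℝ} (hβ : β < 1)
    (hb : ∀ τ, ∀ᵐ x : E3, |G τ x| ≤ C * ‖x‖ ^ (-2 - β)) (hχ : Continuous χ)
    (hχc : HasCompactSupport χ) (t N c : ℝ) :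
    Integrable (fun z : ℝ × E3 => (G (t + z.1) z.2 : ℂ) *
      radialKernel (dAlembert χ (z.1 - c)) z.2) ((volume.restrict (Ioc 0 N)).prod volume) := by
  obtain ⟨L, hL⟩ := exists_forall_lt_norm_eq_zero hχc
  obtain ⟨B, hB⟩ := hχ.bounded_above_of_compact_support hχc
  set Λ : ℝ := L + (|N| + |c|)
  set q : ℝ → ℝ := (Iic Λ).indicator fun r => C * (B / (2 * π)) * r ^ (-2 - β)
  have hq : Integrable fun x : E3 => q ‖x‖ := integrable_indicator_rpow_norm hβ _ Λ
  have hmeas := aestronglyMeasurable_duhamel_integrand hG hχ t N c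
  have hle : ∀ σ ∈ Ioc 0 N, ∀ᵐ x : E3,
      ‖(G (t + σ) x : ℂ) * radialKernel (dAlembert χ (σ - c)) x‖ ≤ q ‖x‖ := fun σ hσ => by
    filter_upwards [hb (t + σ)] with x hx
    by_cases hxΛ : ‖x‖ ∈ Iic Λ
    · simp only [q, hxΛ, indicator_of_mem]
      rw [norm_mul, Complex.norm_real, Real.norm_eq_abs, mul_right_comm]
      exact mul_le_mul hx (norm_radialKernel_dAlembert_le hχ hB _ x) (norm_nonneg _)
        ((abs_nonneg _).trans hx)
    · have hσc : |σ - c| ≤ |N| + |c| :=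
        (abs_sub σ c).trans (add_le_add_left (abs_le_abs_of_nonneg hσ.1.le hσ.2) _)
      have hxL : L + |σ - c| < ‖x‖ := (add_le_add_right hσc L).trans_lt (not_le.1 hxΛ)
      simp [q, hxΛ, radialKernel_dAlembert_eq_zero hL hxL]
  refine (integrable_prod_iff hmeas).2 ⟨?_, ?_⟩
  · filter_upwards [hmeas.prodMk_left, ae_restrict_mem measurableSet_Ioc] with σ hσm hσ
    exact hq.mono' hσm (hle σ hσ)
  · refine Integrable.of_bound hmeas.norm.integral_prod_right' (∫ x : E3, q ‖x‖) ?_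
    filter_upwards [ae_restrict_mem measurableSet_Ioc] with σ hσ
    refine norm_integral_le_of_norm_le hq ?_
    filter_upwards [hle σ hσ] with x hx
    rwa [norm_norm]

end duhamelIntegrand

/-- The forward-in-time Duhamel formula for the profile of a radial wave `U` with velocity `V` and
forcing term `G`, tested against functions of the radius. -/
structure RadialFlow (s : ℝ) (U : ℝ → Hdot s) (V : ℝ → Hdot (s - 1)) (G : ℝ → E3 → ℝ) : Prop where
  aestronglyMeasurable : AEStronglyMeasurable (fun z : ℝ × E3 => G z.1 z.2)
  exists_bound : ∃ C β : ℝ, β < 1 ∧ ∀ τ, ∀ᵐ x : E3, |G τ x| ≤ C * ‖x‖ ^ (-2 - β)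
  duhamel : ∀ (t N : ℝ) (χ : ℝ → ℝ), 0 ≤ N → IsTest 0 χ →
    ∫ ρ, (χ ρ : ℂ) * (U t).profile ρ
      = (∫ ρ, (χ ρ : ℂ) * freeField (-N) (U (t + N)) (V (t + N)) ρ)
        + ∫ σ in (0 : ℝ)..N, ∫ x, (G (t + σ) x : ℂ) * radialKernel (dAlembert χ σ) x

theorem enorm_setIntegral_sub_intervalIntegral_le {X E : Type*} [MeasurableSpace X]
    {μ : Measure X} [SFinite μ] [NormedAddCommGroup E] [NormedSpace ℝ E] {f f' : ℝ → X → E}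
    {h N : ℝ} (hh : 0 ≤ h) (hN : h ≤ N)
    (hf : Integrable (fun z : ℝ × X => f z.1 z.2) ((volume.restrict (Ioc 0 N)).prod μ))
    (hf' : Integrable (fun z : ℝ × X => f' z.1 z.2) ((volume.restrict (Ioc 0 N)).prod μ))
    {b : ℝ → ℝ≥0∞} (hb : ∀ σ ∈ Ioc 0 h, ‖∫ x, f σ x ∂μ‖ₑ ≤ b σ)
    (hb' : ∀ σ ∈ Ioc h N, ‖∫ x, (f' σ x - f σ x) ∂μ‖ₑ ≤ b σ) :
    ‖(∫ σ in h..N, ∫ x, f' σ x ∂μ) - ∫ σ in (0 : ℝ)..N, ∫ x, f σ x ∂μ‖ₑ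
      ≤ ∫⁻ σ in Ioi (0 : ℝ), b σ := by
  have hsub₁ : Ioc 0 h ⊆ Ioc 0 N := Ioc_subset_Ioc_right hN
  have hsub₂ : Ioc h N ⊆ Ioc 0 N := Ioc_subset_Ioc_left hh
  have hint : IntegrableOn (fun σ => ∫ x, f σ x ∂μ) (Ioc 0 N) := hf.integral_prod_left
  have hint' : IntegrableOn (fun σ => ∫ x, f' σ x ∂μ) (Ioc 0 N) := hf'.integral_prod_left
  have hdisj : Disjoint (Ioc 0 h) (Ioc h N) := Ioc_disjoint_Ioc_of_le le_rfl
  have hsplit : ∫ σ in (0 : ℝ)..N, ∫ x, f σ x ∂μ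
      = (∫ σ in Ioc 0 h, ∫ x, f σ x ∂μ) + ∫ σ in Ioc h N, ∫ x, f σ x ∂μ := by
    rw [intervalIntegral.integral_of_le (hh.trans hN), ← Ioc_union_Ioc_eq_Ioc hh hN,
      setIntegral_union hdisj measurableSet_Ioc (hint.mono_set hsub₁) (hint.mono_set hsub₂)]
  have hdiff : (∫ σ in Ioc h N, ∫ x, f' σ x ∂μ) - ∫ σ in Ioc h N, ∫ x, f σ x ∂μ
      = ∫ σ in Ioc h N, ∫ x, (f' σ x - f σ x) ∂μ := by
    rw [← integral_sub (hint'.mono_set hsub₂) (hint.mono_set hsub₂)]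
    refine integral_congr_ae ?_
    filter_upwards [ae_restrict_of_ae_restrict_of_subset hsub₂ hf.prod_right_ae,
      ae_restrict_of_ae_restrict_of_subset hsub₂ hf'.prod_right_ae] with σ hσ hσ'
    exact (integral_sub hσ' hσ).symm
  rw [intervalIntegral.integral_of_le hN, hsplit, sub_add_eq_sub_sub_swap, hdiff]
  calc _ ≤ (∫⁻ σ in Ioc h N, b σ) + ∫⁻ σ in Ioc 0 h, b σ :=
        enorm_sub_le.trans (add_le_add
          ((enorm_integral_le_lintegral_enorm _).trans (setLIntegral_mono' measurableSet_Ioc hb'))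
          ((enorm_integral_le_lintegral_enorm _).trans (setLIntegral_mono' measurableSet_Ioc hb)))
    _ = ∫⁻ σ in Ioc 0 N, b σ := by
        rw [add_comm, ← lintegral_union measurableSet_Ioc hdisj, Ioc_union_Ioc_eq_Ioc hh hN]
    _ ≤ ∫⁻ σ in Ioi (0 : ℝ), b σ := lintegral_mono_set Ioc_subset_Ioi_self

section flow

variable {s : ℝ} {U : ℝ → Hdot s} {V : ℝ → Hdot (s - 1)} {G : ℝ → E3 → ℝ}

theorem intervalIntegral_add_eq_sub (g : ℝ → ℝ → ℂ) (t h N : ℝ) :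
    ∫ σ in (0 : ℝ)..(N - h), g (t + h + σ) σ = ∫ σ in h..N, g (t + σ) (σ - h) := by
  rw [← sub_self h, ← intervalIntegral.integral_comp_sub_right]
  simp only [add_assoc, add_sub_cancel]

theorem RadialFlow.enorm_duhamel_sub_le (hf : RadialFlow s U V G) {R M γ h N : ℝ} (hR : 0 ≤ R)
    (hM : 0 ≤ M) (hγ : 1 < γ) (hh : 0 ≤ h) (hN : h ≤ N)
    (hG : ∀ τ, ∀ᵐ x, R < ‖x‖ → |G τ x| ≤ M * ‖x‖ ^ (-γ - 1)) (t : ℝ)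
    {χ : ℝ → ℝ} (hχ : IsTest (R + 2 * h) χ) :
    ‖(∫ σ in (0 : ℝ)..(N - h), ∫ x, (G (t + h + σ) x : ℂ) *
        radialKernel (dAlembert (fun y => χ (y + h)) σ) x)
      - ∫ σ in (0 : ℝ)..N, ∫ x, (G (t + σ) x : ℂ) * radialKernel (dAlembert χ σ) x‖ₑ
      ≤ ∫⁻ y, ‖χ y‖ₑ * ENNReal.ofReal (h * (M / (γ - 1) * (y - 2 * h) ^ (1 - γ))) := by
  have hχc := hχ.continuous
  have hχh : IsTest (R + 2 * h - h) fun y => χ (y + h) := hχ.comp_add_right h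
  have hχ0 : ∀ y ≤ 2 * h, χ y = 0 := fun y hy => hχ.eq_zero (by linarith)
  obtain ⟨C, β, hβ, hb⟩ := hf.exists_bound
  have hint := integrable_duhamel_integrand hf.aestronglyMeasurable hβ hb hχc
    hχ.hasCompactSupport t N 0
  simp only [sub_zero] at hint
  have hint' := integrable_duhamel_integrand hf.aestronglyMeasurable hβ hb hχh.continuous
    hχh.hasCompactSupport t N h
  have hdA (χ : ℝ → ℝ) (hχ : Continuous χ) (σ : ℝ) : Continuous (dAlembert χ σ) :=
    (continuous_dAlembert hχ).comp (by fun_prop : Continuous fun r : ℝ => (σ, r))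
  rw [intervalIntegral_add_eq_sub (fun τ σ => ∫ x, (G τ x : ℂ) *
    radialKernel (dAlembert (fun y => χ (y + h)) σ) x)]
  refine (enorm_setIntegral_sub_intervalIntegral_le hh hN hint hint' (b := fun σ =>
    ENNReal.ofReal (h * M) * ∫⁻ y, ‖χ y‖ₑ * ENNReal.ofReal ((y - 2 * h + σ) ^ (-γ)))
    (fun σ hσ => ?_) fun σ hσ => ?_).trans_eq ?_
  · exact (enorm_integral_le_lintegral_enorm _).trans
      (lintegral_mul_radialKernel_le_of_enorm_le hR hM (by linarith) hσ.1.le (hG _) hχ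
        (hdA _ hχc σ).measurable fun r hr => enorm_dAlembert_le hχ0 hσ.1.le hσ.2 hr.le)
  · simp only [← mul_sub, ← radialKernel_sub]
    refine (enorm_integral_le_lintegral_enorm _).trans
      (lintegral_mul_radialKernel_le_of_enorm_le hR hM (by linarith) (hh.trans hσ.1.le) (hG _) hχ
        ((hdA _ hχh.continuous _).sub (hdA _ hχc σ)).measurable fun r hr => ?_)
    rw [← enorm_neg, neg_sub, dAlembert_sub_dAlembert_comp_add hχc hχ0 hh hσ.1.le hr.le]
    exact enorm_half_intervalIntegral_le χ _ (by linarith) le_rfl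
  · have hχm := hχc.measurable
    rw [lintegral_const_mul' _ _ ENNReal.ofReal_ne_top,
      lintegral_Ioi_lintegral_enorm_mul_rpow hχm hχ0 hγ,
      ← lintegral_const_mul' _ _ ENNReal.ofReal_ne_top]
    refine lintegral_congr fun y => ?_
    rw [mul_left_comm, ← ENNReal.ofReal_mul (by positivity)]
    congr 2
    ring

theorem integral_test_comp_add_mul (χ : ℝ → ℝ) (f : ℝ → ℂ) (h : ℝ) :
    ∫ y, (χ (y + h) : ℂ) * f y = ∫ y, (χ y : ℂ) * f (y - h) := by
  rw [← integral_add_right_eq_self (fun y => (χ y : ℂ) * f (y - h)) h]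
  simp only [add_sub_cancel_right]

theorem IsTest.integral_mul_sub {a : ℝ} {χ : ℝ → ℝ} (hχ : IsTest a χ) {f g : ℝ → ℂ}
    (hf : Continuous f) (hg : Continuous g) :
    ∫ y, (χ y : ℂ) * (f y - g y) = (∫ y, (χ y : ℂ) * f y) - ∫ y, (χ y : ℂ) * g y := by
  simp only [mul_sub]
  exact integral_sub (hχ.integrable_mul hf) (hχ.integrable_mul hg)

theorem RadialFlow.integral_test_mul_profile_sub (hs : 1 / 2 < s) (hs' : s < 3 / 2)
    (hf : RadialFlow s U V G) {h N : ℝ} (hh : 0 ≤ h) (hN : h ≤ N) (t : ℝ) {χ : ℝ → ℝ}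
    (hχ : IsTest h χ) :
    ∫ y, (χ y : ℂ) * (((U (t + h)).profile (y - h) - (U t).profile y)
        - nullDiff h (y + N - h) (U (t + N), V (t + N)))
      = (∫ σ in (0 : ℝ)..(N - h), ∫ x, (G (t + h + σ) x : ℂ) *
          radialKernel (dAlembert (fun y => χ (y + h)) σ) x)
        - ∫ σ in (0 : ℝ)..N, ∫ x, (G (t + σ) x : ℂ) * radialKernel (dAlembert χ σ) x := by
  have hduh := hf.duhamel t N χ (hh.trans hN) (hχ.mono hh)
  have hduh' := hf.duhamel (t + h) (N - h) (fun y => χ (y + h)) (by linarith)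
    (by simpa only [sub_self] using hχ.comp_add_right h)
  rw [integral_test_comp_add_mul, integral_test_comp_add_mul,
    show t + h + (N - h) = t + N by ring, neg_sub] at hduh'
  have hprof := (U t).continuous_profile hs hs'
  have hprof' := (U (t + h)).continuous_profile hs hs'
  have hfree := continuous_freeField hs hs' (-N) (U (t + N)) (V (t + N))
  have hfree' := continuous_freeField hs hs' (h - N) (U (t + N)) (V (t + N))
  simp only [← freeField_sub_freeField hs hs']
  rw [hχ.integral_mul_sub (by fun_prop) (by fun_prop), hχ.integral_mul_sub (by fun_prop) hprof,
    hχ.integral_mul_sub (by fun_prop) hfree, hduh, hduh']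
  ring

theorem RadialFlow.norm_profile_sub_sub_nullDiff_le (hs : 1 / 2 < s) (hs' : s < 3 / 2)
    (hf : RadialFlow s U V G) {R M γ h N : ℝ} (hR : 0 ≤ R) (hM : 0 ≤ M) (hγ : 1 < γ) (hh : 0 ≤ h)
    (hN : h ≤ N) (hG : ∀ τ, ∀ᵐ x, R < ‖x‖ → |G τ x| ≤ M * ‖x‖ ^ (-γ - 1)) (t : ℝ) {ρ : ℝ}
    (hρ : R + 2 * h < ρ) :
    ‖((U (t + h)).profile (ρ - h) - (U t).profile ρ)
        - nullDiff h (ρ + N - h) (U (t + N), V (t + N))‖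
      ≤ h * (M / (γ - 1) * (ρ - 2 * h) ^ (1 - γ)) := by
  have hρh : 0 < ρ - 2 * h := by linarith
  have : 0 < γ - 1 := by linarith
  have hprof := (U t).continuous_profile hs hs'
  have hprof' := (U (t + h)).continuous_profile hs hs'
  have hfree := continuous_freeField hs hs' (-N) (U (t + N)) (V (t + N))
  have hfree' := continuous_freeField hs hs' (h - N) (U (t + N)) (V (t + N))
  refine norm_le_of_forall_test (a := R + 2 * h)
    (f := fun ρ => ((U (t + h)).profile (ρ - h) - (U t).profile ρ)
      - nullDiff h (ρ + N - h) (U (t + N), V (t + N)))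
    (B := fun ρ => h * (M / (γ - 1) * (ρ - 2 * h) ^ (1 - γ))) ?_ ?_ (by positivity)
    (fun χ hχ => ?_) hρ
  · simp only [← freeField_sub_freeField hs hs']
    fun_prop
  · exact continuousAt_const.mul (continuousAt_const.mul
      (ContinuousAt.rpow_const (by fun_prop) (Or.inl hρh.ne')))
  · rw [hf.integral_test_mul_profile_sub hs hs' hh hN t (hχ.mono (by linarith))]
    exact hf.enorm_duhamel_sub_le hR hM hγ hh hN hG t hχ

-- Precompactness makes the free part of the increment disappear as the final time tends to `∞`.
theorem RadialFlow.norm_profile_sub_le (hs : 1 / 2 < s) (hs' : s < 3 / 2) (hf : RadialFlow s U V G)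
    (hcpt : IsCompact (closure (range fun t => (U t, V t)))) {R M γ h : ℝ} (hR : 0 ≤ R)
    (hM : 0 ≤ M) (hγ : 1 < γ) (hh : 0 ≤ h)
    (hG : ∀ τ, ∀ᵐ x, R < ‖x‖ → |G τ x| ≤ M * ‖x‖ ^ (-γ - 1)) (t : ℝ) {ρ : ℝ}
    (hρ : R + 2 * h < ρ) :
    ‖(U (t + h)).profile (ρ - h) - (U t).profile ρ‖
      ≤ h * (M / (γ - 1) * (ρ - 2 * h) ^ (1 - γ)) := by
  refine le_of_forall_pos_le_add fun ε hε => ?_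
  obtain ⟨Y, hY0, hY⟩ := exists_forall_norm_nullDiff_le hs hs' hcpt h hε
  have hsub := hf.norm_profile_sub_sub_nullDiff_le hs hs' hR hM hγ hh
    (le_add_of_nonneg_right hY0.le : h ≤ h + Y) hG t hρ
  have hfree := hY (ρ + (h + Y) - h) (by linarith) _ (mem_range_self (t + (h + Y)))
  have htri := norm_le_norm_sub_add ((U (t + h)).profile (ρ - h) - (U t).profile ρ)
    (nullDiff h (ρ + (h + Y) - h) (U (t + (h + Y)), V (t + (h + Y))))
  linarith

end flow

/-! ### From null segments to space and time increments -/

/-- The increments of `w` along incoming null segments of length `h`, forward and backward in time,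
are at most `h D` in the region of radii greater than `R`. -/
def NullLip (w : ℝ → ℝ → ℂ) (R : ℝ) (D : ℝ → ℝ) : Prop :=
  ∀ t h ρ, 0 < h → R + 2 * h < ρ →
    ‖w (t + h) (ρ - h) - w t ρ‖ ≤ h * D (ρ - 2 * h) ∧
    ‖w (t - h) (ρ - h) - w t ρ‖ ≤ h * D (ρ - 2 * h)

theorem norm_sub_le_of_forall_eventually {E : Type*} [NormedAddCommGroup E] {f : ℝ → E}
    {D Φ : ℝ → ℝ} {a b : ℝ} (hab : a ≤ b) (hf : ContinuousOn f (Icc a b))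
    (hΦ : ∀ x ∈ Icc a b, HasDerivAt Φ (D x) x)
    (h : ∀ x ∈ Ico a b, ∀ r, D x < r → ∀ᶠ z in 𝓝[>] x, ‖f z - f x‖ ≤ r * (z - x)) :
    ‖f b - f a‖ ≤ Φ b - Φ a := by
  refine le_of_forall_pos_le_add fun ε hε => ?_
  have hba : 0 < b - a + 1 := by linarith
  have hslope : 0 < ε / (b - a + 1) := by positivity
  have hΦc : ContinuousOn Φ (Icc a b) := fun x hx => (hΦ x hx).continuousAt.continuousWithinAt
  have hbound := image_norm_le_of_liminf_right_slope_norm_lt_deriv_boundary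
    (f := fun x => f x - f a) (f' := D) (a := a) (b := b) (hf.sub continuousOn_const)
    (B := fun x => Φ x - Φ a + ε / (b - a + 1) * (x - a)) (B' := fun x => D x + ε / (b - a + 1))
    (fun x hx r hr => ?_) (by simp) ((hΦc.sub continuousOn_const).add (by fun_prop))
    (fun x hx => ?_) (fun x _ _ => by linarith) (right_mem_Icc.2 hab)
  · refine hbound.trans (add_le_add_right ?_ _)
    rw [div_mul_eq_mul_div, div_le_iff₀ hba]
    nlinarith
  · obtain ⟨r', hDr', hr'r⟩ := exists_between hr
    refine Eventually.frequently ?_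
    filter_upwards [h x hx r' hDr', self_mem_nhdsWithin] with z hz hzx
    have hzx' : 0 < z - x := sub_pos.2 hzx
    rw [slope_def_field, div_lt_iff₀ hzx']
    have hnorm := norm_sub_norm_le (f z - f a) (f x - f a)
    rw [sub_sub_sub_cancel_right] at hnorm
    simp only [Function.comp_apply]
    linarith [mul_lt_mul_of_pos_right hr'r hzx']
  · have hderiv := ((hΦ x (Ico_subset_Icc_self hx)).sub_const (Φ a)).fun_add
      (((hasDerivAt_id x).sub_const a).const_mul (ε / (b - a + 1)))
    rw [mul_one] at hderiv
    exact hderiv.hasDerivWithinAt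

section nullLip

variable {w : ℝ → ℝ → ℂ} {R : ℝ} {D : ℝ → ℝ}

-- A space increment of length `2h` is an incoming null segment forward in time, followed by one
-- backward in time; a time increment is an incoming and an outgoing segment.
theorem NullLip.norm_space_increment_le (hw : NullLip w R D) (t : ℝ) {ρ h : ℝ} (hh : 0 < h)
    (hρ : R + h < ρ) : ‖w t (ρ + 2 * h) - w t ρ‖ ≤ h * D ρ + h * D (ρ - h) := by
  have hforward := (hw t h (ρ + 2 * h) hh (by linarith)).1
  have hbackward := (hw (t + h) h (ρ + h) hh (by linarith)).2
  rw [show ρ + 2 * h - h = ρ + h by ring, add_sub_cancel_right] at hforward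
  rw [add_sub_cancel_right, add_sub_cancel_right, show ρ + h - 2 * h = ρ - h by ring] at hbackward
  rw [norm_sub_rev] at hforward hbackward
  exact (norm_sub_le_norm_sub_add_norm_sub _ _ _).trans (add_le_add hforward hbackward)

theorem NullLip.norm_time_increment_le (hw : NullLip w R D) (t : ℝ) {ρ h : ℝ} (hh : 0 < h)
    (hρ : R + 2 * h < ρ) : ‖w (t + 2 * h) ρ - w t ρ‖ ≤ 2 * h * D (ρ - 2 * h) := by
  have hforward := (hw t h ρ hh hρ).1
  have hbackward := (hw (t + 2 * h) h ρ hh hρ).2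
  rw [show t + 2 * h - h = t + h by ring, norm_sub_rev] at hbackward
  have htri := norm_sub_le_norm_sub_add_norm_sub (w (t + 2 * h) ρ) (w (t + h) (ρ - h)) (w t ρ)
  linarith

theorem NullLip.norm_space_sub_le (hw : NullLip w R D) (hD : ContinuousOn D (Ioi R)) {Φ : ℝ → ℝ}
    (hΦ : ∀ x ∈ Ioi R, HasDerivAt Φ (D x) x) {t : ℝ} (hc : Continuous (w t)) {ρ r : ℝ}
    (hρ : R < ρ) (hr : ρ ≤ r) : ‖w t r - w t ρ‖ ≤ Φ r - Φ ρ := by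
  refine norm_sub_le_of_forall_eventually hr hc.continuousOn
    (fun x hx => hΦ x (hρ.trans_le hx.1)) fun x hx q hq => ?_
  have hxR : R < x := hρ.trans_le hx.1
  have hlim : Tendsto (fun z : ℝ => x - (z - x) / 2) (𝓝[>] x) (𝓝 x) :=
    ((by fun_prop : Continuous fun z : ℝ => x - (z - x) / 2).tendsto' x x (by simp)).mono_left
      nhdsWithin_le_nhds
  have hDlim := (hD.continuousAt (Ioi_mem_nhds hxR)).tendsto.comp hlim
  filter_upwards [hDlim.eventually_lt_const hq, hlim.eventually_const_lt hxR, self_mem_nhdsWithin]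
    with z hDz hRz hxz
  have hh : 0 < (z - x) / 2 := half_pos (sub_pos.2 hxz)
  have hstep := hw.norm_space_increment_le t hh (by linarith : R + (z - x) / 2 < x)
  rw [show x + 2 * ((z - x) / 2) = z by ring] at hstep
  calc ‖w t z - w t x‖
      ≤ (z - x) / 2 * D x + (z - x) / 2 * D (x - (z - x) / 2) := hstep
    _ ≤ (z - x) / 2 * q + (z - x) / 2 * q := by gcongr; exact hDz.le
    _ = q * (z - x) := by ring

theorem NullLip.norm_time_sub_le (hw : NullLip w R D) (hD : ContinuousOn D (Ioi R)) {ρ : ℝ}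
    (hc : Continuous fun t => w t ρ) (hρ : R < ρ) {t t' : ℝ} (ht : t ≤ t') :
    ‖w t' ρ - w t ρ‖ ≤ (t' - t) * D ρ := by
  have hbound := norm_sub_le_of_forall_eventually (f := fun t => w t ρ) (D := fun _ => D ρ)
    (Φ := fun τ => τ * D ρ) ht hc.continuousOn
    (fun x _ => by simpa using (hasDerivAt_id x).mul_const (D ρ)) fun x _ q hq => ?_
  · simpa only [← sub_mul] using hbound
  have hlim : Tendsto (fun z : ℝ => ρ - (z - x)) (𝓝[>] x) (𝓝 ρ) :=
    ((by fun_prop : Continuous fun z : ℝ => ρ - (z - x)).tendsto' x ρ (by simp)).mono_left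
      nhdsWithin_le_nhds
  have hDlim := (hD.continuousAt (Ioi_mem_nhds hρ)).tendsto.comp hlim
  filter_upwards [hDlim.eventually_lt_const hq, hlim.eventually_const_lt hρ, self_mem_nhdsWithin]
    with z hDz hRz hxz
  have hzx : 0 < z - x := sub_pos.2 hxz
  have hstep := hw.norm_time_increment_le x (half_pos hzx)
    (by linarith : R + 2 * ((z - x) / 2) < ρ)
  rw [show 2 * ((z - x) / 2) = z - x by ring, show x + (z - x) = z by ring] at hstep
  calc ‖w z ρ - w x ρ‖ ≤ (z - x) * D (ρ - (z - x)) := hstep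
    _ ≤ (z - x) * q := by gcongr; exact hDz.le
    _ = q * (z - x) := mul_comm _ _

theorem continuousOn_const_mul_rpow (K a : ℝ) :
    ContinuousOn (fun y : ℝ => K * y ^ a) (Ioi 0) :=
  continuousOn_const.mul (continuousOn_id.rpow_const fun _ hy => Or.inl (ne_of_gt hy))

theorem hasDerivAt_const_mul_rpow (K : ℝ) {a x : ℝ} (ha : a + 1 ≠ 0) (hx : 0 < x) :
    HasDerivAt (fun y : ℝ => K / (a + 1) * y ^ (a + 1)) (K * x ^ a) x := by
  refine ((Real.hasDerivAt_rpow_const (p := a + 1) (Or.inl hx.ne')).const_mul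
    (K / (a + 1))).congr_deriv ?_
  rw [add_sub_cancel_right]
  field_simp

theorem NullLip.norm_space_sub_le_rpow {K a : ℝ} (hw : NullLip w R fun y => K * y ^ a)
    (hR : 0 ≤ R) (ha : a + 1 ≠ 0) {t : ℝ} (hc : Continuous (w t)) {ρ r : ℝ}
    (hρ : R < ρ) (hr : ρ ≤ r) :
    ‖w t r - w t ρ‖ ≤ K / (a + 1) * r ^ (a + 1) - K / (a + 1) * ρ ^ (a + 1) :=
  hw.norm_space_sub_le
    ((continuousOn_const_mul_rpow K a).mono (Ioi_subset_Ioi hR))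
    (fun _ hx => hasDerivAt_const_mul_rpow K ha (hR.trans_lt hx)) hc hρ hr

end nullLip

/-! ### Improved decay -/

section decay

variable {w : ℝ → ℝ → ℂ} {p : ℝ}

/-- A bound of power type on `w` implies a bound on its increments along null segments. It is the
consequence of the wave equation with a nonlinearity of degree `p` that the decay estimates use. -/
def SelfImproving (p : ℝ) (w : ℝ → ℝ → ℂ) : Prop :=
  ∀ R K b : ℝ, 0 ≤ R → 0 ≤ K → 2 < p * b → (∀ t, ∀ r > R, ‖w t r‖ ≤ K * r ^ (1 - b)) →
    NullLip w R fun y => K ^ p / (p * b - 2) * y ^ (2 - p * b)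

theorem two_mul_rpow_le {L R r θ : ℝ} (hL : 0 < L) (hR : 0 ≤ R) (hr : L * R ≤ r) (hθ : 0 ≤ θ)
    (hθ1 : θ ≤ 1) : (2 * R) ^ θ ≤ 2 * (L ^ (-θ) * r ^ θ) := by
  have hr0 : 0 ≤ r := (by positivity : 0 ≤ L * R).trans hr
  have htwo : (2 : ℝ) ^ θ ≤ 2 := Real.rpow_le_self_of_one_le one_le_two hθ1
  have hscale : R ^ θ ≤ L ^ (-θ) * r ^ θ := by
    rw [Real.rpow_neg hL.le, ← Real.inv_rpow hL.le, ← Real.mul_rpow (by positivity) hr0]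
    exact Real.rpow_le_rpow hR (by rwa [inv_mul_eq_div, le_div_iff₀' hL]) hθ
  rw [Real.mul_rpow zero_le_two hR]
  exact mul_le_mul htwo hscale (by positivity) zero_le_two

theorem rpow_div_div_eq_mul {p K β θ : ℝ} (hp : p ≠ 0) (hK : 0 ≤ K) :
    K ^ p / β / θ = K * (K ^ (p - 1) / (β * θ)) := by
  rw [div_div, ← mul_div_assoc, ← Real.rpow_one_add' hK (by simpa), add_sub_cancel]

theorem SelfImproving.norm_le_of_scale (hw : SelfImproving p w) (hc : ∀ t, Continuous (w t))
    {β δ L R K : ℝ} (hβ0 : 0 < β) (hβ1 : β < 1) (hpβ : p * β = 2 + β) (hL : L ^ δ = 4)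
    (hL2 : 2 < L) (hR : 0 < R) (hK : 0 ≤ K)
    (hsmall : K ^ (p - 1) / (β * (1 - β)) ≤ 2 * L ^ (-(1 - β)))
    (h : ∀ t, ∀ r ≥ R, ‖w t r‖ ≤ K * r ^ (1 - β)) (t : ℝ) {r : ℝ} (hr : L * R ≤ r) :
    ‖w t r‖ ≤ K * L ^ (-(1 - β - δ)) * r ^ (1 - β) := by
  have hp : p ≠ 0 := by rintro rfl; linarith
  have hL0 : 0 < L := by linarith
  have h2R : 2 * R ≤ r := (mul_le_mul_of_nonneg_right hL2.le hR.le).trans hr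
  have hr0 : 0 < r := by linarith
  have hθ : 0 < 1 - β := by linarith
  have hnull := hw R K β hR.le hK (by linarith) fun t r hr => h t r hr.le
  rw [hpβ, add_sub_cancel_left, sub_add_cancel_left] at hnull
  have hspace := hnull.norm_space_sub_le_rpow hR.le (by linarith) (hc t) (by linarith : R < 2 * R)
    h2R
  rw [neg_add_eq_sub, rpow_div_div_eq_mul hp hK] at hspace
  have hdrop : 0 ≤ K * (K ^ (p - 1) / (β * (1 - β))) * (2 * R) ^ (1 - β) := by positivity
  have hbase : ‖w t (2 * R)‖ ≤ K * (2 * (L ^ (-(1 - β)) * r ^ (1 - β))) :=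
    (h t (2 * R) (by linarith)).trans
      (by gcongr; exact two_mul_rpow_le hL0 hR.le hr hθ.le (by linarith))
  have hgain : K * (K ^ (p - 1) / (β * (1 - β))) * r ^ (1 - β)
      ≤ K * (2 * L ^ (-(1 - β))) * r ^ (1 - β) := by gcongr
  calc ‖w t r‖
      ≤ ‖w t r - w t (2 * R)‖ + ‖w t (2 * R)‖ := norm_le_norm_sub_add _ _
    _ ≤ K * (2 * L ^ (-(1 - β))) * r ^ (1 - β)
          + K * (2 * (L ^ (-(1 - β)) * r ^ (1 - β))) := by linarith
    _ = K * (4 * L ^ (-(1 - β))) * r ^ (1 - β) := by ring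
    _ = K * L ^ (-(1 - β - δ)) * r ^ (1 - β) := by
        rw [← hL, ← Real.rpow_add hL0, show δ + -(1 - β) = -(1 - β - δ) by ring]

theorem SelfImproving.norm_le_of_scale_pow (hw : SelfImproving p w) (hc : ∀ t, Continuous (w t))
    {β δ L R K : ℝ} (hβ0 : 0 < β) (hβ1 : β < 1) (hpβ : p * β = 2 + β) (hp : 1 < p)
    (hδ : δ ≤ 1 - β) (hL : L ^ δ = 4) (hL2 : 2 < L) (hR : 0 < R) (hK : 0 ≤ K)
    (hsmall : K ^ (p - 1) / (β * (1 - β)) ≤ 2 * L ^ (-(1 - β)))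
    (h : ∀ t, ∀ r ≥ R, ‖w t r‖ ≤ K * r ^ (1 - β)) (n : ℕ) :
    ∀ t, ∀ r ≥ L ^ n * R, ‖w t r‖ ≤ K * (L ^ n) ^ (-(1 - β - δ)) * r ^ (1 - β) := by
  have hL0 : 0 < L := by linarith
  induction n with
  | zero => simpa using h
  | succ n ih =>
    intro t r hr
    have : 0 < 1 - β := by linarith
    have hfactor : (L ^ n : ℝ) ^ (-(1 - β - δ)) ≤ 1 :=
      Real.rpow_le_one_of_one_le_of_nonpos (one_le_pow₀ (by linarith)) (by linarith)
    have hsmall' : (K * (L ^ n) ^ (-(1 - β - δ))) ^ (p - 1) / (β * (1 - β))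
        ≤ 2 * L ^ (-(1 - β)) := by
      refine le_trans ?_ hsmall
      gcongr
      exact mul_le_of_le_one_right hK hfactor
    have hstep := hw.norm_le_of_scale hc hβ0 hβ1 hpβ hL hL2 (by positivity : 0 < L ^ n * R)
      (by positivity) hsmall' ih t (r := r) (by rwa [← mul_assoc, ← pow_succ'])
    rwa [mul_assoc K, ← Real.mul_rpow (by positivity) hL0.le, ← pow_succ] at hstep

theorem norm_le_rpow_of_forall_scale_pow {f : ℝ → ℂ} {L R K θ η : ℝ} (hL : 1 < L) (hR : 0 < R)
    (hK : 0 ≤ K) (hη : 0 ≤ η)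
    (h : ∀ n : ℕ, ∀ r ≥ L ^ n * R, ‖f r‖ ≤ K * (L ^ n) ^ (-η) * r ^ θ) {r : ℝ} (hr : R ≤ r) :
    ‖f r‖ ≤ K * (L * R) ^ η * r ^ (θ - η) := by
  have hr0 : 0 < r := hR.trans_le hr
  have hLR : 0 < L * R := by positivity
  obtain ⟨n, hle, hlt⟩ := exists_nat_pow_near ((one_le_div hR).2 hr) hL
  rw [le_div_iff₀ hR] at hle
  rw [div_lt_iff₀ hR, pow_succ, mul_assoc] at hlt
  calc ‖f r‖ ≤ K * (L ^ n) ^ (-η) * r ^ θ := h n r hle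
    _ ≤ K * (r / (L * R)) ^ (-η) * r ^ θ := by
        gcongr ?_ * ?_ * ?_
        exact Real.rpow_le_rpow_of_nonpos (by positivity) ((div_le_iff₀ hLR).2 hlt.le)
          (neg_nonpos.2 hη)
    _ = K * (L * R) ^ η * r ^ (θ - η) := by
        rw [Real.rpow_neg (by positivity), Real.div_rpow hr0.le hLR.le, Real.rpow_sub hr0]
        field_simp

theorem exists_scale (hp : 3 < p) {θ : ℝ} (hθ : 0 < θ) (hθ1 : θ ≤ 1) :
    ∃ δ L : ℝ, δ ≤ θ ∧ p * δ < p - 3 ∧ L ^ δ = 4 ∧ 2 < L := by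
  have hδ : 0 < min ((p - 3) / (2 * p)) θ :=
    lt_min (div_pos (by linarith) (by linarith)) hθ
  refine ⟨min ((p - 3) / (2 * p)) θ, 4 ^ (min ((p - 3) / (2 * p)) θ)⁻¹, min_le_right _ _, ?_,
    Real.rpow_inv_rpow (by norm_num) hδ.ne', ?_⟩
  · calc p * min ((p - 3) / (2 * p)) θ ≤ p * ((p - 3) / (2 * p)) := by
          gcongr
          exact min_le_left _ _
      _ = (p - 3) / 2 := by field_simp
      _ < p - 3 := by linarith
  · calc (2 : ℝ) < 4 ^ (1 : ℝ) := by norm_num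
      _ ≤ 4 ^ (min ((p - 3) / (2 * p)) θ)⁻¹ :=
          Real.rpow_le_rpow_of_exponent_le (by norm_num)
            ((one_le_inv₀ hδ).2 ((min_le_right _ _).trans hθ1))

theorem SelfImproving.exists_norm_le_rpow (hw : SelfImproving p w) (hc : ∀ t, Continuous (w t))
    {β : ℝ} (hβ0 : 0 < β) (hβ1 : β < 1) (hpβ : p * β = 2 + β) (hp : 3 < p)
    (hsmall : ∀ ε > 0, ∃ R > 0, ∀ t, ∀ r ≥ R, ‖w t r‖ ≤ ε * r ^ (1 - β)) :
    ∃ δ R K : ℝ, p * δ < p - 3 ∧ 0 < R ∧ 0 ≤ K ∧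
      ∀ t, ∀ r > R, ‖w t r‖ ≤ K * r ^ (1 - (1 - δ)) := by
  have hθ : 0 < 1 - β := by linarith
  obtain ⟨δ, L, hδθ, hpδ, hL, hL2⟩ := exists_scale hp hθ (by linarith)
  have : 0 < L := by linarith
  have hc0 : 0 < β * (1 - β) * (2 * L ^ (-(1 - β))) := by positivity
  obtain ⟨R, hR, hwR⟩ := hsmall _ (Real.rpow_pos_of_pos hc0 (p - 1)⁻¹)
  refine ⟨δ, R, (β * (1 - β) * (2 * L ^ (-(1 - β)))) ^ (p - 1)⁻¹ * (L * R) ^ (1 - β - δ), hpδ,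
    hR, by positivity, fun t r hr => ?_⟩
  have hdecay := norm_le_rpow_of_forall_scale_pow (by linarith) hR (by positivity) (by linarith)
    (fun n => hw.norm_le_of_scale_pow hc hβ0 hβ1 hpβ (by linarith) hδθ hL hL2 hR (by positivity)
      ?_ hwR n t) hr.le
  · rwa [show 1 - β - (1 - β - δ) = 1 - (1 - δ) by ring] at hdecay
  · rw [Real.rpow_inv_rpow hc0.le (by linarith), mul_div_cancel_left₀ _ (by positivity)]

theorem NullLip.norm_le_add_rpow {R K e : ℝ} (hw : NullLip w R fun y => K * y ^ (-e)) (hR : 0 ≤ R)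
    (hK : 0 ≤ K) (he : 1 < e) {t : ℝ} (hc : Continuous (w t)) {ρ r : ℝ} (hρ : R < ρ)
    (hr : ρ ≤ r) : ‖w t r‖ ≤ ‖w t ρ‖ + K / (e - 1) * ρ ^ (-e + 1) := by
  have hspace := hw.norm_space_sub_le_rpow hR (by linarith) hc hρ hr
  have hr0 : 0 < r := (hR.trans_lt hρ).trans_le hr
  have he1 : 0 < e - 1 := by linarith
  rw [show K / (-e + 1) = -(K / (e - 1)) by rw [← div_neg, neg_sub, neg_add_eq_sub]] at hspace
  have hdrop : 0 ≤ K / (e - 1) * r ^ (-e + 1) := by positivity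
  linarith [norm_le_norm_sub_add (w t r) (w t ρ)]

theorem SelfImproving.exists_bound (hw : SelfImproving p w) (hc : ∀ t, Continuous (w t)) {β : ℝ}
    (hβ0 : 0 < β) (hβ1 : β < 1) (hpβ : p * β = 2 + β) (hp : 3 < p) {C₀ : ℝ}
    (hC₀ : ∀ t, ∀ r > 0, ‖w t r‖ ≤ C₀ * r ^ (1 - β))
    (hsmall : ∀ ε > 0, ∃ R > 0, ∀ t, ∀ r ≥ R, ‖w t r‖ ≤ ε * r ^ (1 - β)) :
    ∃ C ≥ 0, ∀ t, ∀ r > 0, ‖w t r‖ ≤ C := by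
  obtain ⟨δ, R, K, hpδ, hR, hK, hdecay⟩ := hw.exists_norm_le_rpow hc hβ0 hβ1 hpβ hp hsmall
  have hexp : 1 < p * (1 - δ) - 2 := by linarith
  have hnull := hw R K (1 - δ) hR.le hK (by linarith) hdecay
  rw [← neg_sub (p * (1 - δ)) 2] at hnull
  have hC₀0 : 0 ≤ C₀ := by simpa using (norm_nonneg _).trans (hC₀ 0 1 one_pos)
  have htail : 0 ≤ K ^ p / (p * (1 - δ) - 2) / (p * (1 - δ) - 2 - 1)
      * (2 * R) ^ (-(p * (1 - δ) - 2) + 1) := by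
    have : 0 < p * (1 - δ) - 2 - 1 := by linarith
    positivity
  refine ⟨_, add_nonneg (by positivity : 0 ≤ C₀ * (2 * R) ^ (1 - β)) htail, fun t r hr => ?_⟩
  rcases le_total r (2 * R) with hnear | hfar
  · calc ‖w t r‖ ≤ C₀ * r ^ (1 - β) := hC₀ t r hr
      _ ≤ C₀ * (2 * R) ^ (1 - β) := by gcongr
      _ ≤ _ := le_add_of_nonneg_right htail
  · exact (hnull.norm_le_add_rpow hR.le (by positivity) hexp (hc t) (by linarith) hfar).trans
      (add_le_add_left (hC₀ t (2 * R) (by positivity)) _)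

theorem NullLip.mono {R : ℝ} {D D' : ℝ → ℝ} (hw : NullLip w R D) (h : ∀ y > R, D y ≤ D' y) :
    NullLip w R D' := by
  intro t k ρ hk hρ
  have hD := mul_le_mul_of_nonneg_left (h (ρ - 2 * k) (by linarith)) hk.le
  exact ⟨(hw t k ρ hk hρ).1.trans hD, (hw t k ρ hk hρ).2.trans hD⟩

theorem NullLip.min {R : ℝ} {D D' : ℝ → ℝ} (hw : NullLip w R D) (hw' : NullLip w R D') :
    NullLip w R fun y => min (D y) (D' y) := by
  intro t h ρ hh hρ
  simp only [mul_min_of_nonneg _ _ hh.le, le_min_iff]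
  exact ⟨⟨(hw t h ρ hh hρ).1, (hw' t h ρ hh hρ).1⟩, (hw t h ρ hh hρ).2, (hw' t h ρ hh hρ).2⟩

theorem SelfImproving.exists_nullLip (hw : SelfImproving p w) {β : ℝ} (hβ0 : 0 < β) (hβ1 : β ≤ 1)
    (hpβ : p * β = 2 + β) (hp : 3 ≤ p) {C₀ C₁ : ℝ} (hC₀0 : 0 ≤ C₀) (hC₁0 : 0 ≤ C₁)
    (hC₀ : ∀ t, ∀ r > 0, ‖w t r‖ ≤ C₀ * r ^ (1 - β)) (hC₁ : ∀ t, ∀ r > 0, ‖w t r‖ ≤ C₁) :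
    ∃ C > 0, NullLip w 0 (fun y => C * y ^ (2 - p)) ∧ NullLip w 0 (fun y => C * y ^ (-1 : ℝ)) := by
  have hfar := hw 0 C₁ 1 le_rfl hC₁0 (by linarith) fun t r hr => by simpa using hC₁ t r hr
  have hnear := hw 0 C₀ β le_rfl hC₀0 (by linarith) hC₀
  rw [mul_one] at hfar
  rw [hpβ, add_sub_cancel_left, sub_add_cancel_left] at hnear
  have hp2 : 0 < p - 2 := by linarith
  have hfar0 : 0 ≤ C₁ ^ p / (p - 2) := by positivity
  have hnear0 : 0 ≤ C₀ ^ p / β := by positivity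
  refine ⟨C₁ ^ p / (p - 2) + C₀ ^ p / β + 1, by positivity, hfar.mono fun y hy => ?_,
    (hfar.min hnear).mono fun y hy => ?_⟩
  · gcongr
    linarith
  rcases le_total 1 y with hy1 | hy1
  · refine (min_le_left _ _).trans (mul_le_mul (by linarith) ?_ (by positivity) (by positivity))
    exact Real.rpow_le_rpow_of_exponent_le hy1 (by linarith)
  · refine (min_le_right _ _).trans (mul_le_mul (by linarith) ?_ (by positivity) (by positivity))
    exact Real.rpow_le_rpow_of_exponent_ge hy hy1 (by linarith)

end decay

/-! ### The profile of a radial function -/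

section profile

variable {s : ℝ} {g : Hdot s} {f : E3 → ℝ}

theorem Hdot.IsFunction.integral_test_mul_profile (hs : 1 / 2 < s) (hs' : s < 3 / 2)
    (hf : g.IsFunction f) {q : ℝ → ℝ} (hq : ∀ x, f x = q ‖x‖) {χ : ℝ → ℝ} (hχ : IsTest 0 χ) :
    IntegrableOn (fun r => (χ r : ℂ) * (r * q r : ℝ)) (Ioi 0) ∧
      ∫ r in Ioi (0 : ℝ), (χ r : ℂ) * (r * q r : ℝ) = ∫ r, (χ r : ℂ) * g.profile r := by
  obtain ⟨hint, hpair⟩ := hf hχ.toSchwartz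
  let H : ℝ → ℂ := fun r => q r * (χ r / (4 * π * r) : ℝ)
  have hradial : (fun x => (f x : ℂ) * hχ.toSchwartz x) = fun x => H ‖x‖ := by
    ext x
    rw [hq, hχ.coe_toSchwartz, radialKernel]
  have hpolar : EqOn (fun r : ℝ => (4 * π * r ^ 2) • H r) (fun r => (χ r : ℂ) * (r * q r : ℝ))
      (Ioi 0) := fun r hr => by
    have hr0 : r ≠ 0 := (mem_Ioi.1 hr).ne'
    simp only [H, Complex.real_smul, ← Complex.ofReal_mul]
    congr 1
    field_simp
  rw [hradial] at hint
  rw [pair_toSchwartz hs hs' hχ, hradial, integral_norm_E3,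
    setIntegral_congr_fun measurableSet_Ioi hpolar] at hpair
  refine ⟨(integrableOn_congr_fun (fun r hr => ?_) measurableSet_Ioi).1
    ((integrable_norm_E3.1 hint).smul (4 * π)), hpair⟩
  exact (smul_smul _ _ _).trans (hpolar hr)

theorem isTest_contDiffBump {a c : ℝ} (φ : ContDiffBump c) (h : a < c - φ.rOut) : IsTest a φ := by
  refine ⟨φ.contDiff, φ.hasCompactSupport, ?_⟩
  rw [φ.tsupport_eq, Real.closedBall_eq_Icc]
  exact fun y hy => h.trans_le hy.1

theorem locallyIntegrableOn_of_forall_test {f : ℝ → ℂ} {a : ℝ}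
    (h : ∀ χ, IsTest a χ → IntegrableOn (fun r => (χ r : ℂ) * f r) (Ioi a)) :
    LocallyIntegrableOn f (Ioi a) := by
  intro r (hr : a < r)
  let φ : ContDiffBump r := ⟨(r - a) / 4, (r - a) / 2, by linarith, by linarith⟩
  have hχ : IsTest a φ := isTest_contDiffBump φ (by simp only [φ]; linarith)
  have hsub : Metric.closedBall r ((r - a) / 4) ⊆ Ioi a := by
    rw [Real.closedBall_eq_Icc]
    exact fun y hy => (by linarith : a < r - (r - a) / 4).trans_le hy.1
  refine ⟨Metric.closedBall r ((r - a) / 4), mem_nhdsWithin_of_mem_nhds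
    (Metric.closedBall_mem_nhds r (by linarith)), ?_⟩
  refine (integrableOn_congr_fun (fun y hy => ?_) Metric.isClosed_closedBall.measurableSet).1
    ((h φ hχ).mono_set hsub)
  rw [φ.one_of_mem_closedBall hy, Complex.ofReal_one, one_mul]

theorem ae_eq_zero_of_forall_test {f : ℝ → ℂ} {a : ℝ} (hf : LocallyIntegrableOn f (Ioi a))
    (h : ∀ χ, IsTest a χ → ∫ r in Ioi a, (χ r : ℂ) * f r = 0) : ∀ᵐ r, a < r → f r = 0 := by
  refine isOpen_Ioi.ae_eq_zero_of_integral_contDiff_smul_eq_zero hf fun χ hχ hχc hχs => ?_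
  have htest : IsTest a χ := ⟨hχ, hχc, hχs⟩
  simp only [Complex.real_smul]
  rw [← h χ htest, setIntegral_eq_integral_of_forall_compl_eq_zero fun r hr => by
    rw [htest.eq_zero (not_lt.1 hr), Complex.ofReal_zero, zero_mul]]

theorem Hdot.IsFunction.ae_mul_eq_profile (hs : 1 / 2 < s) (hs' : s < 3 / 2) (hf : g.IsFunction f)
    {q : ℝ → ℝ} (hq : ∀ x, f x = q ‖x‖) :
    ∀ᵐ r : ℝ, 0 < r → ((r * q r : ℝ) : ℂ) - g.profile r = 0 := by
  have hc := g.continuous_profile hs hs'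
  refine ae_eq_zero_of_forall_test ((locallyIntegrableOn_of_forall_test fun χ hχ =>
    (hf.integral_test_mul_profile hs hs' hq hχ).1).sub
      (hc.locallyIntegrable.locallyIntegrableOn _)) fun χ hχ => ?_
  obtain ⟨hint, heq⟩ := hf.integral_test_mul_profile hs hs' hq hχ
  simp only [mul_sub]
  rw [integral_sub hint (hχ.integrable_mul hc).integrableOn, heq, sub_eq_zero,
    setIntegral_eq_integral_of_forall_compl_eq_zero fun r hr => by
      rw [hχ.eq_zero (not_lt.1 hr), Complex.ofReal_zero, zero_mul]]

theorem Hdot.IsFunction.ae_eq_profile (hs : 1 / 2 < s) (hs' : s < 3 / 2)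
    (hf : g.IsFunction f) (hr : IsRadial f) : ∀ᵐ x : E3, (f x : ℂ) = g.profile ‖x‖ / ‖x‖ := by
  have hfq : ∀ x, f x = f (‖x‖ • EuclideanSpace.single (0 : Fin 3) (1 : ℝ)) :=
    fun x => hr _ _ (by simp [norm_smul])
  filter_upwards [ae_norm_of_ae volume (hf.ae_mul_eq_profile hs hs'
    (q := fun r => f (r • EuclideanSpace.single (0 : Fin 3) (1 : ℝ))) hfq),
    Measure.ae_ne volume (0 : E3)] with x hx hx0
  have hnorm : (‖x‖ : ℂ) ≠ 0 := by exact_mod_cast norm_ne_zero_iff.2 hx0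
  rw [eq_div_iff hnorm, hfq, ← sub_eq_zero.1 hx, Complex.ofReal_mul,
    mul_comm]

theorem Hdot.IsFunction.ae_abs_le (hs : 1 / 2 < s) (hs' : s < 3 / 2) (hf : g.IsFunction f)
    (hr : IsRadial f) {R K b : ℝ} (h : ∀ r > R, 0 < r → ‖g.profile r‖ ≤ K * r ^ (1 - b)) :
    ∀ᵐ x, R < ‖x‖ → |f x| ≤ K * ‖x‖ ^ (-b) := by
  filter_upwards [hf.ae_eq_profile hs hs' hr, Measure.ae_ne volume (0 : E3)] with x hx hx0 hR
  have hx0' := norm_pos_iff.2 hx0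
  rw [← Real.norm_eq_abs, ← Complex.norm_real, hx, norm_div, Complex.norm_real, norm_norm,
    div_le_iff₀ hx0']
  refine (h _ hR hx0').trans_eq ?_
  rw [sub_eq_neg_add, Real.rpow_add hx0', Real.rpow_one, mul_assoc]

theorem Hdot.continuous_profile_comp (hs : 1 / 2 < s) (hs' : s < 3 / 2) {U : ℝ → Hdot s}
    (hU : Continuous U) (r : ℝ) : Continuous fun t => (U t).profile r := by
  have hLip : LipschitzWith (sobolevConst s * |r| ^ (s - 1 / 2)).toNNReal
      fun g : Hdot s => g.profile r := by
    refine LipschitzWith.of_dist_le' fun a b => ?_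
    rw [dist_eq_norm, dist_eq_norm, ← a.profile_sub b hs hs' r]
    exact (a - b).norm_profile_le hs hs' r
  exact hLip.continuous.comp hU

end profile

/-! ### Time reversal -/

theorem sinSymbol_neg (t : ℝ) (ξ : E3) : sinSymbol (-t) ξ = -sinSymbol t ξ := by
  rw [sinSymbol, sinSymbol, neg_mul, Real.sin_neg, neg_div]

theorem Hdot.neg_act {σ : ℝ} (g : Hdot σ) (k : E3 → ℝ) : (-g).act k = -g.act k := by
  rw [Hdot.act, Hdot.act, ← integral_neg]
  refine integral_congr_ae ?_
  filter_upwards [absolutelyContinuous_hdotMeasure σ (Lp.coeFn_neg g)] with ξ hξ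
  rw [hξ, Pi.neg_apply, neg_mul]

theorem freeField_neg {s : ℝ} (t : ℝ) (g₀ : Hdot s) (g₁ : Hdot (s - 1)) (ρ : ℝ) :
    freeField (-t) g₀ (-g₁) ρ = freeField t g₀ g₁ ρ := by
  simp only [freeField, Hdot.neg_act, Hdot.act_neg, sinSymbol_neg, neg_mul, Real.cos_neg, neg_neg]

theorem isCompact_closure_range_reverse {X Y : Type*} [TopologicalSpace X] [R1Space X]
    [TopologicalSpace Y] [R1Space Y] [Neg Y] [ContinuousNeg Y] {U : ℝ → X} {V : ℝ → Y}
    (h : IsCompact (closure (range fun t => (U t, V t)))) :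
    IsCompact (closure (range fun t => (U (-t), -V (-t)))) := by
  have hc : Continuous fun q : X × Y => (q.1, -q.2) := by fun_prop
  refine (h.image hc).closure_of_subset ?_
  rintro _ ⟨t, rfl⟩
  exact ⟨(U (-t), V (-t)), subset_closure ⟨-t, rfl⟩, rfl⟩

/-! ### The profile of a solution -/

section compactness

variable {s : ℝ}

theorem Hdot.exists_forall_norm_profile_le (hs : 1 / 2 < s) (hs' : s < 3 / 2) {S : Set (Hdot s)}
    (hS : Bornology.IsBounded S) :
    ∃ C ≥ 0, ∀ g ∈ S, ∀ r, ‖g.profile r‖ ≤ C * |r| ^ (s - 1 / 2) := by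
  obtain ⟨B, hB0, hB⟩ := hS.exists_pos_norm_le
  have := sobolevConst_nonneg s
  refine ⟨sobolevConst s * B, by positivity, fun g hg r => ?_⟩
  rw [mul_right_comm]
  exact (g.norm_profile_le hs hs' r).trans (by gcongr; exact hB g hg)

theorem Hdot.exists_forall_norm_profile_le_small (hs : 1 / 2 < s) (hs' : s < 3 / 2)
    {S : Set (Hdot s)} (hS : IsCompact (closure S)) {ε : ℝ} (hε : 0 < ε) :
    ∃ R > 0, ∀ g ∈ S, ∀ r ≥ R, ‖g.profile r‖ ≤ ε * r ^ (s - 1 / 2) := by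
  have hcancel : ∀ r : ℝ, 0 < r → r ^ (1 / 2 - s) = (r ^ (s - 1 / 2))⁻¹ := fun r hr => by
    rw [← Real.rpow_neg (le_of_lt hr), neg_sub]
  have hLip : ∀ r : ℝ, 0 < r → ∀ g g' : Hdot s,
      ‖(r ^ (1 / 2 - s) : ℝ) • g.profile r - (r ^ (1 / 2 - s) : ℝ) • g'.profile r‖
        ≤ sobolevConst s * dist g g' := by
    intro r hr g g'
    rw [← smul_sub, ← g.profile_sub g' hs hs', norm_smul, Real.norm_of_nonneg (by positivity),
      hcancel r hr, inv_mul_le_iff₀ (by positivity), dist_eq_norm]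
    exact ((g - g').norm_profile_le hs hs' r).trans_eq (by rw [abs_of_pos hr]; ring)
  obtain ⟨R, hR, hsmall⟩ := exists_forall_norm_le_of_isCompact hS
    (Φ := fun r g => (r ^ (1 / 2 - s) : ℝ) • g.profile r) hLip
    (fun g => g.tendsto_profile hs hs') hε
  refine ⟨R, hR, fun g hg r hr => ?_⟩
  have hr0 : 0 < r := hR.trans_le hr
  have hle := hsmall r hr g hg
  rwa [norm_smul, Real.norm_of_nonneg (by positivity), hcancel r hr0,
    inv_mul_le_iff₀ (by positivity), mul_comm] at hle

end compactness

section solution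

variable {p : ℝ} {F : ℝ → ℝ → ℝ → ℝ} {u : ℝ → E3 → ℝ} {U : ℝ → Hdot (sCrit p)}
  {V : ℝ → Hdot (sCrit p - 1)}

theorem half_lt_sCrit (hp₃ : 3 < p) : 1 / 2 < sCrit p := by
  have : 2 / (p - 1) < 1 := by rw [div_lt_one (by linarith)]; linarith
  rw [sCrit]; linarith

theorem sCrit_lt (hp : 1 < p) : sCrit p < 3 / 2 :=
  sub_lt_self _ (div_pos two_pos (sub_pos.2 hp))

theorem sCrit_sub_half (p : ℝ) : sCrit p - 1 / 2 = 1 - 2 / (p - 1) := by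
  rw [sCrit]; ring

theorem mul_two_div_sub_one (hp : p ≠ 1) : p * (2 / (p - 1)) = 2 + 2 / (p - 1) := by
  have : p - 1 ≠ 0 := sub_ne_zero.2 hp
  field_simp
  ring

theorem isCompact_closure_range_fst {X Y : Type*} [TopologicalSpace X] [R1Space X]
    [TopologicalSpace Y] {U : ℝ → X} {V : ℝ → Y}
    (h : IsCompact (closure (range fun t => (U t, V t)))) : IsCompact (closure (range U)) := by
  refine (h.image continuous_fst).closure_of_subset ?_
  rintro _ ⟨t, rfl⟩
  exact ⟨(U t, V t), subset_closure ⟨t, rfl⟩, rfl⟩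

theorem IsGlobalSolution.ae_abs_nonlinearity_le (hu : IsGlobalSolution p F u U V) (hp₃ : 3 < p)
    (hF : ∀ r : ℝ, 0 ≤ r → ∀ v t : ℝ, |F r v t| ≤ |v| ^ p) (hrad : ∀ t, IsRadial (u t))
    {R K b : ℝ} (hK : 0 ≤ K) {τ : ℝ} (h : ∀ r > R, 0 < r → ‖(U τ).profile r‖ ≤ K * r ^ (1 - b)) :
    ∀ᵐ x, R < ‖x‖ → |F ‖x‖ (u τ x) τ| ≤ K ^ p * ‖x‖ ^ (-(p * b)) := by
  filter_upwards [(hu.isFunction τ).ae_abs_le (half_lt_sCrit hp₃) (sCrit_lt (by linarith)) (hrad τ)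
    h] with x hx hR
  calc |F ‖x‖ (u τ x) τ| ≤ |u τ x| ^ p := hF _ (norm_nonneg x) _ _
    _ ≤ (K * ‖x‖ ^ (-b)) ^ p := Real.rpow_le_rpow (abs_nonneg _) (hx hR) (by linarith)
    _ = K ^ p * ‖x‖ ^ (-(p * b)) := by
      rw [Real.mul_rpow hK (by positivity), ← Real.rpow_mul (norm_nonneg x), neg_mul, mul_comm b]

theorem IsGlobalSolution.exists_bound_nonlinearity (hu : IsGlobalSolution p F u U V) (hp₃ : 3 < p)
    (hF : ∀ r : ℝ, 0 ≤ r → ∀ v t : ℝ, |F r v t| ≤ |v| ^ p) (hrad : ∀ t, IsRadial (u t))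
    (hbdd : Bornology.IsBounded (range U)) :
    ∃ C β : ℝ, β < 1 ∧ ∀ τ, ∀ᵐ x : E3, |F ‖x‖ (u τ x) τ| ≤ C * ‖x‖ ^ (-2 - β) := by
  obtain ⟨C₀, hC₀, hU⟩ := Hdot.exists_forall_norm_profile_le (half_lt_sCrit hp₃)
    (sCrit_lt (by linarith)) hbdd
  refine ⟨C₀ ^ p, 2 / (p - 1), by rw [div_lt_one (by linarith)]; linarith, fun τ => ?_⟩
  filter_upwards [hu.ae_abs_nonlinearity_le hp₃ hF hrad (R := -1) (b := 2 / (p - 1)) hC₀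
    fun r _ hr => by simpa only [sCrit_sub_half, abs_of_pos hr] using hU _ (mem_range_self τ) r]
    with x hx
  rw [← neg_add', ← mul_two_div_sub_one (by linarith : p ≠ 1)]
  exact hx (neg_one_lt_zero.trans_le (norm_nonneg x))

theorem IsGlobalSolution.integral_test_mul_profile (hu : IsGlobalSolution p F u U V) (hp₃ : 3 < p)
    (t₀ t : ℝ) {χ : ℝ → ℝ} (hχ : IsTest 0 χ) :
    ∫ ρ, (χ ρ : ℂ) * (U t).profile ρ
      = (∫ ρ, (χ ρ : ℂ) * freeField (t - t₀) (U t₀) (V t₀) ρ)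
        + ∫ τ in t₀..t, ∫ x, (F ‖x‖ (u τ x) τ : ℂ) * radialKernel (dAlembert χ (t - τ)) x := by
  have hs := half_lt_sCrit hp₃
  have hs' := sCrit_lt (by linarith : 1 < p)
  rw [← pair_toSchwartz hs hs' hχ, ← freeWave_toSchwartz hs hs' hχ, hu.integral_equation t₀ t,
    duhamel]
  congr 2
  ext τ
  refine integral_congr_ae ?_
  filter_upwards [Measure.ae_ne volume (0 : E3)] with x hx
  rw [sinPropagator_toSchwartz hχ _ hx]

theorem radialKernel_dAlembert_neg (χ : ℝ → ℝ) (σ : ℝ) (x : E3) :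
    radialKernel (dAlembert χ (-σ)) x = -radialKernel (dAlembert χ σ) x := by
  rw [radialKernel, radialKernel, dAlembert_neg, neg_div, Complex.ofReal_neg]

theorem IsGlobalSolution.radialFlow (hu : IsGlobalSolution p F u U V) (hp₃ : 3 < p)
    (hF : ∀ r : ℝ, 0 ≤ r → ∀ v t : ℝ, |F r v t| ≤ |v| ^ p) (hrad : ∀ t, IsRadial (u t))
    (hbdd : Bornology.IsBounded (range U)) :
    RadialFlow (sCrit p) U V fun τ x => F ‖x‖ (u τ x) τ where
  aestronglyMeasurable := hu.aestronglyMeasurable_nonlinearity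
  exists_bound := hu.exists_bound_nonlinearity hp₃ hF hrad hbdd
  duhamel t N χ _ hχ := by
    have hshift := intervalIntegral.integral_comp_add_left (a := 0) (b := N)
      (fun τ => -∫ x, (F ‖x‖ (u τ x) τ : ℂ) * radialKernel (dAlembert χ (t - τ)) x) t
    rw [add_zero] at hshift
    rw [hu.integral_test_mul_profile hp₃ (t + N) t hχ, sub_add_cancel_left,
      intervalIntegral.integral_symm, ← intervalIntegral.integral_neg, ← hshift]
    simp only [sub_add_cancel_left, radialKernel_dAlembert_neg, mul_neg, integral_neg, neg_neg]

theorem IsGlobalSolution.radialFlow_reverse (hu : IsGlobalSolution p F u U V) (hp₃ : 3 < p)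
    (hF : ∀ r : ℝ, 0 ≤ r → ∀ v t : ℝ, |F r v t| ≤ |v| ^ p) (hrad : ∀ t, IsRadial (u t))
    (hbdd : Bornology.IsBounded (range U)) :
    RadialFlow (sCrit p) (fun t => U (-t)) (fun t => -V (-t))
      fun τ x => F ‖x‖ (u (-τ) x) (-τ) where
  aestronglyMeasurable := hu.aestronglyMeasurable_nonlinearity.comp_measurePreserving
    ((Measure.measurePreserving_neg (volume : Measure ℝ)).prod
      (MeasurePreserving.id (volume : Measure E3)))
  exists_bound := by
    obtain ⟨C, β, hβ, h⟩ := hu.exists_bound_nonlinearity hp₃ hF hrad hbdd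
    exact ⟨C, β, hβ, fun τ => h (-τ)⟩
  duhamel t N χ _ hχ := by
    have hshift := intervalIntegral.integral_comp_sub_left (a := 0) (b := N)
      (fun τ => ∫ x, (F ‖x‖ (u τ x) τ : ℂ) * radialKernel (dAlembert χ (-t - τ)) x) (-t)
    rw [sub_zero, ← neg_add'] at hshift
    rw [hu.integral_test_mul_profile hp₃ (-(t + N)) (-t) hχ, ← hshift,
      show -t - -(t + N) = N by ring]
    simp only [freeField_neg, sub_sub_cancel, neg_add']

theorem IsGlobalSolution.selfImproving (hu : IsGlobalSolution p F u U V) (hp₃ : 3 < p)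
    (hF : ∀ r : ℝ, 0 ≤ r → ∀ v t : ℝ, |F r v t| ≤ |v| ^ p) (hrad : ∀ t, IsRadial (u t))
    (hcpt : IsCompact (closure (range fun t => (U t, V t)))) :
    SelfImproving p fun t r => (U t).profile r := by
  intro R K b hR hK hb hle t h ρ hh hρ
  have hs := half_lt_sCrit hp₃
  have hs' := sCrit_lt (by linarith : 1 < p)
  have hbdd := (isCompact_closure_range_fst hcpt).isBounded.subset subset_closure
  have hG : ∀ τ, ∀ᵐ x : E3, R < ‖x‖ →
      |F ‖x‖ (u τ x) τ| ≤ K ^ p * ‖x‖ ^ (-(p * b - 1) - 1) := fun τ => by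
    rw [neg_sub', sub_neg_eq_add, add_sub_cancel_right]
    exact hu.ae_abs_nonlinearity_le hp₃ hF hrad hK fun r hr _ => hle τ r hr
  have hforward := (hu.radialFlow hp₃ hF hrad hbdd).norm_profile_sub_le hs hs' hcpt hR
    (by positivity) (by linarith) hh.le hG t hρ
  have hbackward := (hu.radialFlow_reverse hp₃ hF hrad hbdd).norm_profile_sub_le hs hs'
    (isCompact_closure_range_reverse hcpt) hR (by positivity) (by linarith) hh.le
    (fun τ => hG (-τ)) (-t) hρ
  rw [show p * b - 1 - 1 = p * b - 2 by ring, show 1 - (p * b - 1) = 2 - p * b by ring]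
    at hforward hbackward
  rw [neg_neg, neg_add', neg_neg] at hbackward
  exact ⟨hforward, hbackward⟩

theorem IsGlobalSolution.exists_profile_bounds (hu : IsGlobalSolution p F u U V) (hp₃ : 3 < p)
    (hF : ∀ r : ℝ, 0 ≤ r → ∀ v t : ℝ, |F r v t| ≤ |v| ^ p) (hrad : ∀ t, IsRadial (u t))
    (hcpt : IsCompact (closure (range fun t => (U t, V t)))) :
    ∃ C > 0, (∀ t, ∀ r > 0, ‖(U t).profile r‖ ≤ C) ∧
      NullLip (fun t r => (U t).profile r) 0 (fun y => C * y ^ (2 - p)) ∧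
      NullLip (fun t r => (U t).profile r) 0 (fun y => C * y ^ (-1 : ℝ)) := by
  have hs := half_lt_sCrit hp₃
  have hs' := sCrit_lt (by linarith : 1 < p)
  have hself := hu.selfImproving hp₃ hF hrad hcpt
  have hβ0 : 0 < 2 / (p - 1) := div_pos two_pos (by linarith)
  have hβ1 : 2 / (p - 1) < 1 := by rw [div_lt_one (by linarith)]; linarith
  have hpβ := mul_two_div_sub_one (by linarith : p ≠ 1)
  have hUcpt := isCompact_closure_range_fst hcpt
  obtain ⟨C₀, hC₀, hU⟩ := Hdot.exists_forall_norm_profile_le hs hs'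
    (hUcpt.isBounded.subset subset_closure)
  have hcrit : ∀ t, ∀ r > 0, ‖(U t).profile r‖ ≤ C₀ * r ^ (1 - 2 / (p - 1)) := fun t r hr => by
    simpa only [sCrit_sub_half, abs_of_pos hr] using hU _ (mem_range_self t) r
  obtain ⟨C₁, hC₁, hbound⟩ := hself.exists_bound (fun t => (U t).continuous_profile hs hs') hβ0 hβ1
    hpβ hp₃ hcrit fun ε hε => by
      simpa only [sCrit_sub_half, forall_mem_range]
        using Hdot.exists_forall_norm_profile_le_small hs hs' hUcpt hε
  obtain ⟨C₂, hC₂, hfar, hnear⟩ := hself.exists_nullLip hβ0 hβ1.le hpβ hp₃.le hC₀ hC₁ hcrit hbound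
  have hle : C₂ ≤ C₁ + C₂ := le_add_of_nonneg_left hC₁
  exact ⟨C₁ + C₂, by positivity, fun t r hr => (hbound t r hr).trans (by linarith),
    hfar.mono fun y hy => by gcongr, hnear.mono fun y hy => by gcongr⟩

end solution

/-! ### The limit of the profile at infinity -/

section limit

theorem exists_tendsto_atTop_of_norm_sub_le {E : Type*} [NormedAddCommGroup E] [CompleteSpace E]
    {f : ℝ → E} {b : ℝ → ℝ} (hb : Tendsto b atTop (𝓝 0))
    (hf : ∀ ρ > 0, ∀ r ≥ ρ, ‖f r - f ρ‖ ≤ b ρ) :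
    ∃ A, Tendsto f atTop (𝓝 A) ∧ ∀ ρ > 0, ‖f ρ - A‖ ≤ b ρ := by
  have hcauchy : CauchySeq f := Metric.cauchySeq_iff'.2 fun ε hε => by
    obtain ⟨N, hN, hN0⟩ := ((hb.eventually_lt_const hε).and (eventually_gt_atTop 0)).exists
    exact ⟨N, fun r hr => (dist_eq_norm (f r) (f N) ▸ hf N hN0 r hr).trans_lt hN⟩
  obtain ⟨A, hA⟩ := cauchySeq_tendsto_of_complete hcauchy
  refine ⟨A, hA, fun ρ hρ => ?_⟩
  rw [norm_sub_rev]
  refine le_of_tendsto (hA.sub_const (f ρ)).norm ?_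
  filter_upwards [eventually_ge_atTop ρ] with r hr using hf ρ hρ r hr

theorem tendsto_const_mul_rpow_atTop (K : ℝ) {a : ℝ} (ha : a < 0) :
    Tendsto (fun r : ℝ => K * r ^ a) atTop (𝓝 0) := by
  simpa using (tendsto_rpow_neg_atTop (neg_pos.2 ha)).const_mul K

variable {w : ℝ → ℝ → ℂ} {C a : ℝ}

theorem NullLip.tendsto_time_sub (hw : NullLip w 0 fun y => C * y ^ a) (ha : a < 0)
    (hct : ∀ r > 0, Continuous fun t => w t r) {t t' : ℝ} (ht : t ≤ t') :
    Tendsto (fun r => w t' r - w t r) atTop (𝓝 0) := by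
  have hlim : Tendsto (fun r : ℝ => (t' - t) * (C * r ^ a)) atTop (𝓝 0) := by
    simpa using (tendsto_const_mul_rpow_atTop C ha).const_mul (t' - t)
  refine squeeze_zero_norm' ?_ hlim
  filter_upwards [eventually_gt_atTop 0] with r hr
  exact hw.norm_time_sub_le (continuousOn_const_mul_rpow C a) (hct r hr) hr ht

theorem NullLip.norm_space_sub_le_of_lt_neg_one (hw : NullLip w 0 fun y => C * y ^ a)
    (hC : 0 ≤ C) (ha : a < -1) {t : ℝ} (hc : Continuous (w t)) {ρ r : ℝ} (hρ : 0 < ρ)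
    (hr : ρ ≤ r) : ‖w t r - w t ρ‖ ≤ C / (-(a + 1)) * ρ ^ (a + 1) := by
  have hr0 : 0 < r := hρ.trans_le hr
  have ha' : 0 < -(a + 1) := by linarith
  have hnonneg : 0 ≤ C / (-(a + 1)) * r ^ (a + 1) := by positivity
  have hsub := hw.norm_space_sub_le_rpow le_rfl (by linarith) hc hρ hr
  rw [div_neg] at hnonneg ⊢
  linarith

-- The space bounds give a limit at each time, and the time bounds identify these limits.
theorem NullLip.exists_limit (hw : NullLip w 0 fun y => C * y ^ a) (hC : 0 ≤ C) (ha : a < -1)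
    (hc : ∀ t, Continuous (w t)) (hct : ∀ r > 0, Continuous fun t => w t r) :
    ∃ A : ℂ, ∀ t, ∀ r > 0, ‖w t r - A‖ ≤ C / (-(a + 1)) * r ^ (a + 1) := by
  choose A hA hbound using fun t => exists_tendsto_atTop_of_norm_sub_le
    (tendsto_const_mul_rpow_atTop (C / (-(a + 1))) (by linarith : a + 1 < 0))
    fun ρ hρ r hr => hw.norm_space_sub_le_of_lt_neg_one hC ha (hc t) hρ hr
  have hA_eq : ∀ {t t' : ℝ}, t ≤ t' → A t' = A t := fun {t t'} ht => sub_eq_zero.1 <|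
    tendsto_nhds_unique ((hA t').sub (hA t)) (hw.tendsto_time_sub (by linarith) hct ht)
  have hA_const : ∀ t, A t = A 0 := fun t =>
    (le_total 0 t).elim (fun ht => hA_eq ht) fun ht => (hA_eq ht).symm
  exact ⟨A 0, fun t r hr => hA_const t ▸ hbound t r hr⟩

theorem NullLip.norm_space_sub_le_div (hw : NullLip w 0 fun y => C * y ^ (-1 : ℝ)) (hC : 0 ≤ C)
    {t : ℝ} (hc : Continuous (w t)) {ρ r : ℝ} (hρ : 0 < ρ) (hr : ρ ≤ r) :
    ‖w t r - w t ρ‖ ≤ C * ((r - ρ) / ρ) := by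
  have hr0 : 0 < r := hρ.trans_le hr
  have hderiv : ∀ x ∈ Ioi (0 : ℝ), HasDerivAt (fun y => C * Real.log y) (C * x ^ (-1 : ℝ)) x :=
    fun x hx => by
      rw [Real.rpow_neg_one]
      exact (Real.hasDerivAt_log (ne_of_gt hx)).const_mul C
  calc ‖w t r - w t ρ‖
      ≤ C * Real.log r - C * Real.log ρ :=
        hw.norm_space_sub_le (continuousOn_const_mul_rpow C _) hderiv hc hρ hr
    _ = C * Real.log (r / ρ) := by rw [Real.log_div hr0.ne' hρ.ne', mul_sub]
    _ ≤ C * (r / ρ - 1) := by gcongr; exact Real.log_le_sub_one_of_pos (by positivity)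
    _ = C * ((r - ρ) / ρ) := by field_simp

end limit

/-! ### Weak gradients of locally Lipschitz functions -/

theorem locallyIntegrableOn_of_norm_le_div_pow {X E : Type*} [NormedAddCommGroup X]
    [MeasurableSpace X] [BorelSpace X] {μ : Measure X} [IsLocallyFiniteMeasure μ]
    [NormedAddCommGroup E] {f : X → E} {C : ℝ} {k : ℕ} (hf : AEStronglyMeasurable f μ)
    (hle : ∀ᵐ x ∂μ, ‖f x‖ ≤ C / ‖x‖ ^ k) : LocallyIntegrableOn f {0}ᶜ μ := by
  have hc : ContinuousOn (fun x : X => C / ‖x‖ ^ k) {0}ᶜ :=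
    continuousOn_const.div (by fun_prop) fun _ hx => pow_ne_zero k (norm_ne_zero_iff.2 hx)
  refine (hc.locallyIntegrableOn (measurableSet_singleton _).compl).mono hf ?_
  filter_upwards [hle] with x hx using hx.trans (Real.le_norm_self _)

theorem exists_pos_forall_lt_norm {X : Type*} [NormedAddCommGroup X] {K : Set X}
    (hK : IsCompact K) (h0 : K ⊆ {0}ᶜ) : ∃ a > 0, ∀ x ∈ K, a < ‖x‖ := by
  rcases K.eq_empty_or_nonempty with rfl | hne
  · exact ⟨1, one_pos, by simp⟩
  obtain ⟨x, hx, hmin⟩ := hK.exists_isMinOn hne continuous_norm.continuousOn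
  obtain ⟨a, ha, hax⟩ := exists_between (norm_pos_iff.2 (h0 hx))
  exact ⟨a, ha, fun y hy => hax.trans_le (isMinOn_iff.1 hmin y hy)⟩

theorem setOf_le_norm_mem_nhds {X : Type*} [SeminormedAddCommGroup X] {a : ℝ} {x : X}
    (hx : a < ‖x‖) : {y : X | a ≤ ‖y‖} ∈ 𝓝 x :=
  (continuous_norm.continuousAt.eventually_const_lt hx).mono fun _ => le_of_lt

theorem norm_gradient_eq_norm_fderiv {X : Type*} [NormedAddCommGroup X] [InnerProductSpace ℝ X]
    [CompleteSpace X] (v : X → ℝ) (x : X) : ‖gradient v x‖ = ‖fderiv ℝ v x‖ := by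
  rw [← toDual_gradient, LinearIsometryEquiv.norm_map]

theorem norm_fderiv_le_of_lipschitzOnWith {X : Type*} [NormedAddCommGroup X] [NormedSpace ℝ X]
    {v : X → ℝ} {L : NNReal} {s : Set X} (hv : LipschitzOnWith L v s) {x : X} (hs : s ∈ 𝓝 x) :
    ‖fderiv ℝ v x‖ ≤ L := by
  refine norm_fderiv_le_of_lip' ℝ L.coe_nonneg ?_
  filter_upwards [hs] with y hy
  simpa only [dist_eq_norm] using hv.dist_le_mul y hy x (mem_of_mem_nhds hs)

-- `v` is replaced by a globally Lipschitz extension `v'`, which has the same derivatives on the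
-- support of `φ`.
theorem integral_mul_fderiv_of_lipschitzOnWith {X : Type*} [NormedAddCommGroup X]
    [NormedSpace ℝ X] [FiniteDimensional ℝ X] [MeasurableSpace X] [BorelSpace X] {μ : Measure X}
    [μ.IsAddHaarMeasure] {v φ : X → ℝ} {L : NNReal} {s : Set X} (hv : LipschitzOnWith L v s)
    (hφ : ContDiff ℝ 1 φ) (hφc : HasCompactSupport φ) (hφs : tsupport φ ⊆ interior s) (e : X) :
    ∫ x, v x * fderiv ℝ φ x e ∂μ = -∫ x, fderiv ℝ v x e * φ x ∂μ := by
  obtain ⟨v', hv', hvv'⟩ := hv.extend_real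
  obtain ⟨D, hD⟩ := hφ.lipschitzWith_of_hasCompactSupport hφc one_ne_zero
  have hparts := hv'.integral_lineDeriv_mul_eq (μ := μ) hD hφc e
  have hleft : ∀ᵐ x ∂μ, lineDeriv ℝ v' x e * φ x = fderiv ℝ v x e * φ x := by
    filter_upwards [hv'.ae_differentiableAt] with x hx
    by_cases hxs : x ∈ tsupport φ
    · have hloc : v' =ᶠ[𝓝 x] v :=
        hvv'.symm.eventuallyEq_of_mem (mem_interior_iff_mem_nhds.1 (hφs hxs))
      rw [hx.lineDeriv_eq_fderiv, hloc.fderiv_eq]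
    · rw [image_eq_zero_of_notMem_tsupport hxs, mul_zero, mul_zero]
  have hright : ∀ x, lineDeriv ℝ φ x (-e) * v' x = -(v x * fderiv ℝ φ x e) := fun x => by
    rw [((hφ.differentiable one_ne_zero) x).lineDeriv_eq_fderiv, map_neg]
    by_cases hxs : x ∈ tsupport φ
    · rw [← hvv' (interior_subset (hφs hxs))]
      ring
    · rw [image_eq_zero_of_notMem_tsupport fun h => hxs (tsupport_fderiv_subset ℝ h)]
      simp
  rw [← integral_congr_ae hleft, hparts, ← integral_neg]
  simp only [hright, neg_neg]

theorem norm_gradient_le_of_lipschitzOnWith {X : Type*} [NormedAddCommGroup X]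
    [InnerProductSpace ℝ X] [CompleteSpace X] {v : X → ℝ} {C : ℝ} (hC : 0 ≤ C)
    (hv : ∀ a > 0, LipschitzOnWith (C / a ^ 2).toNNReal v {x | a ≤ ‖x‖}) {x : X} (hx : x ≠ 0) :
    ‖gradient v x‖ ≤ 4 * C / ‖x‖ ^ 2 := by
  have hn := norm_pos_iff.2 hx
  have hfderiv := norm_fderiv_le_of_lipschitzOnWith (hv (‖x‖ / 2) (by positivity))
    (setOf_le_norm_mem_nhds (half_lt_self hn))
  rw [Real.coe_toNNReal _ (by positivity), ← norm_gradient_eq_norm_fderiv] at hfderiv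
  exact hfderiv.trans_eq (by field_simp; ring)

theorem isWeakGradientOn_gradient {v : E3 → ℝ} {C : ℝ} (hC : 0 ≤ C)
    (hv : ∀ a > 0, LipschitzOnWith (C / a ^ 2).toNNReal v {x | a ≤ ‖x‖}) :
    IsWeakGradientOn {0}ᶜ v (gradient v) := by
  refine ⟨?_, ?_, fun φ hφ hφc hφs e => ?_⟩
  · refine ContinuousOn.locallyIntegrableOn (fun x hx => ?_) (measurableSet_singleton _).compl
    have hn : 0 < ‖x‖ := norm_pos_iff.2 hx
    exact ((hv (‖x‖ / 2) (by positivity)).continuousOn.continuousAt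
      (setOf_le_norm_mem_nhds (half_lt_self hn))).continuousWithinAt
  · have hmeas : Measurable (gradient v) :=
      (InnerProductSpace.toDual ℝ E3).symm.continuous.measurable.comp (measurable_fderiv ℝ v)
    refine locallyIntegrableOn_of_norm_le_div_pow (C := 4 * C) (k := 2)
      hmeas.aestronglyMeasurable ?_
    filter_upwards [Measure.ae_ne volume (0 : E3)] with x hx
    exact norm_gradient_le_of_lipschitzOnWith hC hv hx
  · obtain ⟨a, ha, hlt⟩ := exists_pos_forall_lt_norm hφc hφs
    simp only [inner_gradient_left]
    exact integral_mul_fderiv_of_lipschitzOnWith (hv a ha) (hφ.of_le (by simp)) hφc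
      (fun x hx => mem_interior_iff_mem_nhds.2 (setOf_le_norm_mem_nhds (hlt x hx))) e

theorem IsWeakGradientOn.congr_ae {Ω : Set E3} {f g : E3 → ℝ} {G : E3 → E3}
    (h : IsWeakGradientOn Ω f G) (hfg : f =ᵐ[volume] g) : IsWeakGradientOn Ω g G := by
  refine ⟨fun x hx => ?_, h.2.1, fun φ hφ hφc hφs e => ?_⟩
  · obtain ⟨s, hs, hi⟩ := h.1 x hx
    exact ⟨s, hs, hi.congr (ae_restrict_of_ae hfg)⟩
  · rw [← h.2.2 φ hφ hφc hφs e]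
    refine integral_congr_ae ?_
    filter_upwards [hfg] with x hx
    rw [hx]

theorem sq_le_sq_of_abs_le_div_norm_sq {x : E3} {y C r : ℝ} (hr : 0 < r) (hx : r < ‖x‖)
    (hy : |y| ≤ C / ‖x‖ ^ 2) : y ^ 2 ≤ C ^ 2 / r ^ 4 :=
  calc y ^ 2 ≤ (C / ‖x‖ ^ 2) ^ 2 := sq_le_sq' (neg_le_of_abs_le hy) (le_of_abs_le hy)
    _ = C ^ 2 / ‖x‖ ^ 4 := by ring
    _ ≤ C ^ 2 / r ^ 4 := by gcongr

theorem localEnergy_le {G : E3 → E3} {v : E3 → ℝ} {C : ℝ}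
    (hG : ∀ᵐ x, ‖G x‖ ≤ C / ‖x‖ ^ 2) (hv : ∀ᵐ x, |v x| ≤ C / ‖x‖ ^ 2) {r : ℝ} (hr : 0 < r) :
    localEnergy r G v ≤ ENNReal.ofReal (512 * π / 3 * C ^ 2 * r⁻¹) := by
  have hshell : MeasurableSet {x : E3 | r < ‖x‖ ∧ ‖x‖ < 4 * r} :=
    (measurableSet_lt measurable_const measurable_norm).inter
      (measurableSet_lt measurable_norm measurable_const)
  calc localEnergy r G v
      ≤ ∫⁻ _ in {x : E3 | r < ‖x‖ ∧ ‖x‖ < 4 * r}, ENNReal.ofReal (2 * (C ^ 2 / r ^ 4)) := by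
        refine setLIntegral_mono_ae' hshell ?_
        filter_upwards [hG, hv] with x hGx hvx hx
        rw [two_mul]
        exact ENNReal.ofReal_le_ofReal (add_le_add
          (sq_le_sq_of_abs_le_div_norm_sq hr hx.1 (by rwa [abs_norm]))
          (sq_le_sq_of_abs_le_div_norm_sq hr hx.1 hvx))
    _ ≤ ENNReal.ofReal (2 * (C ^ 2 / r ^ 4)) * volume (Metric.ball (0 : E3) (4 * r)) := by
        rw [setLIntegral_const]
        gcongr
        exact fun x hx => mem_ball_zero_iff.2 hx.2
    _ = ENNReal.ofReal (512 * π / 3 * C ^ 2 * r⁻¹) := by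
        rw [EuclideanSpace.volume_ball_fin_three, ← ENNReal.ofReal_pow (by positivity),
          ← ENNReal.ofReal_mul (by positivity), ← ENNReal.ofReal_mul (by positivity)]
        congr 1
        field_simp
        ring

/-! ### Weak limits of dominated functions -/

section weakLimit

variable {ι α : Type*} [MeasurableSpace α] {μ : Measure α}

theorem exists_tendsto_inner_of_norm_le {H : Type*} [NormedAddCommGroup H] [InnerProductSpace ℝ H]
    [CompleteSpace H] {f : ι → H} {R : ℝ} (hf : ∀ i, ‖f i‖ ≤ R) (l : Ultrafilter ι) :
    ∃ g : H, ∀ k, Tendsto (fun i => inner ℝ (f i) k) l (𝓝 (inner ℝ g k)) := by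
  let Λ : ι → WeakDual ℝ H := fun i => StrongDual.toWeakDual (InnerProductSpace.toDual ℝ H (f i))
  have hball : ∀ i, Λ i ∈ WeakDual.toStrongDual ⁻¹' Metric.closedBall (0 : StrongDual ℝ H) R :=
    fun i => mem_closedBall_zero_iff.2
      (((InnerProductSpace.toDual ℝ H).norm_map (f i)).trans_le (hf i))
  obtain ⟨ℓ, -, hℓ⟩ := (WeakDual.isCompact_closedBall (𝕜 := ℝ) (E := H) 0 R).ultrafilter_le_nhds
    (l.map Λ) (le_principal_iff.2 (Filter.mem_map.2 (Filter.univ_mem' hball)))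
  refine ⟨(InnerProductSpace.toDual ℝ H).symm (WeakDual.toStrongDual ℓ), fun k => ?_⟩
  rw [InnerProductSpace.toDual_symm_apply]
  exact ((WeakDual.eval_continuous k).tendsto ℓ).comp hℓ

theorem nonneg_of_forall_inner_nonneg {g : Lp ℝ 2 μ}
    (hg : ∀ k : Lp ℝ 2 μ, 0 ≤ k → 0 ≤ inner ℝ k g) : 0 ≤ g := by
  rw [← Lp.coeFn_nonneg]
  refine (Lp.finStronglyMeasurable g two_ne_zero ENNReal.ofNat_ne_top).aefinStronglyMeasurable
    |>.ae_nonneg_of_forall_setIntegral_nonneg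
      (fun s _ hμs => integrableOn_Lp_of_measure_ne_top g one_le_two hμs.ne) fun s hs hμs => ?_
  rw [← L2.inner_indicatorConstLp_one (𝕜 := ℝ) hs hμs.ne]
  refine hg _ ((Lp.coeFn_nonneg _).1 ?_)
  filter_upwards [indicatorConstLp_coeFn (p := 2) (hs := hs) (hμs := hμs.ne) (c := (1 : ℝ))]
    with x hx
  exact hx ▸ indicator_nonneg (fun _ _ => zero_le_one) x

theorem inner_nonneg_of_nonneg {g k : Lp ℝ 2 μ} (hg : 0 ≤ g) (hk : 0 ≤ k) : 0 ≤ inner ℝ g k := by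
  rw [L2.inner_def]
  refine integral_nonneg_of_ae ?_
  filter_upwards [(Lp.coeFn_nonneg g).2 hg, (Lp.coeFn_nonneg k).2 hk] with x hgx hkx
  exact mul_nonneg hkx hgx

theorem le_of_tendsto_inner {l : Filter ι} [l.NeBot] {f : ι → Lp ℝ 2 μ} {g B : Lp ℝ 2 μ}
    (hf : ∀ k, Tendsto (fun i => inner ℝ (f i) k) l (𝓝 (inner ℝ g k))) (hle : ∀ i, f i ≤ B) :
    g ≤ B := by
  refine sub_nonneg.1 (nonneg_of_forall_inner_nonneg fun k hk => ?_)
  rw [real_inner_comm, inner_sub_left, sub_nonneg]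
  refine le_of_tendsto' (hf k) fun i => ?_
  rw [← sub_nonneg, ← inner_sub_left]
  exact inner_nonneg_of_nonneg (sub_nonneg.2 (hle i)) hk

theorem abs_le_of_tendsto_inner {l : Filter ι} [l.NeBot] {f : ι → Lp ℝ 2 μ} {g B : Lp ℝ 2 μ}
    (hf : ∀ k, Tendsto (fun i => inner ℝ (f i) k) l (𝓝 (inner ℝ g k))) (hle : ∀ i, |f i| ≤ B) :
    |g| ≤ B := by
  refine abs_le'.2 ⟨le_of_tendsto_inner hf fun i => (le_abs_self _).trans (hle i),
    le_of_tendsto_inner (l := l) (f := fun i => -f i) (fun k => ?_)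
      fun i => (neg_le_abs _).trans (hle i)⟩
  simpa only [inner_neg_left] using (hf k).neg

theorem exists_tendsto_inner_of_abs_le {f : ι → Lp ℝ 2 μ} {B : Lp ℝ 2 μ} (hf : ∀ i, |f i| ≤ B)
    (l : Ultrafilter ι) :
    ∃ g, |g| ≤ B ∧ ∀ k, Tendsto (fun i => inner ℝ (f i) k) l (𝓝 (inner ℝ g k)) := by
  obtain ⟨g, hg⟩ := exists_tendsto_inner_of_norm_le
    (fun i => norm_le_norm_of_abs_le_abs ((hf i).trans (le_abs_self B))) l
  exact ⟨g, abs_le_of_tendsto_inner hg hf, hg⟩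

theorem exists_weak_limit_of_abs_le {f : ι → α → ℝ} {b : α → ℝ} (hb : MemLp b 2 μ)
    (hf : ∀ i, AEStronglyMeasurable (f i) μ) (hle : ∀ i, ∀ᵐ x ∂μ, |f i x| ≤ b x)
    (l : Ultrafilter ι) :
    ∃ g : α → ℝ, AEStronglyMeasurable g μ ∧ (∀ᵐ x ∂μ, |g x| ≤ b x) ∧ ∀ ψ, MemLp ψ 2 μ →
      Tendsto (fun i => ∫ x, f i x * ψ x ∂μ) l (𝓝 (∫ x, g x * ψ x ∂μ)) := by
  have hf₂ : ∀ i, MemLp (f i) 2 μ := fun i => hb.mono (hf i) <|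
    (hle i).mono fun _ hx => hx.trans (Real.le_norm_self _)
  have hinner : ∀ {h₁ h₂ : α → ℝ} (i₁ : MemLp h₁ 2 μ) (i₂ : MemLp h₂ 2 μ),
      inner ℝ i₁.toLp i₂.toLp = ∫ x, h₁ x * h₂ x ∂μ := fun i₁ i₂ => by
    rw [L2.inner_def]
    refine integral_congr_ae ?_
    filter_upwards [i₁.coeFn_toLp, i₂.coeFn_toLp] with x hx₁ hx₂
    rw [hx₁, hx₂, RCLike.inner_apply, conj_trivial, mul_comm]
  obtain ⟨g, hgb, hg⟩ := exists_tendsto_inner_of_abs_le (f := fun i => (hf₂ i).toLp)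
    (B := hb.toLp) (l := l) fun i => by
      rw [← Lp.coeFn_le]
      filter_upwards [Lp.coeFn_abs (hf₂ i).toLp, (hf₂ i).coeFn_toLp, hb.coeFn_toLp, hle i]
        with x habs hfx hbx hx
      rwa [habs, hfx, hbx]
  refine ⟨g, Lp.aestronglyMeasurable g, ?_, fun ψ hψ => ?_⟩
  · rw [← Lp.coeFn_le] at hgb
    filter_upwards [hgb, Lp.coeFn_abs g, hb.coeFn_toLp] with x hx habs hbx
    rwa [habs, hbx] at hx
  · have hgψ := hg hψ.toLp
    rw [← Lp.toLp_coeFn g (Lp.memLp g)] at hgψ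
    simpa only [hinner] using hgψ

theorem exists_weak_limit_of_abs_le_div {f : ι → α → ℝ} {b θ : α → ℝ} (hb : MemLp b 2 μ)
    (hθ : AEStronglyMeasurable θ μ) (hθ0 : ∀ᵐ x ∂μ, 0 < θ x)
    (hf : ∀ i, AEStronglyMeasurable (f i) μ) (hle : ∀ i, ∀ᵐ x ∂μ, |f i x| ≤ b x / θ x)
    (l : Ultrafilter ι) :
    ∃ g : α → ℝ, AEStronglyMeasurable g μ ∧ (∀ᵐ x ∂μ, |g x| ≤ b x / θ x) ∧
      ∀ ψ : α → ℝ, MemLp (fun x => ψ x / θ x) 2 μ →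
        Tendsto (fun i => ∫ x, f i x * ψ x ∂μ) l (𝓝 (∫ x, g x * ψ x ∂μ)) := by
  obtain ⟨g, hgm, hgb, hg⟩ := exists_weak_limit_of_abs_le (f := fun i x => f i x * θ x) hb
    (fun i => (hf i).mul hθ) (fun i => by
      filter_upwards [hle i, hθ0] with x hx hpos
      rwa [abs_mul, abs_of_pos hpos, ← le_div_iff₀ hpos]) l
  refine ⟨fun x => g x / θ x, (hgm.aemeasurable.div hθ.aemeasurable).aestronglyMeasurable, ?_,
    fun ψ hψ => ?_⟩
  · filter_upwards [hgb, hθ0] with x hx hpos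
    rw [abs_div, abs_of_pos hpos]
    gcongr
  · have hcancel : ∀ i, ∫ x, f i x * θ x * (ψ x / θ x) ∂μ = ∫ x, f i x * ψ x ∂μ := fun i => by
      refine integral_congr_ae ?_
      filter_upwards [hθ0] with x hpos
      field_simp
    have hlim := hg _ hψ
    simp only [hcancel] at hlim
    simpa only [mul_div_assoc', div_mul_eq_mul_div] using hlim

end weakLimit

theorem memLp_div_one_add_norm_sq (C : ℝ) : MemLp (fun x : E3 => C / (1 + ‖x‖ ^ 2)) 2 := by
  have hc : Continuous fun x : E3 => C / (1 + ‖x‖ ^ 2) :=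
    continuous_const.div (by fun_prop) fun x => by positivity
  have hdim : (Module.finrank ℝ E3 : ℝ) < 4 := by
    rw [finrank_euclideanSpace_fin]
    norm_num
  refine (memLp_two_iff_integrable_sq hc.aestronglyMeasurable).2
    (((integrable_rpow_neg_one_add_norm_sq (μ := volume) hdim).const_mul (C ^ 2)).congr
      (Eventually.of_forall fun x => ?_))
  have hx : 0 < 1 + ‖x‖ ^ 2 := by positivity
  simp only [show (-4 / 2 : ℝ) = -(2 : ℕ) by norm_num, Real.rpow_neg hx.le, Real.rpow_natCast,
    div_eq_mul_inv, mul_pow, inv_pow]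

-- `C / ‖x‖ ^ 2` is not square integrable near the origin, hence the weight
-- `‖x‖ ^ 2 / (1 + ‖x‖ ^ 2)`.
theorem exists_weak_limit_of_abs_le_div_norm_sq {ι : Type*} {f : ι → E3 → ℝ} {C : ℝ}
    (hf : ∀ i, AEStronglyMeasurable (f i)) (hle : ∀ i, ∀ᵐ x, |f i x| ≤ C / ‖x‖ ^ 2)
    (l : Ultrafilter ι) :
    ∃ g : E3 → ℝ, AEStronglyMeasurable g ∧ (∀ᵐ x, |g x| ≤ C / ‖x‖ ^ 2) ∧
      ∀ ψ : E3 → ℝ, Continuous ψ → HasCompactSupport ψ → tsupport ψ ⊆ {0}ᶜ →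
        Tendsto (fun i => ∫ x, f i x * ψ x) l (𝓝 (∫ x, g x * ψ x)) := by
  let θ : E3 → ℝ := fun x => ‖x‖ ^ 2 / (1 + ‖x‖ ^ 2)
  have hθ : Continuous θ := Continuous.div (by fun_prop) (by fun_prop) fun x => by positivity
  have hθ0 : ∀ x ≠ 0, 0 < θ x := fun x hx => by
    have := norm_pos_iff.2 hx
    positivity
  have hratio : ∀ x : E3, C / (1 + ‖x‖ ^ 2) / θ x = C / ‖x‖ ^ 2 := fun x =>
    div_div_div_cancel_right₀ (by positivity) C (‖x‖ ^ 2)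
  obtain ⟨g, hgm, hgb, hg⟩ := exists_weak_limit_of_abs_le_div (memLp_div_one_add_norm_sq C)
    hθ.aestronglyMeasurable ((Measure.ae_ne volume 0).mono hθ0) hf
    (by simpa only [hratio] using hle) l
  refine ⟨g, hgm, by simpa only [hratio] using hgb, fun ψ hψ hψc hψs => hg ψ ?_⟩
  have hsupp : Function.support (fun x => ψ x / θ x) ⊆ Function.support ψ := fun x hx h =>
    hx (by simp only [h, zero_div])
  have hcont : Continuous fun x => ψ x / θ x := continuous_of_tsupport fun x hx =>
    hψ.continuousAt.div hθ.continuousAt (hθ0 x (hψs (closure_mono hsupp hx))).ne'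
  exact hcont.memLp_of_hasCompactSupport (hψc.mono hsupp)

theorem integrable_ofReal_mul_of_abs_le_div_norm_sq {f : E3 → ℝ} {C : ℝ}
    (hf : AEStronglyMeasurable f) (hle : ∀ᵐ x, |f x| ≤ C / ‖x‖ ^ 2) {φ : E3 → ℂ}
    (hφ : Continuous φ) (hφc : HasCompactSupport φ) (hφs : tsupport φ ⊆ {0}ᶜ) :
    Integrable fun x => (f x : ℂ) * φ x := by
  have hloc : LocallyIntegrableOn (fun x => (f x : ℂ)) {0}ᶜ :=
    locallyIntegrableOn_of_norm_le_div_pow (Complex.continuous_ofReal.comp_aestronglyMeasurable hf)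
      (by simpa only [Complex.norm_real, Real.norm_eq_abs] using hle)
  refine (integrableOn_iff_integrable_of_support_subset fun x hx => ?_).1
    ((hloc.integrableOn_compact_subset hφs hφc).mul_continuousOn hφ.continuousOn hφc)
  exact subset_tsupport φ (right_ne_zero_of_mul hx)

theorem integral_ofReal_mul_eq {α : Type*} [MeasurableSpace α] {μ : Measure α} {f : α → ℝ}
    {φ : α → ℂ} (h : Integrable (fun x => (f x : ℂ) * φ x) μ) :
    ∫ x, (f x : ℂ) * φ x ∂μ
      = ((∫ x, f x * (φ x).re ∂μ : ℝ) : ℂ) + ((∫ x, f x * (φ x).im ∂μ : ℝ) : ℂ) * Complex.I := by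
  rw [← integral_re_add_im h]
  simp

theorem Hdot.exists_isFunctionOn {ι : Type*} {L : Filter ι} [L.NeBot] {σ : ℝ} {G : Hdot σ}
    {f : ι → E3 → ℝ} {C : ℝ} (hf : ∀ i, AEStronglyMeasurable (f i))
    (hle : ∀ i, ∀ᵐ x, |f i x| ≤ C / ‖x‖ ^ 2)
    (hlim : ∀ φ : 𝓢(E3, ℂ), Tendsto (fun i => ∫ x, (f i x : ℂ) * φ x) L (𝓝 (G.pair φ))) :
    ∃ g : E3 → ℝ, G.IsFunctionOn {0}ᶜ g ∧ ∀ᵐ x, |g x| ≤ C / ‖x‖ ^ 2 := by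
  obtain ⟨g, hgm, hgb, hg⟩ := exists_weak_limit_of_abs_le_div_norm_sq hf hle (Ultrafilter.of L)
  refine ⟨g, ⟨locallyIntegrableOn_of_norm_le_div_pow hgm hgb, fun φ hφc hφs => ?_⟩, hgb⟩
  have hsplit : ∀ {k : E3 → ℝ}, AEStronglyMeasurable k → (∀ᵐ x, |k x| ≤ C / ‖x‖ ^ 2) →
      ∫ x, (k x : ℂ) * φ x
        = ((∫ x, k x * (φ x).re : ℝ) : ℂ) + ((∫ x, k x * (φ x).im : ℝ) : ℂ) * Complex.I :=
    fun hk hkle => integral_ofReal_mul_eq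
      (integrable_ofReal_mul_of_abs_le_div_norm_sq hk hkle φ.continuous hφc hφs)
  have hpart : ∀ P : ℂ → ℝ, Continuous P → P 0 = 0 →
      Tendsto (fun i => ((∫ x, f i x * P (φ x) : ℝ) : ℂ)) (Ultrafilter.of L)
        (𝓝 ((∫ x, g x * P (φ x) : ℝ) : ℂ)) := fun P hP hP0 =>
    (Complex.continuous_ofReal.tendsto _).comp (hg (fun x => P (φ x)) (hP.comp φ.continuous)
      (hφc.comp_left hP0) ((tsupport_comp_subset hP0 φ).trans hφs))
  have hweak := (hpart Complex.re Complex.continuous_re Complex.zero_re).add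
    ((hpart Complex.im Complex.continuous_im Complex.zero_im).mul_const Complex.I)
  rw [hsplit hgm hgb]
  refine tendsto_nhds_unique hweak (((hlim φ).mono_left (Ultrafilter.of_le L)).congr fun i => ?_)
  exact hsplit (hf i) (hle i)

/-! ### Derivatives of solutions -/

theorem lipschitzOnWith_of_forall_le {f : ℝ → ℝ} {L : ℝ} {s : Set ℝ} (hL : 0 ≤ L)
    (hf : ∀ ρ ∈ s, ∀ r ∈ s, ρ ≤ r → |f r - f ρ| ≤ L * (r - ρ)) :
    LipschitzOnWith L.toNNReal f s := by
  refine LipschitzOnWith.of_dist_le_mul fun x hx y hy => ?_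
  rw [Real.coe_toNNReal _ hL, Real.dist_eq, Real.dist_eq]
  rcases le_total y x with h | h
  · rw [abs_of_nonneg (sub_nonneg.2 h)]
    exact hf y hy x hx h
  · rw [abs_sub_comm, abs_sub_comm x, abs_of_nonneg (sub_nonneg.2 h)]
    exact hf x hx y hy h

theorem abs_div_sub_div_le {C a ρ r y z : ℝ} (ha : 0 < a) (hρ : a ≤ ρ) (hr : ρ ≤ r)
    (hy : |y| ≤ C) (hzy : |z - y| ≤ C * ((r - ρ) / ρ)) :
    |z / r - y / ρ| ≤ 2 * C / a ^ 2 * (r - ρ) := by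
  have hρ0 : 0 < ρ := ha.trans_le hρ
  have hr0 : 0 < r := hρ0.trans_le hr
  have hC : 0 ≤ C := (abs_nonneg y).trans hy
  have : 0 ≤ r - ρ := sub_nonneg.2 hr
  have hsplit : z / r - y / ρ = (z - y) / r - y * ((r - ρ) / (ρ * r)) := by
    field_simp
    ring
  calc |z / r - y / ρ|
      ≤ |(z - y) / r| + |y * ((r - ρ) / (ρ * r))| := hsplit ▸ abs_sub _ _
    _ = |z - y| / r + |y| * ((r - ρ) / (ρ * r)) := by
        rw [abs_div, abs_mul, abs_of_pos hr0,
          abs_of_nonneg (a := (r - ρ) / (ρ * r)) (by positivity)]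
    _ ≤ C * ((r - ρ) / ρ) / r + C * ((r - ρ) / (ρ * r)) := by gcongr
    _ = 2 * C * ((r - ρ) / (ρ * r)) := by field_simp; ring
    _ ≤ 2 * C * ((r - ρ) / (a * a)) := by gcongr; exact hρ.trans hr
    _ = 2 * C / a ^ 2 * (r - ρ) := by ring

theorem lipschitzOnWith_re_div_norm {X : Type*} [SeminormedAddCommGroup X] {w : ℝ → ℂ} {C : ℝ}
    (hC : 0 ≤ C) (hw : ∀ r > 0, ‖w r‖ ≤ C)
    (hlip : ∀ ρ r, 0 < ρ → ρ ≤ r → ‖w r - w ρ‖ ≤ C * ((r - ρ) / ρ)) {a : ℝ} (ha : 0 < a) :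
    LipschitzOnWith (2 * C / a ^ 2).toNNReal (fun x : X => (w ‖x‖).re / ‖x‖) {x | a ≤ ‖x‖} := by
  have hprofile : LipschitzOnWith (2 * C / a ^ 2).toNNReal (fun r => (w r).re / r) (Ici a) :=
    lipschitzOnWith_of_forall_le (by positivity) fun ρ hρ r _ hr => by
      have hρ0 : 0 < ρ := ha.trans_le hρ
      refine abs_div_sub_div_le ha hρ hr ((Complex.abs_re_le_norm _).trans (hw ρ hρ0)) ?_
      rw [← Complex.sub_re]
      exact (Complex.abs_re_le_norm _).trans (hlip ρ r hρ0 hr)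
  have hcomp := hprofile.comp (lipschitzWith_one_norm.lipschitzOnWith (s := {x : X | a ≤ ‖x‖}))
    fun _ hx => hx
  rwa [mul_one] at hcomp

section solution

variable {p : ℝ} {F : ℝ → ℝ → ℝ → ℝ} {u : ℝ → E3 → ℝ} {U : ℝ → Hdot (sCrit p)}
  {V : ℝ → Hdot (sCrit p - 1)} {C : ℝ}

theorem IsGlobalSolution.ae_eq_re_profile (hu : IsGlobalSolution p F u U V) (hp₃ : 3 < p)
    (hrad : ∀ t, IsRadial (u t)) (t : ℝ) :
    u t =ᵐ[volume] fun x => ((U t).profile ‖x‖).re / ‖x‖ := by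
  filter_upwards [(hu.isFunction t).ae_eq_profile (half_lt_sCrit hp₃) (sCrit_lt (by linarith))
    (hrad t)] with x hx
  rw [← Complex.div_ofReal_re, ← hx, Complex.ofReal_re]

theorem IsGlobalSolution.ae_abs_le_div (hu : IsGlobalSolution p F u U V) (hp₃ : 3 < p)
    (hrad : ∀ t, IsRadial (u t)) {t : ℝ} (hw : ∀ r > 0, ‖(U t).profile r‖ ≤ C) :
    ∀ᵐ x, |u t x| ≤ C / ‖x‖ := by
  filter_upwards [hu.ae_eq_re_profile hp₃ hrad t, Measure.ae_ne volume (0 : E3)] with x hx hx0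
  have hn := norm_pos_iff.2 hx0
  rw [hx, abs_div, abs_norm]
  gcongr
  exact (Complex.abs_re_le_norm _).trans (hw _ hn)

theorem IsGlobalSolution.ae_abs_sub_div_le (hu : IsGlobalSolution p F u U V) (hp₃ : 3 < p)
    (hrad : ∀ t, IsRadial (u t)) {t b : ℝ} {A : ℂ}
    (hA : ∀ r > 0, ‖(U t).profile r - A‖ ≤ C * r ^ (b + 1)) :
    ∀ᵐ x, |u t x - A.re / ‖x‖| ≤ C * ‖x‖ ^ b := by
  filter_upwards [hu.ae_eq_re_profile hp₃ hrad t, Measure.ae_ne volume (0 : E3)] with x hx hx0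
  have hn := norm_pos_iff.2 hx0
  rw [hx, ← sub_div, ← Complex.sub_re, abs_div, abs_norm, div_le_iff₀ hn, mul_assoc,
    ← Real.rpow_add_one hn.ne']
  exact (Complex.abs_re_le_norm _).trans (hA _ hn)

theorem IsGlobalSolution.aestronglyMeasurable_slice (hu : IsGlobalSolution p F u U V)
    (hp₃ : 3 < p) (hrad : ∀ t, IsRadial (u t)) (t : ℝ) : AEStronglyMeasurable (u t) := by
  have hc := (U t).continuous_profile (half_lt_sCrit hp₃) (sCrit_lt (by linarith))
  have hmeas : Measurable fun x : E3 => ((U t).profile ‖x‖).re / ‖x‖ :=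
    (Complex.measurable_re.comp (hc.measurable.comp measurable_norm)).div measurable_norm
  exact hmeas.aestronglyMeasurable.congr (hu.ae_eq_re_profile hp₃ hrad t).symm

theorem IsGlobalSolution.exists_isWeakGradientOn (hu : IsGlobalSolution p F u U V) (hp₃ : 3 < p)
    (hrad : ∀ t, IsRadial (u t)) (hC : 0 ≤ C) {t : ℝ} (hw : ∀ r > 0, ‖(U t).profile r‖ ≤ C)
    (hlip : NullLip (fun t r => (U t).profile r) 0 (fun y => C * y ^ (-1 : ℝ))) :
    ∃ Du : E3 → E3, IsWeakGradientOn {0}ᶜ (u t) Du ∧ ∀ᵐ x, ‖Du x‖ ≤ 8 * C / ‖x‖ ^ 2 := by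
  have hc := (U t).continuous_profile (half_lt_sCrit hp₃) (sCrit_lt (by linarith))
  have hv : ∀ a > 0, LipschitzOnWith (2 * C / a ^ 2).toNNReal
      (fun x : E3 => ((U t).profile ‖x‖).re / ‖x‖) {x | a ≤ ‖x‖} := fun a ha =>
    lipschitzOnWith_re_div_norm hC hw
      (fun ρ r hρ hr => hlip.norm_space_sub_le_div hC hc hρ hr) ha
  refine ⟨_, (isWeakGradientOn_gradient (by positivity) hv).congr_ae
    (hu.ae_eq_re_profile hp₃ hrad t).symm, ?_⟩
  filter_upwards [Measure.ae_ne volume (0 : E3)] with x hx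
  exact (norm_gradient_le_of_lipschitzOnWith (by positivity) hv hx).trans_eq (by ring)

theorem IsGlobalSolution.ae_abs_slope_le (hu : IsGlobalSolution p F u U V) (hp₃ : 3 < p)
    (hrad : ∀ t, IsRadial (u t))
    (hlip : NullLip (fun t r => (U t).profile r) 0 (fun y => C * y ^ (-1 : ℝ))) (t : ℝ) {h : ℝ}
    (hh : 0 < h) : ∀ᵐ x, |h⁻¹ * (u (t + h) x - u t x)| ≤ C / ‖x‖ ^ 2 := by
  filter_upwards [hu.ae_eq_re_profile hp₃ hrad t, hu.ae_eq_re_profile hp₃ hrad (t + h),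
    Measure.ae_ne volume (0 : E3)] with x hxt hxth hx0
  have hn := norm_pos_iff.2 hx0
  have hsub : ‖(U (t + h)).profile ‖x‖ - (U t).profile ‖x‖‖ ≤ h * (C * ‖x‖ ^ (-1 : ℝ)) := by
    simpa only [add_sub_cancel_left] using hlip.norm_time_sub_le (continuousOn_const_mul_rpow C _)
      (Hdot.continuous_profile_comp (half_lt_sCrit hp₃) (sCrit_lt (by linarith))
        hu.continuous_fst ‖x‖) hn (le_add_of_nonneg_right (a := t) hh.le)
  rw [hxt, hxth, ← sub_div, ← Complex.sub_re, abs_mul, abs_div, abs_norm,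
    abs_of_pos (inv_pos.2 hh), inv_mul_le_iff₀ hh, div_le_iff₀ hn]
  refine ((Complex.abs_re_le_norm _).trans hsub).trans_eq ?_
  rw [Real.rpow_neg_one]
  field_simp

theorem IsGlobalSolution.integral_slope_mul (hu : IsGlobalSolution p F u U V) (t h : ℝ)
    (φ : 𝓢(E3, ℂ)) :
    ∫ x, ((h⁻¹ * (u (t + h) x - u t x) : ℝ) : ℂ) * φ x
      = h⁻¹ • ((U (t + h)).pair φ - (U t).pair φ) := by
  obtain ⟨hint_th, heq_th⟩ := hu.isFunction (t + h) φ
  obtain ⟨hint_t, heq_t⟩ := hu.isFunction t φ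
  rw [← heq_th, ← heq_t, ← integral_sub hint_th hint_t, Complex.real_smul, ← integral_const_mul]
  congr with x
  push_cast
  ring

theorem IsGlobalSolution.exists_isFunctionOn (hu : IsGlobalSolution p F u U V) (hp₃ : 3 < p)
    (hrad : ∀ t, IsRadial (u t))
    (hlip : NullLip (fun t r => (U t).profile r) 0 (fun y => C * y ^ (-1 : ℝ))) (t : ℝ) :
    ∃ ut : E3 → ℝ, (V t).IsFunctionOn {0}ᶜ ut ∧ ∀ᵐ x, |ut x| ≤ C / ‖x‖ ^ 2 := by
  have hpos : ∀ n : ℕ, 0 < 1 / ((n : ℝ) + 1) := fun n => Nat.one_div_pos_of_nat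
  refine Hdot.exists_isFunctionOn (L := atTop)
    (fun n => ((hu.aestronglyMeasurable_slice hp₃ hrad _).sub
      (hu.aestronglyMeasurable_slice hp₃ hrad t)).const_mul _)
    (fun n => hu.ae_abs_slope_le hp₃ hrad hlip t (hpos n)) fun φ => ?_
  have hstep : Tendsto (fun n : ℕ => 1 / ((n : ℝ) + 1)) atTop (𝓝[>] 0) :=
    tendsto_nhdsWithin_iff.2 ⟨tendsto_one_div_add_atTop_nhds_zero_nat, Eventually.of_forall hpos⟩
  exact ((hu.hasDerivAt φ t).tendsto_slope_zero_right.comp hstep).congr fun n =>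
    (hu.integral_slope_mul t _ φ).symm

theorem IsGlobalSolution.exists_localEnergy_le (hu : IsGlobalSolution p F u U V) (hp₃ : 3 < p)
    (hrad : ∀ t, IsRadial (u t)) (hC : 0 ≤ C) {t : ℝ} (hw : ∀ r > 0, ‖(U t).profile r‖ ≤ C)
    (hlip : NullLip (fun t r => (U t).profile r) 0 (fun y => C * y ^ (-1 : ℝ))) :
    ∃ (Du : E3 → E3) (ut : E3 → ℝ), IsWeakGradientOn {0}ᶜ (u t) Du ∧
      (V t).IsFunctionOn {0}ᶜ ut ∧
      ∀ r : ℝ, 0 < r → localEnergy r Du ut ≤ ENNReal.ofReal (512 * π / 3 * (8 * C) ^ 2 * r⁻¹) := by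
  obtain ⟨Du, hDu, hDu_le⟩ := hu.exists_isWeakGradientOn hp₃ hrad hC hw hlip
  obtain ⟨ut, hut, hut_le⟩ := hu.exists_isFunctionOn hp₃ hrad hlip t
  refine ⟨Du, ut, hDu, hut, fun r hr => localEnergy_le hDu_le ?_ hr⟩
  filter_upwards [hut_le] with x hx
  refine hx.trans ?_
  gcongr
  linarith

end solution

end RadialWave

end

open RadialWave in
theorem mainTheorem3_general (p : ℝ) (hp₃ : 3 < p)
    (F : ℝ → ℝ → ℝ → ℝ)
    (hF : ∀ r : ℝ, 0 ≤ r → ∀ v t : ℝ, |F r v t| ≤ |v| ^ p)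
    (u : ℝ → E3 → ℝ) (U : ℝ → Hdot (sCrit p)) (V : ℝ → Hdot (sCrit p - 1))
    (hu : IsGlobalSolution p F u U V)
    (hrad : ∀ t, IsRadial (u t))
    (hcpt : IsCompact (closure (Set.range fun t : ℝ => (U t, V t)))) :
    ∃ A C C₃ C₄ : ℝ, 0 < C ∧ 0 < C₃ ∧ 0 < C₄ ∧
      (∀ t : ℝ, ∀ᵐ x : E3, |u t x| ≤ C₃ / ‖x‖) ∧
      (∀ t : ℝ, ∀ᵐ x : E3, |u t x - A / ‖x‖| ≤ C * ‖x‖ ^ (2 - p)) ∧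
      (∀ t : ℝ, ∃ (Du : E3 → E3) (ut : E3 → ℝ),
        IsWeakGradientOn {0}ᶜ (u t) Du ∧ (V t).IsFunctionOn {0}ᶜ ut ∧
        ∀ r : ℝ, 0 < r → localEnergy r Du ut ≤ ENNReal.ofReal (C₄ * r⁻¹)) := by
  have hs := half_lt_sCrit hp₃
  have hs' := sCrit_lt (by linarith : 1 < p)
  obtain ⟨C, hC, hw, hlip_decay, hlip_energy⟩ := hu.exists_profile_bounds hp₃ hF hrad hcpt
  obtain ⟨A, hA⟩ := hlip_decay.exists_limit hC.le (by linarith : 2 - p < -1)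
    (fun t => (U t).continuous_profile hs hs')
    fun r _ => Hdot.continuous_profile_comp hs hs' hu.continuous_fst r
  have hdecay_const : 0 < C / (-(2 - p + 1)) := div_pos hC (by linarith)
  exact ⟨A.re, C / (-(2 - p + 1)), C, 512 * Real.pi / 3 * (8 * C) ^ 2,
    hdecay_const, hC, by positivity,
    fun t => hu.ae_abs_le_div hp₃ hrad (hw t),
    fun t => hu.ae_abs_sub_div_le hp₃ hrad (hA t),
    fun t => hu.exists_localEnergy_le hp₃ hrad hC.le (hw t) hlip_energy⟩

open RadialWave in
theorem mainTheorem3 (p : ℝ) (hp₃ : 3 < p) (hp₅ : p < 5)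
    (F : ℝ → ℝ → ℝ → ℝ)
    (hF : ∀ r : ℝ, 0 ≤ r → ∀ v t : ℝ, |F r v t| ≤ |v| ^ p)
    (u : ℝ → E3 → ℝ) (U : ℝ → Hdot (sCrit p)) (V : ℝ → Hdot (sCrit p - 1))
    (hu : IsGlobalSolution p F u U V)
    (hrad : ∀ t, IsRadial (u t))
    (hcpt : IsCompact (closure (Set.range fun t : ℝ => (U t, V t)))) :
    ∃ A C C₃ C₄ : ℝ, 0 < C ∧ 0 < C₃ ∧ 0 < C₄ ∧
      (∀ t : ℝ, ∀ᵐ x : E3, |u t x| ≤ C₃ / ‖x‖) ∧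
      (∀ t : ℝ, ∀ᵐ x : E3, |u t x - A / ‖x‖| ≤ C * ‖x‖ ^ (2 - p)) ∧
      (∀ t : ℝ, ∃ (Du : E3 → E3) (ut : E3 → ℝ),
        IsWeakGradientOn {0}ᶜ (u t) Du ∧ (V t).IsFunctionOn {0}ᶜ ut ∧
        ∀ r : ℝ, 0 < r → localEnergy r Du ut ≤ ENNReal.ofReal (C₄ * r⁻¹)) :=
  mainTheorem3_general p hp₃ F hF u U V hu hrad hcpt
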